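/- Let $T, I, J\subseteq\mathbb R$ be nonempty open intervals, let $f\colon I\to\mathbb R$ and $D,K\colon J\to\mathbb R$ be $C^\infty$ functions with $f(x)\neq 0$ on $I$ and $D(u)\neq 0$ on $J$, and assume that the equation $$f(x)\,u_t=(D(u)u_x)_x+K(u)u_x \qquad (*)$$ is nonlinear, i.e. the derivatives $D_u$ and $K_u$ are not both identically zero on $J$. Suppose that there is a Lie algebra $\mathfrak g$, of dimension at least $4$ over $\mathbb R$, of smooth vector fields $$Q=\xi^t(t,x,u)\partial_t+\xi^x(t,x,u)\partial_x+\eta(t,x,u)\partial_u$$ on $T\times I\times J$, all of which are infinitesimal symmetries of $(*)$ (Lie's infinitesimal invariance criterion: the second prolongation of $Q$ applied to $f u_t-(Du_x)_x-Ku_x$ vanishes at all second-order jets over $T\times I\times J$ that satisfy $(*)$). Then $(*)$ can be reduced by a point transformation to an equation of the same class with $f=1$: there are open intervals $I_1,J_1$, functions $D_1,K_1\in C^\infty(J_1)$ with $D_1\ne0$ on $J_1$ and with $D_{1,u},K_{1,u}$ not both identically zero on $J_1$, and a smooth diffeomorphism $\Phi\colon(t,x,u)\mapsto(\tilde t,\tilde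 x,\tilde u)$ of $T\times I\times J$ onto an open subset of $\mathbb R\times I_1\times J_1$, which maps $(*)$ to $$\tilde u_{\tilde t}=(D_1(\tilde u)\tilde u_{\tilde x})_{\tilde x}+K_1(\tilde u)\tilde u_{\tilde x}.$$ Here "maps" means: whenever $\Phi$ takes the graph of a smooth function $u=v(t,x)$, defined on an open set, into the graph of a smooth function $\tilde u=w(\tilde t,\tilde x)$, defined on an open set, $v$ satisfies $(*)$ at a point if and only if $w$ satisfies the new equation at the corresponding point. -/

import Mathlib

open scoped ContDiff

noncomputable section

/-- `S` is a nonempty open interval of the real line (bounded or not). -/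
def IsOpenInterval (S : Set ℝ) : Prop :=
  IsOpen S ∧ S.OrdConnected ∧ S.Nonempty

/-- The space of the variables `(t, x, u)`. -/
abbrev PointSpace : Type := ℝ × ℝ × ℝ

/-- The domain `T × I × J` in the space of the variables `(t, x, u)`. -/
def box (T I J : Set ℝ) : Set PointSpace := T ×ˢ (I ×ˢ J)

/-- The functions `f` on the interval `I` and `D`, `K` on the interval `J` are admissible
arbitrary elements of the class `f(x) u_t = (D(u) u_x)_x + K(u) u_x`: they are smooth,
`f D ≠ 0`, and the equation is nonlinear, i.e. `D_u` and `K_u` are not both identically zero. -/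
structure IsAdmissible (I J : Set ℝ) (f D K : ℝ → ℝ) : Prop where
  interval_x : IsOpenInterval I
  interval_u : IsOpenInterval J
  smooth_f : ContDiffOn ℝ ∞ f I
  smooth_D : ContDiffOn ℝ ∞ D J
  smooth_K : ContDiffOn ℝ ∞ K J
  f_ne_zero : ∀ x ∈ I, f x ≠ 0
  D_ne_zero : ∀ u ∈ J, D u ≠ 0
  nonlinear : ∃ u ∈ J, deriv D u ≠ 0 ∨ deriv K u ≠ 0

/-- The function `v(t, x)` satisfies `f(x) u_t = (D(u) u_x)_x + K(u) u_x` at the point `(t, x)`. -/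
def SatisfiesAt (f D K : ℝ → ℝ) (v : ℝ → ℝ → ℝ) (t x : ℝ) : Prop :=
  f x * deriv (fun s => v s x) t =
    deriv (fun y => D (v t y) * deriv (fun z => v t z) y) x
      + K (v t x) * deriv (fun y => v t y) x

/-! ### Infinitesimal symmetries -/

/-- The left-hand side `f(x) u_t - D(u) u_xx - D'(u) u_x ^ 2 - K(u) u_x` of the equation, as
a function of the jet variables `(t, x, u, u_t, u_x, u_xx)`. -/
def equationLHS (f D K : ℝ → ℝ) : ℝ × ℝ × ℝ × ℝ × ℝ × ℝ → ℝ :=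
  fun (_, x, u, ut, ux, uxx) => f x * ut - D u * uxx - deriv D u * ux ^ 2 - K u * ux

/-- The total derivative with respect to `t` of a function `F(t, x, u)`, at a first-order jet. -/
def totalDt (F : PointSpace → ℝ) : ℝ × ℝ × ℝ × ℝ × ℝ → ℝ :=
  fun (t, x, u, ut, _) => fderiv ℝ F (t, x, u) (1, 0, ut)

/-- The total derivative with respect to `x` of a function `F(t, x, u)`, at a first-order jet. -/
def totalDx (F : PointSpace → ℝ) : ℝ × ℝ × ℝ × ℝ × ℝ → ℝ :=
  fun (t, x, u, _, ux) => fderiv ℝ F (t, x, u) (0, 1, ux)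

/-- Coefficient of `∂_t` of a vector field on the space of `(t, x, u)`. -/
def xiT (Q : PointSpace → PointSpace) (p : PointSpace) : ℝ := (Q p).1

/-- Coefficient of `∂_x` of a vector field on the space of `(t, x, u)`. -/
def xiX (Q : PointSpace → PointSpace) (p : PointSpace) : ℝ := (Q p).2.1

/-- Coefficient of `∂_u` of a vector field on the space of `(t, x, u)`. -/
def eta (Q : PointSpace → PointSpace) (p : PointSpace) : ℝ := (Q p).2.2

/-- Coefficient of `∂_{u_t}` in the prolongation of `Q`:
`η^t = D_t η - u_t D_t ξ^t - u_x D_t ξ^x`. -/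
def etaT (Q : PointSpace → PointSpace) (j : ℝ × ℝ × ℝ × ℝ × ℝ) : ℝ :=
  totalDt (eta Q) j - j.2.2.2.1 * totalDt (xiT Q) j - j.2.2.2.2 * totalDt (xiX Q) j

/-- Coefficient of `∂_{u_x}` in the prolongation of `Q`:
`η^x = D_x η - u_t D_x ξ^t - u_x D_x ξ^x`. -/
def etaX (Q : PointSpace → PointSpace) (j : ℝ × ℝ × ℝ × ℝ × ℝ) : ℝ :=
  totalDx (eta Q) j - j.2.2.2.1 * totalDx (xiT Q) j - j.2.2.2.2 * totalDx (xiX Q) j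

/-- Coefficient of `∂_{u_xx}` in the second prolongation of `Q`:
`η^xx = D_x η^x - u_tx D_x ξ^t - u_xx D_x ξ^x`, where
`D_x = ∂_x + u_x ∂_u + u_tx ∂_{u_t} + u_xx ∂_{u_x}` on functions of first-order jets. -/
def etaXX (Q : PointSpace → PointSpace) (j : ℝ × ℝ × ℝ × ℝ × ℝ) (utx uxx : ℝ) : ℝ :=
  fderiv ℝ (etaX Q) j (0, 1, j.2.2.2.2, utx, uxx)
    - utx * totalDx (xiT Q) j - uxx * totalDx (xiX Q) j

/-- Lie's criterion of infinitesimal invariance over the domain `Ω`: the second prolongation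
of `Q = ξ^t ∂_t + ξ^x ∂_x + η ∂_u`, applied to the left-hand side of the equation, vanishes at
all second-order jets over `Ω` that satisfy the equation. -/
def IsInfinitesimalSymmetry (f D K : ℝ → ℝ) (Ω : Set PointSpace)
    (Q : PointSpace → PointSpace) : Prop :=
  ∀ t x u ut ux utx uxx : ℝ, (t, x, u) ∈ Ω →
    equationLHS f D K (t, x, u, ut, ux, uxx) = 0 →
    fderiv ℝ (equationLHS f D K) (t, x, u, ut, ux, uxx)
      (xiT Q (t, x, u), xiX Q (t, x, u), eta Q (t, x, u),
        etaT Q (t, x, u, ut, ux), etaX Q (t, x, u, ut, ux),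
        etaXX Q (t, x, u, ut, ux) utx uxx) = 0

/-- `𝔤` is a Lie algebra of smooth vector fields on the open set `Ω`, all of which are
infinitesimal symmetries of the equation. A vector field on `Ω` is represented by its extension
by zero to the whole space, so that fields are equal, or linearly dependent, exactly if they are
so on `Ω`. -/
structure IsInvarianceAlgebra (f D K : ℝ → ℝ) (Ω : Set PointSpace)
    (𝔤 : Submodule ℝ (PointSpace → PointSpace)) : Prop where
  smooth : ∀ Q ∈ 𝔤, ContDiffOn ℝ ∞ Q Ω
  zero_outside : ∀ Q ∈ 𝔤, ∀ p, p ∉ Ω → Q p = 0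
  symmetry : ∀ Q ∈ 𝔤, IsInfinitesimalSymmetry f D K Ω Q
  bracket_mem : ∀ Q ∈ 𝔤, ∀ R ∈ 𝔤, VectorField.lieBracket ℝ Q R ∈ 𝔤

/-! ### Point transformations -/

/-- `Φ` is a point transformation with domain `Ω`: a smooth diffeomorphism of `Ω` onto an open
subset of the space of `(t, x, u)`. -/
def IsPointTransformation (Ω : Set PointSpace)
    (Φ : OpenPartialHomeomorph PointSpace PointSpace) : Prop :=
  Φ.source = Ω ∧ ContDiffOn ℝ ∞ Φ Φ.source ∧ ContDiffOn ℝ ∞ Φ.symm Φ.target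

/-- `Φ` takes the graph of `v` over `U` into the graph of `w` over `W`. -/
def MapsGraph (Φ : PointSpace → PointSpace) (U : Set (ℝ × ℝ)) (v : ℝ → ℝ → ℝ)
    (W : Set (ℝ × ℝ)) (w : ℝ → ℝ → ℝ) : Prop :=
  ∀ t x, (t, x) ∈ U →
    ((Φ (t, x, v t x)).1, (Φ (t, x, v t x)).2.1) ∈ W ∧
      (Φ (t, x, v t x)).2.2 = w (Φ (t, x, v t x)).1 (Φ (t, x, v t x)).2.1

/-- `Φ`, defined on `Ω`, maps the equation with arbitrary elements `f, D, K` to the equation with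
arbitrary elements `f₁, D₁, K₁`: whenever it takes the graph of a smooth function `v` (lying
in `Ω`) to the graph of a smooth function `w`, the function `v` satisfies the first equation at
a point exactly if `w` satisfies the second one at the corresponding point. -/
def MapsEquation (Ω : Set PointSpace) (Φ : PointSpace → PointSpace)
    (f D K f₁ D₁ K₁ : ℝ → ℝ) : Prop :=
  ∀ (U W : Set (ℝ × ℝ)) (v w : ℝ → ℝ → ℝ), IsOpen U → IsOpen W →
    ContDiffOn ℝ ∞ (fun z : ℝ × ℝ => v z.1 z.2) U →
    ContDiffOn ℝ ∞ (fun z : ℝ × ℝ => w z.1 z.2) W →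
    (∀ t x, (t, x) ∈ U → (t, x, v t x) ∈ Ω) →
    MapsGraph Φ U v W w →
    ∀ t x, (t, x) ∈ U →
      (SatisfiesAt f D K v t x ↔
        SatisfiesAt f₁ D₁ K₁ w (Φ (t, x, v t x)).1 (Φ (t, x, v t x)).2.1)

end

/-! ### Functions on open intervals -/

theorem IsOpenInterval.isPreconnected {S : Set ℝ} (h : IsOpenInterval S) : IsPreconnected S :=
  h.2.1.isPreconnected

theorem IsOpenInterval.mem_nhds {S : Set ℝ} (h : IsOpenInterval S) {x : ℝ} (hx : x ∈ S) :
    S ∈ nhds x :=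
  h.1.mem_nhds hx

theorem IsOpenInterval.infinite {S : Set ℝ} (h : IsOpenInterval S) : S.Infinite := by
  obtain ⟨x, hx⟩ := h.2.2
  exact infinite_of_mem_nhds x (h.mem_nhds hx)

theorem IsOpenInterval.exists_ne {S : Set ℝ} (h : IsOpenInterval S) (x : ℝ) :
    ∃ y ∈ S, y ≠ x := by
  obtain ⟨y, hy, hyx⟩ := h.infinite.exists_notMem_finset {x}
  exact ⟨y, hy, by simpa using hyx⟩

theorem IsOpenInterval.eq_of_hasDerivAt_zero {S : Set ℝ} (h : IsOpenInterval S) {g : ℝ → ℝ}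
    (hg : ∀ x ∈ S, HasDerivAt g 0 x) {x y : ℝ} (hx : x ∈ S) (hy : y ∈ S) : g x = g y :=
  h.1.is_const_of_deriv_eq_zero h.isPreconnected
    (fun z hz => (hg z hz).differentiableAt.differentiableWithinAt)
    (fun z hz => (hg z hz).deriv) hx hy

theorem IsOpenInterval.eq_zero_of_hasDerivAt {S : Set ℝ} (h : IsOpenInterval S) {g g' : ℝ → ℝ}
    {c : ℝ} (hg : ∀ x ∈ S, HasDerivAt g (g' x) x) (hc : ∀ x ∈ S, g x = c) :
    ∀ x ∈ S, g' x = 0 := by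
  intro x hx
  have h1 : HasDerivAt g 0 x :=
    (hasDerivAt_const x c).congr_of_eventuallyEq
      (Filter.eventually_of_mem (h.mem_nhds hx) hc)
  exact (hg x hx).unique h1

/-- A continuous function vanishing off a point of an open set vanishes on the set. -/
theorem eq_zero_of_eq_zero_off_point {S : Set ℝ} (hS : IsOpen S) {g : ℝ → ℝ}
    (hg : ContinuousOn g S) (c : ℝ) (h : ∀ x ∈ S, x ≠ c → g x = 0) : ∀ x ∈ S, g x = 0 := by
  intro x hx
  by_cases hxc : x = c
  · have h1 : Filter.Tendsto g (nhdsWithin x {x}ᶜ) (nhds (g x)) :=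
      (hg.continuousAt (hS.mem_nhds hx)).tendsto.mono_left nhdsWithin_le_nhds
    have h2 : Filter.Tendsto g (nhdsWithin x {x}ᶜ) (nhds 0) := by
      refine Filter.Tendsto.congr' ?_ tendsto_const_nhds
      filter_upwards [self_mem_nhdsWithin, mem_nhdsWithin_of_mem_nhds (hS.mem_nhds hx)] with y hy hyS
      exact (h y hyS (by rw [← hxc]; exact hy)).symm
    exact tendsto_nhds_unique h1 h2
  · exact h x hx hxc

theorem eq_zero_of_affine_mul_eq_zero {S : Set ℝ} (hS : IsOpen S) {g : ℝ → ℝ}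
    (hg : ContinuousOn g S) {a b : ℝ} (hab : a ≠ 0 ∨ b ≠ 0)
    (h : ∀ x ∈ S, (a * x + b) * g x = 0) : ∀ x ∈ S, g x = 0 := by
  by_cases ha : a = 0
  · have hb : b ≠ 0 := by tauto
    intro x hx
    have := h x hx
    rw [ha, zero_mul, zero_add] at this
    exact (mul_eq_zero.1 this).resolve_left hb
  · refine eq_zero_of_eq_zero_off_point hS hg (-b / a) fun x hx hxc => ?_
    refine (mul_eq_zero.1 (h x hx)).resolve_left fun h0 => hxc ?_
    field_simp
    linarith

/-- A cubic polynomial with infinitely many roots is zero. -/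
theorem cubic_eq_zero {S : Set ℝ} (hS : S.Infinite) {a b c d : ℝ}
    (h : ∀ y ∈ S, a + b * y + c * y ^ 2 + d * y ^ 3 = 0) : a = 0 ∧ b = 0 ∧ c = 0 ∧ d = 0 := by
  open Polynomial in
  have hp : (C a + C b * X + C c * X ^ 2 + C d * X ^ 3 : ℝ[X]) = 0 := by
    refine Polynomial.eq_zero_of_infinite_isRoot _ (hS.mono fun y hy => ?_)
    simpa [Polynomial.IsRoot] using h y hy
  have h0 := congrArg (fun p => Polynomial.coeff p 0) hp
  have h1 := congrArg (fun p => Polynomial.coeff p 1) hp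
  have h2 := congrArg (fun p => Polynomial.coeff p 2) hp
  have h3 := congrArg (fun p => Polynomial.coeff p 3) hp
  simp [Polynomial.coeff_X, Polynomial.coeff_X_pow, Polynomial.coeff_C] at h0 h1 h2 h3
  exact ⟨h0, h1, h2, h3⟩

/-! ### Primitives of exponentials -/

/-- The primitive of `s ↦ exp (m * s)` vanishing at `0`. -/
noncomputable def expInt (m s : ℝ) : ℝ := if m = 0 then s else (Real.exp (m * s) - 1) / m

theorem one_add_mul_expInt (m s : ℝ) : 1 + m * expInt m s = Real.exp (m * s) := by
  unfold expInt
  split_ifs with h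
  · simp [h]
  · field_simp
    ring

@[simp] theorem expInt_zero (m : ℝ) : expInt m 0 = 0 := by
  simp [expInt]

theorem hasDerivAt_expInt (m s : ℝ) : HasDerivAt (expInt m) (Real.exp (m * s)) s := by
  by_cases h : m = 0
  · have : expInt m = fun s => s := by ext; simp [expInt, h]
    rw [this, h, zero_mul, Real.exp_zero]
    exact hasDerivAt_id' s
  · have h1 : expInt m = fun s => (Real.exp (m * s) - 1) / m := by ext; simp [expInt, h]
    rw [h1]
    have h2 := ((((hasDerivAt_id' s).const_mul m).exp.sub_const 1).div_const m)
    exact h2.congr_deriv (by rw [mul_one, mul_div_assoc, div_self h, mul_one])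

theorem contDiff_expInt (m : ℝ) : ContDiff ℝ ∞ (expInt m) := by
  by_cases h : m = 0
  · have : expInt m = fun s => s := by ext; simp [expInt, h]
    rw [this]
    exact contDiff_id
  · have h1 : expInt m = fun s => (Real.exp (m * s) - 1) / m := by ext; simp [expInt, h]
    rw [h1]
    fun_prop

theorem strictMono_expInt (m : ℝ) : StrictMono (expInt m) :=
  strictMono_of_deriv_pos fun s => by
    rw [(hasDerivAt_expInt m s).deriv]
    exact Real.exp_pos _

theorem expInt_eq_zero_iff {m s : ℝ} : expInt m s = 0 ↔ s = 0 := by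
  refine ⟨fun h => (strictMono_expInt m).injective ?_, fun h => ?_⟩
  · rw [h, expInt_zero]
  · rw [h, expInt_zero]

theorem hasDerivAt_expInt_sub (m c x : ℝ) :
    HasDerivAt (fun y => expInt m (y - c)) (Real.exp (m * (x - c))) x := by
  exact ((hasDerivAt_expInt m (x - c)).comp x ((hasDerivAt_id' x).sub_const c)).congr_deriv
    (mul_one _)

/-- The solutions of `g'' = m g'`. -/
theorem IsOpenInterval.eq_of_deriv_deriv {S : Set ℝ} (h : IsOpenInterval S) {g g₁ : ℝ → ℝ} {m : ℝ}
    (hg : ∀ x ∈ S, HasDerivAt g (g₁ x) x) (hg₁ : ∀ x ∈ S, HasDerivAt g₁ (m * g₁ x) x)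
    {c x : ℝ} (hc : c ∈ S) (hx : x ∈ S) :
    g₁ x = g₁ c * Real.exp (m * (x - c)) ∧ g x = g c + g₁ c * expInt m (x - c) := by
  have key : ∀ y ∈ S, g₁ y = g₁ c * Real.exp (m * (y - c)) := by
    intro y hy
    have h1 : ∀ z ∈ S, HasDerivAt (fun z => g₁ z * Real.exp (-m * (z - c))) 0 z := by
      intro z hz
      have h2 : HasDerivAt (fun z => Real.exp (-m * (z - c)))
          (Real.exp (-m * (z - c)) * (-m)) z := by
        simpa using (((hasDerivAt_id' z).sub_const c).const_mul (-m)).exp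
      refine ((hg₁ z hz).mul h2).congr_deriv ?_
      ring
    have h3 := h.eq_of_hasDerivAt_zero h1 hy hc
    simp only [sub_self, mul_zero, Real.exp_zero, mul_one] at h3
    rw [← h3, mul_assoc, ← Real.exp_add]
    simp
  refine ⟨key x hx, ?_⟩
  have h1 : ∀ z ∈ S, HasDerivAt (fun z => g z - g₁ c * expInt m (z - c)) 0 z := by
    intro z hz
    refine ((hg z hz).sub ((hasDerivAt_expInt_sub m c z).const_mul (g₁ c))).congr_deriv ?_
    rw [key z hz]
    ring
  have h3 := h.eq_of_hasDerivAt_zero h1 hx hc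
  simp only [sub_self, expInt_zero, mul_zero, sub_zero] at h3
  linarith

/-- The solutions of `g' = m g`. -/
theorem IsOpenInterval.eq_mul_exp {S : Set ℝ} (h : IsOpenInterval S) {g : ℝ → ℝ} {m : ℝ}
    (hg : ∀ x ∈ S, HasDerivAt g (m * g x) x) {c x : ℝ} (hc : c ∈ S) (hx : x ∈ S) :
    g x = g c * Real.exp (m * (x - c)) := by
  have h1 : ∀ z ∈ S, HasDerivAt (fun z => g z * Real.exp (-m * (z - c))) 0 z := by
    intro z hz
    have h2 : HasDerivAt (fun z => Real.exp (-m * (z - c)))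
        (Real.exp (-m * (z - c)) * (-m)) z := by
      simpa using (((hasDerivAt_id' z).sub_const c).const_mul (-m)).exp
    refine ((hg z hz).mul h2).congr_deriv ?_
    ring
  have h3 := h.eq_of_hasDerivAt_zero h1 hx hc
  simp only [sub_self, mul_zero, Real.exp_zero, mul_one] at h3
  rw [← h3, mul_assoc, ← Real.exp_add]
  simp

/-! ### Diffeomorphisms -/

/-- An injective smooth map with invertible derivative on an open set is a diffeomorphism onto an
open set. -/
theorem exists_isPointTransformation {Ω : Set PointSpace} (hΩ : IsOpen Ω)
    {Φ : PointSpace → PointSpace} (hΦ : ContDiffOn ℝ ∞ Φ Ω) (hinj : Set.InjOn Φ Ω)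
    (hker : ∀ p ∈ Ω, ∀ v, fderiv ℝ Φ p v = 0 → v = 0) :
    ∃ e : OpenPartialHomeomorph PointSpace PointSpace,
      IsPointTransformation Ω e ∧ (e : PointSpace → PointSpace) = Φ := by
  have hequiv : ∀ p ∈ Ω, ∃ L : PointSpace ≃L[ℝ] PointSpace,
      (L : PointSpace →L[ℝ] PointSpace) = fderiv ℝ Φ p := by
    intro p hp
    have hi : Function.Injective (fderiv ℝ Φ p : PointSpace →ₗ[ℝ] PointSpace) :=
      (injective_iff_map_eq_zero _).2 (hker p hp)
    refine ⟨(LinearEquiv.ofInjectiveEndo _ hi).toContinuousLinearEquiv, ?_⟩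
    exact ContinuousLinearMap.ext fun v => rfl
  have hat : ∀ p ∈ Ω, ContDiffAt ℝ ∞ Φ p := fun p hp => hΦ.contDiffAt (hΩ.mem_nhds hp)
  have hopen : IsOpenMap (Ω.domRestrict Φ) := by
    refine isOpenMap_iff_nhds_le.2 fun p => ?_
    obtain ⟨L, hL⟩ := hequiv p p.2
    have h1 : HasStrictFDerivAt Φ (L : PointSpace →L[ℝ] PointSpace) (p : PointSpace) := by
      rw [hL]
      exact (hat p p.2).hasStrictFDerivAt (by simp)
    have h2 := h1.map_nhds_eq_of_equiv
    have h3 : Filter.map ((↑) : Ω → PointSpace) (nhds p) = nhds (p : PointSpace) :=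
      map_nhds_subtype_val p |>.trans (hΩ.nhdsWithin_eq p.2)
    have h4 : Set.domRestrict Ω Φ = Φ ∘ ((↑) : Ω → PointSpace) := rfl
    have h5 : Filter.map (Set.domRestrict Ω Φ) (nhds p) = nhds (Φ p) := by
      rw [h4, ← Filter.map_map, h3, h2]
    exact h5.ge
  let e := OpenPartialHomeomorph.ofContinuousOpenRestrict (hinj.toPartialEquiv Φ Ω)
    hΦ.continuousOn hopen hΩ
  have he : (e : PointSpace → PointSpace) = Φ := rfl
  have hs : e.source = Ω := rfl
  refine ⟨e, ⟨hs, hΦ, fun y hy => ?_⟩, he⟩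
  have hmem : e.symm y ∈ Ω := e.map_target hy
  obtain ⟨L, hL⟩ := hequiv _ hmem
  refine (e.contDiffAt_symm (f₀' := L) hy ?_ (hat _ hmem)).contDiffWithinAt
  rw [he, hL]
  exact ((hat _ hmem).differentiableAt (by simp)).hasFDerivAt

/-! ### Vector fields in the kernel of functionals -/

theorem exists_ne_zero_of_four_le_rank {V : Type} [AddCommGroup V] [Module ℝ V]
    {S : Submodule ℝ V} (hdim : 4 ≤ Module.rank ℝ S) (l : V →ₗ[ℝ] Fin 3 → ℝ) :
    ∃ Q ∈ S, Q ≠ 0 ∧ l Q = 0 := by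
  by_contra hcon
  push Not at hcon
  have hinj : Function.Injective (l ∘ₗ S.subtype) := by
    refine (injective_iff_map_eq_zero _).2 fun Q hQ => ?_
    by_contra h0
    exact hcon Q Q.2 (fun h => h0 (Subtype.ext h)) hQ
  have h1 := LinearMap.rank_le_of_injective _ hinj
  rw [rank_fin_fun] at h1
  have h2 : ((4 : ℕ) : Cardinal) ≤ ((3 : ℕ) : Cardinal) := le_trans (by exact_mod_cast hdim) h1
  have h3 : 4 ≤ 3 := by exact_mod_cast h2
  omega

/-! ### Partial derivatives of functions of `(t, x, u)` -/

theorem isOpen_box {T I J : Set ℝ} (hT : IsOpen T) (hI : IsOpen I) (hJ : IsOpen J) :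
    IsOpen (box T I J) :=
  hT.prod (hI.prod hJ)

/-- The partial derivative with respect to `t`. -/
noncomputable def pdt (F : PointSpace → ℝ) (p : PointSpace) : ℝ := fderiv ℝ F p (1, 0, 0)

/-- The partial derivative with respect to `x`. -/
noncomputable def pdx (F : PointSpace → ℝ) (p : PointSpace) : ℝ := fderiv ℝ F p (0, 1, 0)

/-- The partial derivative with respect to `u`. -/
noncomputable def pdu (F : PointSpace → ℝ) (p : PointSpace) : ℝ := fderiv ℝ F p (0, 0, 1)

theorem fderiv_eq_partials (F : PointSpace → ℝ) (p : PointSpace) (a b c : ℝ) :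
    fderiv ℝ F p (a, b, c) = a * pdt F p + b * pdx F p + c * pdu F p := by
  have : ((a, b, c) : PointSpace) = a • (1, 0, 0) + b • (0, 1, 0) + c • (0, 0, 1) := by
    simp
  rw [this, map_add, map_add, map_smul, map_smul, map_smul]
  rfl

theorem fderiv_fderiv_eq {F : PointSpace → ℝ} {p : PointSpace} (hF : ContDiffAt ℝ ∞ F p)
    (v w : PointSpace) :
    fderiv ℝ (fderiv ℝ F) p v w = fderiv ℝ (fun q => fderiv ℝ F q w) p v := by
  have h1 : DifferentiableAt ℝ (fderiv ℝ F) p :=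
    (hF.fderiv_right (m := 1) (by norm_cast)).differentiableAt (by simp)
  have h2 := h1.hasFDerivAt.clm_apply (hasFDerivAt_const w p)
  rw [h2.fderiv]
  simp

theorem second_total_eq {F : PointSpace → ℝ} {p : PointSpace} (hF : ContDiffAt ℝ ∞ F p) (c : ℝ) :
    fderiv ℝ (fderiv ℝ F) p (0, 1, c) (0, 1, c) =
      pdx (pdx F) p + c * (pdx (pdu F) p + pdu (pdx F) p) + c ^ 2 * pdu (pdu F) p := by
  have h : ((0, 1, c) : PointSpace) = (0, 1, 0) + c • (0, 0, 1) := by simp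
  have h1 : fderiv ℝ (fderiv ℝ F) p (0, 1, c) (0, 1, c) =
      fderiv ℝ (fderiv ℝ F) p (0, 1, c) (0, 1, 0)
        + c * fderiv ℝ (fderiv ℝ F) p (0, 1, c) (0, 0, 1) := by
    conv_lhs => rw [show fderiv ℝ (fderiv ℝ F) p (0, 1, c) (0, 1, c) =
      fderiv ℝ (fderiv ℝ F) p (0, 1, c) ((0, 1, 0) + c • (0, 0, 1)) by rw [← h]]
    rw [map_add, map_smul, smul_eq_mul]
  rw [h1, fderiv_fderiv_eq hF, fderiv_fderiv_eq hF]
  change fderiv ℝ (pdx F) p (0, 1, c) + c * fderiv ℝ (pdu F) p (0, 1, c) = _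
  rw [fderiv_eq_partials, fderiv_eq_partials]
  ring

theorem hasFDerivAt_totalDx {F : PointSpace → ℝ} {t x u ut ux : ℝ}
    (hF : ContDiffAt ℝ ∞ F (t, x, u)) :
    ∃ L : ℝ × ℝ × ℝ × ℝ × ℝ →L[ℝ] ℝ, HasFDerivAt (totalDx F) L (t, x, u, ut, ux) ∧
      ∀ a b c d e, L (a, b, c, d, e) =
        fderiv ℝ (fderiv ℝ F) (t, x, u) (a, b, c) (0, 1, ux) + fderiv ℝ F (t, x, u) (0, 0, e) := by
  have h1 : HasFDerivAt (fderiv ℝ F) (fderiv ℝ (fderiv ℝ F) (t, x, u)) (t, x, u) :=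
    ((hF.fderiv_right (m := 1) (by norm_cast)).differentiableAt (by simp)).hasFDerivAt
  let π : ℝ × ℝ × ℝ × ℝ × ℝ →L[ℝ] PointSpace :=
    (ContinuousLinearMap.fst ℝ _ _).prod
      (((ContinuousLinearMap.fst ℝ _ _).comp (ContinuousLinearMap.snd ℝ _ _)).prod
        ((ContinuousLinearMap.fst ℝ _ _).comp
          ((ContinuousLinearMap.snd ℝ _ _).comp (ContinuousLinearMap.snd ℝ _ _))))
  let ε : ℝ × ℝ × ℝ × ℝ × ℝ →L[ℝ] PointSpace :=
    (0 : ℝ × ℝ × ℝ × ℝ × ℝ →L[ℝ] ℝ).prod ((0 : ℝ × ℝ × ℝ × ℝ × ℝ →L[ℝ] ℝ).prod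
      ((ContinuousLinearMap.snd ℝ _ _).comp ((ContinuousLinearMap.snd ℝ _ _).comp
        ((ContinuousLinearMap.snd ℝ _ _).comp (ContinuousLinearMap.snd ℝ _ _)))))
  have h2 : HasFDerivAt (fun j => fderiv ℝ F (π j))
      ((fderiv ℝ (fderiv ℝ F) (t, x, u)).comp π) (t, x, u, ut, ux) :=
    HasFDerivAt.comp (t, x, u, ut, ux) (g := fderiv ℝ F) (f := π) h1 π.hasFDerivAt
  have h3 : HasFDerivAt (fun j => ((0, 1, 0) : PointSpace) + ε j) ε (t, x, u, ut, ux) :=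
    ε.hasFDerivAt.const_add _
  have h4 := h2.clm_apply h3
  refine ⟨_, h4.congr_of_eventuallyEq (Filter.Eventually.of_forall ?_), ?_⟩
  · rintro ⟨a, b, c, d, e⟩
    simp [totalDx, π, ε]
  · intro a b c d e
    simp [π, ε]
    ring

theorem etaXX_eq {Q : PointSpace → PointSpace} {t x u : ℝ} (hQ : ContDiffAt ℝ ∞ Q (t, x, u))
    (ut ux utx uxx : ℝ) :
    let p := (t, x, u)
    etaXX Q (t, x, u, ut, ux) utx uxx =
      (pdx (pdx (eta Q)) p + ux * (pdx (pdu (eta Q)) p + pdu (pdx (eta Q)) p)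
        + ux ^ 2 * pdu (pdu (eta Q)) p + uxx * pdu (eta Q) p)
      - ut * (pdx (pdx (xiT Q)) p + ux * (pdx (pdu (xiT Q)) p + pdu (pdx (xiT Q)) p)
        + ux ^ 2 * pdu (pdu (xiT Q)) p + uxx * pdu (xiT Q) p)
      - ux * (pdx (pdx (xiX Q)) p + ux * (pdx (pdu (xiX Q)) p + pdu (pdx (xiX Q)) p)
        + ux ^ 2 * pdu (pdu (xiX Q)) p + uxx * pdu (xiX Q) p)
      - 2 * utx * (pdx (xiT Q) p + ux * pdu (xiT Q) p)
      - 2 * uxx * (pdx (xiX Q) p + ux * pdu (xiX Q) p) := by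
  intro p
  have hη : ContDiffAt ℝ ∞ (eta Q) (t, x, u) := hQ.snd.snd
  have hT : ContDiffAt ℝ ∞ (xiT Q) (t, x, u) := hQ.fst
  have hX : ContDiffAt ℝ ∞ (xiX Q) (t, x, u) := hQ.snd.fst
  obtain ⟨L1, h1, h1'⟩ := hasFDerivAt_totalDx (ut := ut) (ux := ux) hη
  obtain ⟨L2, h2, h2'⟩ := hasFDerivAt_totalDx (ut := ut) (ux := ux) hT
  obtain ⟨L3, h3, h3'⟩ := hasFDerivAt_totalDx (ut := ut) (ux := ux) hX
  let c4 : ℝ × ℝ × ℝ × ℝ × ℝ →L[ℝ] ℝ := (ContinuousLinearMap.fst ℝ _ _).comp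
      ((ContinuousLinearMap.snd ℝ _ _).comp
        ((ContinuousLinearMap.snd ℝ _ _).comp (ContinuousLinearMap.snd ℝ _ _)))
  let c5 : ℝ × ℝ × ℝ × ℝ × ℝ →L[ℝ] ℝ := (ContinuousLinearMap.snd ℝ _ _).comp
      ((ContinuousLinearMap.snd ℝ _ _).comp
        ((ContinuousLinearMap.snd ℝ _ _).comp (ContinuousLinearMap.snd ℝ _ _)))
  have h4 : HasFDerivAt (etaX Q) _ (t, x, u, ut, ux) :=
    (h1.sub (c4.hasFDerivAt.mul h2)).sub (c5.hasFDerivAt.mul h3)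
  unfold etaXX
  rw [h4.fderiv]
  simp only [sub_apply, add_apply,
    smul_apply, h1', h2', h3', second_total_eq hη, second_total_eq hT,
    second_total_eq hX, c4, c5, ContinuousLinearMap.comp_apply, ContinuousLinearMap.coe_fst',
    ContinuousLinearMap.coe_snd', smul_eq_mul, totalDx, fderiv_eq_partials, p]
  ring

theorem fderiv_equationLHS {f D K : ℝ → ℝ} {x u : ℝ} (hf : DifferentiableAt ℝ f x)
    (hD : DifferentiableAt ℝ D u) (hD' : DifferentiableAt ℝ (deriv D) u)
    (hK : DifferentiableAt ℝ K u) (t ut ux uxx a b c d e g : ℝ) :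
    fderiv ℝ (equationLHS f D K) (t, x, u, ut, ux, uxx) (a, b, c, d, e, g) =
      b * deriv f x * ut + f x * d - c * deriv D u * uxx - D u * g
        - c * deriv (deriv D) u * ux ^ 2 - 2 * deriv D u * ux * e
        - c * deriv K u * ux - K u * e := by
  let j : ℝ × ℝ × ℝ × ℝ × ℝ × ℝ := (t, x, u, ut, ux, uxx)
  let s1 : ℝ × ℝ × ℝ × ℝ × ℝ × ℝ →L[ℝ] ℝ × ℝ × ℝ × ℝ × ℝ := ContinuousLinearMap.snd ℝ _ _
  let s2 : ℝ × ℝ × ℝ × ℝ × ℝ × ℝ →L[ℝ] ℝ × ℝ × ℝ × ℝ :=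
    (ContinuousLinearMap.snd ℝ _ _).comp s1
  let s3 : ℝ × ℝ × ℝ × ℝ × ℝ × ℝ →L[ℝ] ℝ × ℝ × ℝ := (ContinuousLinearMap.snd ℝ _ _).comp s2
  let s4 : ℝ × ℝ × ℝ × ℝ × ℝ × ℝ →L[ℝ] ℝ × ℝ := (ContinuousLinearMap.snd ℝ _ _).comp s3
  let cx : ℝ × ℝ × ℝ × ℝ × ℝ × ℝ →L[ℝ] ℝ := (ContinuousLinearMap.fst ℝ _ _).comp s1
  let cu : ℝ × ℝ × ℝ × ℝ × ℝ × ℝ →L[ℝ] ℝ := (ContinuousLinearMap.fst ℝ _ _).comp s2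
  let cut : ℝ × ℝ × ℝ × ℝ × ℝ × ℝ →L[ℝ] ℝ := (ContinuousLinearMap.fst ℝ _ _).comp s3
  let cux : ℝ × ℝ × ℝ × ℝ × ℝ × ℝ →L[ℝ] ℝ := (ContinuousLinearMap.fst ℝ _ _).comp s4
  let cuxx : ℝ × ℝ × ℝ × ℝ × ℝ × ℝ →L[ℝ] ℝ := (ContinuousLinearMap.snd ℝ _ _).comp s4
  have hf' : HasFDerivAt (fun j => f (cx j)) (deriv f x • cx) j :=
    HasDerivAt.comp_hasFDerivAt (h₂ := f) (f := cx) j hf.hasDerivAt cx.hasFDerivAt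
  have hD1 : HasFDerivAt (fun j => D (cu j)) (deriv D u • cu) j :=
    HasDerivAt.comp_hasFDerivAt (h₂ := D) (f := cu) j hD.hasDerivAt cu.hasFDerivAt
  have hD2 : HasFDerivAt (fun j => deriv D (cu j)) (deriv (deriv D) u • cu) j :=
    HasDerivAt.comp_hasFDerivAt (h₂ := deriv D) (f := cu) j hD'.hasDerivAt cu.hasFDerivAt
  have hK1 : HasFDerivAt (fun j => K (cu j)) (deriv K u • cu) j :=
    HasDerivAt.comp_hasFDerivAt (h₂ := K) (f := cu) j hK.hasDerivAt cu.hasFDerivAt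
  have h : HasFDerivAt (equationLHS f D K) _ j :=
    (((hf'.mul cut.hasFDerivAt).sub (hD1.mul cuxx.hasFDerivAt)).sub
      (hD2.mul (cux.hasFDerivAt.pow 2))).sub (hK1.mul cux.hasFDerivAt)
  change fderiv ℝ (equationLHS f D K) j _ = _
  rw [h.fderiv]
  simp [j, cx, cu, cut, cux, cuxx, s1, s2, s3, s4]
  ring

/-! ### Determining equations -/

theorem IsAdmissible.differentiableAt_f {I J : Set ℝ} {f D K : ℝ → ℝ}
    (h : IsAdmissible I J f D K) {x : ℝ} (hx : x ∈ I) : DifferentiableAt ℝ f x :=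
  (h.smooth_f.contDiffAt (h.interval_x.mem_nhds hx)).differentiableAt (by simp)

theorem IsAdmissible.differentiableAt_D {I J : Set ℝ} {f D K : ℝ → ℝ}
    (h : IsAdmissible I J f D K) {u : ℝ} (hu : u ∈ J) : DifferentiableAt ℝ D u :=
  (h.smooth_D.contDiffAt (h.interval_u.mem_nhds hu)).differentiableAt (by simp)

theorem IsAdmissible.differentiableAt_K {I J : Set ℝ} {f D K : ℝ → ℝ}
    (h : IsAdmissible I J f D K) {u : ℝ} (hu : u ∈ J) : DifferentiableAt ℝ K u :=
  (h.smooth_K.contDiffAt (h.interval_u.mem_nhds hu)).differentiableAt (by simp)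

theorem ContDiffOn.contDiffOn_deriv {S : Set ℝ} (hS : IsOpen S) {g : ℝ → ℝ}
    (hg : ContDiffOn ℝ ∞ g S) : ContDiffOn ℝ ∞ (deriv g) S :=
  hg.deriv_of_isOpen hS (by simp)

theorem ContDiffOn.hasDerivAt_of_isOpen {S : Set ℝ} (hS : IsOpen S) {g : ℝ → ℝ}
    (hg : ContDiffOn ℝ ∞ g S) {x : ℝ} (hx : x ∈ S) : HasDerivAt g (deriv g x) x :=
  ((hg.contDiffAt (hS.mem_nhds hx)).differentiableAt (by simp)).hasDerivAt

theorem IsAdmissible.differentiableAt_deriv_D {I J : Set ℝ} {f D K : ℝ → ℝ}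
    (h : IsAdmissible I J f D K) {u : ℝ} (hu : u ∈ J) : DifferentiableAt ℝ (deriv D) u :=
  ((h.smooth_D.contDiffOn_deriv h.interval_u.1).hasDerivAt_of_isOpen
    h.interval_u.1 hu).differentiableAt

section

variable {T I J : Set ℝ} {f D K : ℝ → ℝ} {Q : PointSpace → PointSpace}

theorem lie_identity (hT : IsOpenInterval T) (hadm : IsAdmissible I J f D K)
    (hQ : ContDiffOn ℝ ∞ Q (box T I J)) (hs : IsInfinitesimalSymmetry f D K (box T I J) Q)
    {t x u : ℝ} (ht : t ∈ T) (hx : x ∈ I) (hu : u ∈ J) (ut ux utx uxx : ℝ)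
    (h : f x * ut = D u * uxx + deriv D u * ux ^ 2 + K u * ux) :
    let p := (t, x, u)
    xiX Q p * deriv f x * ut
      + f x * (pdt (eta Q) p + ut * pdu (eta Q) p - ut * (pdt (xiT Q) p + ut * pdu (xiT Q) p)
        - ux * (pdt (xiX Q) p + ut * pdu (xiX Q) p))
      - eta Q p * (deriv D u * uxx + deriv (deriv D) u * ux ^ 2 + deriv K u * ux)
      - (2 * deriv D u * ux + K u) * (pdx (eta Q) p + ux * pdu (eta Q) p
        - ut * (pdx (xiT Q) p + ux * pdu (xiT Q) p) - ux * (pdx (xiX Q) p + ux * pdu (xiX Q) p))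
      - D u * ((pdx (pdx (eta Q)) p + ux * (pdx (pdu (eta Q)) p + pdu (pdx (eta Q)) p)
        + ux ^ 2 * pdu (pdu (eta Q)) p + uxx * pdu (eta Q) p)
      - ut * (pdx (pdx (xiT Q)) p + ux * (pdx (pdu (xiT Q)) p + pdu (pdx (xiT Q)) p)
        + ux ^ 2 * pdu (pdu (xiT Q)) p + uxx * pdu (xiT Q) p)
      - ux * (pdx (pdx (xiX Q)) p + ux * (pdx (pdu (xiX Q)) p + pdu (pdx (xiX Q)) p)
        + ux ^ 2 * pdu (pdu (xiX Q)) p + uxx * pdu (xiX Q) p)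
      - 2 * utx * (pdx (xiT Q) p + ux * pdu (xiT Q) p)
      - 2 * uxx * (pdx (xiX Q) p + ux * pdu (xiX Q) p)) = 0 := by
  intro p
  have hΩ := isOpen_box hT.1 hadm.interval_x.1 hadm.interval_u.1
  have hp : (t, x, u) ∈ box T I J := ⟨ht, hx, hu⟩
  have h1 := hs t x u ut ux utx uxx hp (by simp only [equationLHS]; linarith)
  rw [fderiv_equationLHS (hadm.differentiableAt_f hx) (hadm.differentiableAt_D hu)
    (hadm.differentiableAt_deriv_D hu) (hadm.differentiableAt_K hu),
    etaXX_eq (hQ.contDiffAt (hΩ.mem_nhds hp))] at h1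
  simp only [etaT, etaX, totalDt, totalDx, fderiv_eq_partials] at h1
  simp only [p]
  linear_combination h1

theorem pd_xiT_eq_zero (hT : IsOpenInterval T) (hadm : IsAdmissible I J f D K)
    (hQ : ContDiffOn ℝ ∞ Q (box T I J)) (hs : IsInfinitesimalSymmetry f D K (box T I J) Q)
    {p : PointSpace} (hp : p ∈ box T I J) : pdx (xiT Q) p = 0 ∧ pdu (xiT Q) p = 0 := by
  obtain ⟨t, x, u⟩ := p
  obtain ⟨ht, hx, hu⟩ := hp
  have hf := hadm.f_ne_zero x hx
  have hD := hadm.D_ne_zero u hu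
  have key : ∀ ux : ℝ, pdx (xiT Q) (t, x, u) + ux * pdu (xiT Q) (t, x, u) = 0 := by
    intro ux
    have h0 : f x * ((deriv D u * ux ^ 2 + K u * ux) / f x)
        = D u * 0 + deriv D u * ux ^ 2 + K u * ux := by
      field_simp
      ring
    have h1 := lie_identity hT hadm hQ hs ht hx hu _ ux 0 0 h0
    have h2 := lie_identity hT hadm hQ hs ht hx hu _ ux 1 0 h0
    have h3 : D u * (pdx (xiT Q) (t, x, u) + ux * pdu (xiT Q) (t, x, u)) = 0 := by
      linear_combination (h2 - h1) / 2
    exact (mul_eq_zero.1 h3).resolve_left hD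
  have h0 := key 0
  have h1 := key 1
  constructor <;> linarith

theorem pd_eq_zero_of_eqOn_zero {Ω : Set PointSpace} (hΩ : IsOpen Ω) {G : PointSpace → ℝ}
    (hG : ∀ p ∈ Ω, G p = 0) {p : PointSpace} (hp : p ∈ Ω) : pdx G p = 0 ∧ pdu G p = 0 := by
  have h : fderiv ℝ G p = 0 := by
    have h1 : G =ᶠ[nhds p] fun _ => 0 := Filter.eventually_of_mem (hΩ.mem_nhds hp) hG
    rw [h1.fderiv_eq, fderiv_const_apply]
  simp [pdx, pdu, h]

theorem pdu_xiX_eq_zero (hT : IsOpenInterval T) (hadm : IsAdmissible I J f D K)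
    (hQ : ContDiffOn ℝ ∞ Q (box T I J)) (hs : IsInfinitesimalSymmetry f D K (box T I J) Q)
    {p : PointSpace} (hp : p ∈ box T I J) : pdu (xiX Q) p = 0 := by
  have hΩ := isOpen_box hT.1 hadm.interval_x.1 hadm.interval_u.1
  obtain ⟨h1, h2⟩ := pd_xiT_eq_zero hT hadm hQ hs hp
  obtain ⟨h3, h4⟩ := pd_eq_zero_of_eqOn_zero hΩ
    (fun q hq => (pd_xiT_eq_zero hT hadm hQ hs hq).1) hp
  obtain ⟨h5, h6⟩ := pd_eq_zero_of_eqOn_zero hΩ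
    (fun q hq => (pd_xiT_eq_zero hT hadm hQ hs hq).2) hp
  obtain ⟨t, x, u⟩ := p
  obtain ⟨ht, hx, hu⟩ := hp
  have hf := hadm.f_ne_zero x hx
  have hD := hadm.D_ne_zero u hu
  have key : ∀ ux uxx : ℝ, _ := fun ux uxx =>
    lie_identity hT hadm hQ hs ht hx hu ((D u * uxx + deriv D u * ux ^ 2 + K u * ux) / f x) ux 0 uxx
      (mul_div_cancel₀ _ hf)
  simp only [h1, h2, h3, h4, h5, h6] at key
  have k00 := key 0 0
  have k10 := key 1 0
  have k01 := key 0 1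
  have k11 := key 1 1
  field_simp at k00 k10 k01 k11
  have h : D u * pdu (xiX Q) (t, x, u) * f x = 0 := by
    linear_combination (k11 - k10 - k01 + k00) / 2
  simpa [hD, hf] using h

theorem determining_equations_partials (hT : IsOpenInterval T) (hadm : IsAdmissible I J f D K)
    (hQ : ContDiffOn ℝ ∞ Q (box T I J)) (hs : IsInfinitesimalSymmetry f D K (box T I J) Q)
    {t x u : ℝ} (ht : t ∈ T) (hx : x ∈ I) (hu : u ∈ J) :
    let p := (t, x, u)
    D u * (xiX Q p * deriv f x - f x * pdt (xiT Q) p + 2 * f x * pdx (xiX Q) p)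
        = f x * (eta Q p * deriv D u) ∧
      deriv D u * (xiX Q p * deriv f x - f x * pdt (xiT Q) p + 2 * f x * pdx (xiX Q) p)
        = f x * (eta Q p * deriv (deriv D) u + pdu (eta Q) p * deriv D u
          + D u * pdu (pdu (eta Q)) p) ∧
      K u * (xiX Q p * deriv f x - f x * pdt (xiT Q) p + f x * pdx (xiX Q) p)
        = f x * (f x * pdt (xiX Q) p + eta Q p * deriv K u + 2 * deriv D u * pdx (eta Q) p
          + D u * (pdx (pdu (eta Q)) p + pdu (pdx (eta Q)) p - pdx (pdx (xiX Q)) p)) ∧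
      f x * pdt (eta Q) p = D u * pdx (pdx (eta Q)) p + K u * pdx (eta Q) p := by
  intro p
  have hp : (t, x, u) ∈ box T I J := ⟨ht, hx, hu⟩
  have hΩ := isOpen_box hT.1 hadm.interval_x.1 hadm.interval_u.1
  obtain ⟨h1, h2⟩ := pd_xiT_eq_zero hT hadm hQ hs hp
  obtain ⟨h3, h4⟩ := pd_eq_zero_of_eqOn_zero hΩ
    (fun q hq => (pd_xiT_eq_zero hT hadm hQ hs hq).1) hp
  obtain ⟨h5, h6⟩ := pd_eq_zero_of_eqOn_zero hΩ
    (fun q hq => (pd_xiT_eq_zero hT hadm hQ hs hq).2) hp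
  obtain ⟨h7, h8⟩ := pd_eq_zero_of_eqOn_zero hΩ
    (fun q hq => pdu_xiX_eq_zero hT hadm hQ hs hq) hp
  have h9 := pdu_xiX_eq_zero hT hadm hQ hs hp
  have h10 : pdu (pdx (xiX Q)) (t, x, u) = 0 := by
    have hX : ContDiffAt ℝ ∞ (xiX Q) (t, x, u) := (hQ.contDiffAt (hΩ.mem_nhds hp)).snd.fst
    have hsymm : IsSymmSndFDerivAt ℝ (xiX Q) (t, x, u) :=
      hX.isSymmSndFDerivAt (by simp; norm_cast)
    have e1 := fderiv_fderiv_eq hX (0, 1, 0) (0, 0, 1)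
    have e2 := fderiv_fderiv_eq hX (0, 0, 1) (0, 1, 0)
    have e3 := hsymm.eq (0, 1, 0) (0, 0, 1)
    rw [e1, e2] at e3
    exact e3.symm.trans h7
  have hf := hadm.f_ne_zero x hx
  have hD := hadm.D_ne_zero u hu
  have key : ∀ ux uxx : ℝ, _ := fun ux uxx =>
    lie_identity hT hadm hQ hs ht hx hu ((D u * uxx + deriv D u * ux ^ 2 + K u * ux) / f x) ux 0 uxx
      (mul_div_cancel₀ _ hf)
  simp only [h1, h2, h3, h4, h5, h6, h7, h8, h9, h10] at key
  have k00 := key 0 0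
  have k10 := key 1 0
  have k20 := key (-1) 0
  have k01 := key 0 1
  field_simp at k00 k10 k20 k01
  refine ⟨?_, ?_, ?_, ?_⟩
  · linear_combination k01 - k00
  · linear_combination (k10 + k20) / 2 - k00
  · linear_combination (k10 - k20) / 2
  · refine mul_left_cancel₀ hf ?_
    linear_combination k00

end

theorem hasDerivAt_slice_t {F : PointSpace → ℝ} {t x u : ℝ}
    (hF : DifferentiableAt ℝ F (t, x, u)) :
    HasDerivAt (fun s => F (s, x, u)) (pdt F (t, x, u)) t := by
  have h : HasDerivAt (fun s : ℝ => ((s, x, u) : PointSpace)) (1, 0, 0) t :=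
    (hasDerivAt_id' t).prodMk ((hasDerivAt_const t x).prodMk (hasDerivAt_const t u))
  exact HasFDerivAt.comp_hasDerivAt (l := F) (f := fun s : ℝ => ((s, x, u) : PointSpace)) t
    hF.hasFDerivAt h

theorem hasDerivAt_slice_x {F : PointSpace → ℝ} {t x u : ℝ}
    (hF : DifferentiableAt ℝ F (t, x, u)) :
    HasDerivAt (fun y => F (t, y, u)) (pdx F (t, x, u)) x := by
  have h : HasDerivAt (fun s : ℝ => ((t, s, u) : PointSpace)) (0, 1, 0) x :=
    (hasDerivAt_const x t).prodMk ((hasDerivAt_id' x).prodMk (hasDerivAt_const x u))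
  exact HasFDerivAt.comp_hasDerivAt (l := F) (f := fun s : ℝ => ((t, s, u) : PointSpace)) x
    hF.hasFDerivAt h

theorem hasDerivAt_slice_u {F : PointSpace → ℝ} {t x u : ℝ}
    (hF : DifferentiableAt ℝ F (t, x, u)) :
    HasDerivAt (fun v => F (t, x, v)) (pdu F (t, x, u)) u := by
  have h : HasDerivAt (fun s : ℝ => ((t, x, s) : PointSpace)) (0, 0, 1) u :=
    (hasDerivAt_const u t).prodMk ((hasDerivAt_const u x).prodMk (hasDerivAt_id' u))
  exact HasFDerivAt.comp_hasDerivAt (l := F) (f := fun s : ℝ => ((t, x, s) : PointSpace)) u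
    hF.hasFDerivAt h

/-- The function `g(t, x)` is smooth on `T × I`. -/
def SmoothOn₂ (T I : Set ℝ) (g : ℝ → ℝ → ℝ) : Prop :=
  ContDiffOn ℝ ∞ (fun z : ℝ × ℝ => g z.1 z.2) (T ×ˢ I)

theorem SmoothOn₂.slice_x {T I : Set ℝ} {g : ℝ → ℝ → ℝ} (h : SmoothOn₂ T I g) {t : ℝ}
    (ht : t ∈ T) : ContDiffOn ℝ ∞ (g t) I :=
  ContDiffOn.comp (g := fun z : ℝ × ℝ => g z.1 z.2) (f := fun x => (t, x)) h
    (contDiff_const.prodMk contDiff_id).contDiffOn fun _ hx => ⟨ht, hx⟩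

theorem SmoothOn₂.slice_t {T I : Set ℝ} {g : ℝ → ℝ → ℝ} (h : SmoothOn₂ T I g) {x : ℝ}
    (hx : x ∈ I) : ContDiffOn ℝ ∞ (fun t => g t x) T :=
  ContDiffOn.comp (g := fun z : ℝ × ℝ => g z.1 z.2) (f := fun t => (t, x)) h
    (contDiff_id.prodMk contDiff_const).contDiffOn fun _ ht => ⟨ht, hx⟩

section

variable {T I J : Set ℝ} {f D K : ℝ → ℝ} {Q : PointSpace → PointSpace}

theorem SmoothOn₂.hasDerivAt_x {g : ℝ → ℝ → ℝ} (h : SmoothOn₂ T I g) (hI : IsOpenInterval I)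
    {t x : ℝ} (ht : t ∈ T) (hx : x ∈ I) : HasDerivAt (g t) (deriv (g t) x) x :=
  (h.slice_x ht).hasDerivAt_of_isOpen hI.1 hx

theorem SmoothOn₂.hasDerivAt_deriv_x {g : ℝ → ℝ → ℝ} (h : SmoothOn₂ T I g)
    (hI : IsOpenInterval I) {t x : ℝ} (ht : t ∈ T) (hx : x ∈ I) :
    HasDerivAt (deriv (g t)) (deriv (deriv (g t)) x) x :=
  ((h.slice_x ht).contDiffOn_deriv hI.1).hasDerivAt_of_isOpen hI.1 hx

theorem SmoothOn₂.hasDerivAt_t {g : ℝ → ℝ → ℝ} (h : SmoothOn₂ T I g) (hT : IsOpenInterval T)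
    {t x : ℝ} (ht : t ∈ T) (hx : x ∈ I) :
    HasDerivAt (fun s => g s x) (deriv (fun s => g s x) t) t :=
  (h.slice_t hx).hasDerivAt_of_isOpen hT.1 ht

/-- The vector field `τ(t) ∂_t + ξ(t, x) ∂_x + (a(t, x) u + b(t, x)) ∂_u` is given by smooth
coefficients satisfying the determining equations for the symmetries of
`f(x) u_t = (D(u) u_x)_x + K(u) u_x`. -/
structure SymmetryCoefficients (T I J : Set ℝ) (f D K : ℝ → ℝ) (Q : PointSpace → PointSpace)
    (τ : ℝ → ℝ) (ξ a b : ℝ → ℝ → ℝ) : Prop where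
  eq : ∀ t ∈ T, ∀ x ∈ I, ∀ u ∈ J, Q (t, x, u) = (τ t, ξ t x, a t x * u + b t x)
  smooth_τ : ContDiffOn ℝ ∞ τ T
  smooth_ξ : SmoothOn₂ T I ξ
  smooth_a : SmoothOn₂ T I a
  smooth_b : SmoothOn₂ T I b
  eq_uxx : ∀ t ∈ T, ∀ x ∈ I, ∀ u ∈ J,
    D u * (ξ t x * deriv f x - f x * deriv τ t + 2 * f x * deriv (ξ t) x)
      = f x * ((a t x * u + b t x) * deriv D u)
  eq_ux : ∀ t ∈ T, ∀ x ∈ I, ∀ u ∈ J,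
    K u * (ξ t x * deriv f x - f x * deriv τ t + f x * deriv (ξ t) x)
      = f x * (f x * deriv (fun s => ξ s x) t + (a t x * u + b t x) * deriv K u
        + 2 * deriv D u * (deriv (a t) x * u + deriv (b t) x)
        + D u * (2 * deriv (a t) x - deriv (deriv (ξ t)) x))
  eq_one : ∀ t ∈ T, ∀ x ∈ I, ∀ u ∈ J,
    f x * (deriv (fun s => a s x) t * u + deriv (fun s => b s x) t)
      = D u * (deriv (deriv (a t)) x * u + deriv (deriv (b t)) x)
        + K u * (deriv (a t) x * u + deriv (b t) x)

theorem exists_symmetryCoefficients (hT : IsOpenInterval T) (hadm : IsAdmissible I J f D K)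
    (hQ : ContDiffOn ℝ ∞ Q (box T I J)) (hs : IsInfinitesimalSymmetry f D K (box T I J) Q) :
    ∃ τ ξ a b, SymmetryCoefficients T I J f D K Q τ ξ a b := by
  have hI := hadm.interval_x
  have hJ := hadm.interval_u
  have hΩ := isOpen_box hT.1 hI.1 hJ.1
  obtain ⟨x₀, hx₀⟩ := hI.2.2
  obtain ⟨u₀, hu₀⟩ := hJ.2.2
  obtain ⟨u₁, hu₁, hne⟩ := hJ.exists_ne u₀
  have hne' : u₁ - u₀ ≠ 0 := sub_ne_zero.2 hne
  have hat : ∀ p ∈ box T I J, ContDiffAt ℝ ∞ Q p := fun p hp => hQ.contDiffAt (hΩ.mem_nhds hp)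
  have dT : ∀ p ∈ box T I J, DifferentiableAt ℝ (xiT Q) p := fun p hp =>
    (hat p hp).fst.differentiableAt (by simp)
  have dX : ∀ p ∈ box T I J, DifferentiableAt ℝ (xiX Q) p := fun p hp =>
    (hat p hp).snd.fst.differentiableAt (by simp)
  have cE : ∀ p ∈ box T I J, ContDiffAt ℝ ∞ (eta Q) p := fun p hp => (hat p hp).snd.snd
  have dE : ∀ p ∈ box T I J, DifferentiableAt ℝ (eta Q) p := fun p hp =>
    (cE p hp).differentiableAt (by simp)
  have dpd : ∀ (F : PointSpace → ℝ) (v : PointSpace), (∀ p ∈ box T I J, ContDiffAt ℝ ∞ F p) →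
      ∀ p ∈ box T I J, DifferentiableAt ℝ (fun q => fderiv ℝ F q v) p := by
    intro F v hF p hp
    have h1 : DifferentiableAt ℝ (fderiv ℝ F) p :=
      ((hF p hp).fderiv_right (m := 1) (by norm_cast)).differentiableAt (by simp)
    exact h1.clm_apply (differentiableAt_const v)
  have dxE : ∀ p ∈ box T I J, DifferentiableAt ℝ (pdx (eta Q)) p := dpd _ _ cE
  have duE : ∀ p ∈ box T I J, DifferentiableAt ℝ (pdu (eta Q)) p := dpd _ _ cE
  have dxX : ∀ p ∈ box T I J, DifferentiableAt ℝ (pdx (xiX Q)) p :=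
    dpd _ _ fun p hp => (hat p hp).snd.fst
  set τ : ℝ → ℝ := fun t => xiT Q (t, x₀, u₀) with hτ
  set ξ : ℝ → ℝ → ℝ := fun t x => xiX Q (t, x, u₀) with hξ
  set a : ℝ → ℝ → ℝ := fun t x => (eta Q (t, x, u₁) - eta Q (t, x, u₀)) / (u₁ - u₀) with ha
  set b : ℝ → ℝ → ℝ := fun t x => eta Q (t, x, u₀) - a t x * u₀ with hb
  have eT : ∀ t ∈ T, ∀ x ∈ I, ∀ u ∈ J, xiT Q (t, x, u) = τ t := by
    intro t ht x hx u hu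
    have h1 : xiT Q (t, x, u) = xiT Q (t, x, u₀) :=
      hJ.eq_of_hasDerivAt_zero (g := fun v => xiT Q (t, x, v)) (fun v hv => by
        have h := hasDerivAt_slice_u (dT (t, x, v) ⟨ht, hx, hv⟩)
        rwa [(pd_xiT_eq_zero hT hadm hQ hs (p := (t, x, v)) ⟨ht, hx, hv⟩).2] at h) hu hu₀
    have h2 : xiT Q (t, x, u₀) = xiT Q (t, x₀, u₀) :=
      hI.eq_of_hasDerivAt_zero (g := fun y => xiT Q (t, y, u₀)) (fun y hy => by
        have h := hasDerivAt_slice_x (dT (t, y, u₀) ⟨ht, hy, hu₀⟩)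
        rwa [(pd_xiT_eq_zero hT hadm hQ hs (p := (t, y, u₀)) ⟨ht, hy, hu₀⟩).1] at h) hx hx₀
    rw [h1, h2]
  have eX : ∀ t ∈ T, ∀ x ∈ I, ∀ u ∈ J, xiX Q (t, x, u) = ξ t x := by
    intro t ht x hx u hu
    exact hJ.eq_of_hasDerivAt_zero (g := fun v => xiX Q (t, x, v)) (fun v hv => by
        have h := hasDerivAt_slice_u (dX (t, x, v) ⟨ht, hx, hv⟩)
        rwa [pdu_xiX_eq_zero hT hadm hQ hs (p := (t, x, v)) ⟨ht, hx, hv⟩] at h) hu hu₀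
  have gτ : ∀ t ∈ T, ∀ x ∈ I, ∀ u ∈ J, pdt (xiT Q) (t, x, u) = deriv τ t := by
    intro t ht x hx u hu
    refine ((hasDerivAt_slice_t (dT (t, x, u) ⟨ht, hx, hu⟩)).congr_of_eventuallyEq ?_).deriv.symm
    exact Filter.eventually_of_mem (hT.mem_nhds ht) fun s hs => (eT s hs x hx u hu).symm
  have gξt : ∀ t ∈ T, ∀ x ∈ I, ∀ u ∈ J, pdt (xiX Q) (t, x, u) = deriv (fun s => ξ s x) t := by
    intro t ht x hx u hu
    refine ((hasDerivAt_slice_t (dX (t, x, u) ⟨ht, hx, hu⟩)).congr_of_eventuallyEq ?_).deriv.symm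
    exact Filter.eventually_of_mem (hT.mem_nhds ht) fun s hs => (eX s hs x hx u hu).symm
  have gξx : ∀ t ∈ T, ∀ x ∈ I, ∀ u ∈ J, pdx (xiX Q) (t, x, u) = deriv (ξ t) x := by
    intro t ht x hx u hu
    refine ((hasDerivAt_slice_x (dX (t, x, u) ⟨ht, hx, hu⟩)).congr_of_eventuallyEq ?_).deriv.symm
    exact Filter.eventually_of_mem (hI.mem_nhds hx) fun s hs => (eX t ht s hs u hu).symm
  have gξxx : ∀ t ∈ T, ∀ x ∈ I, ∀ u ∈ J,
      pdx (pdx (xiX Q)) (t, x, u) = deriv (deriv (ξ t)) x := by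
    intro t ht x hx u hu
    refine ((hasDerivAt_slice_x (dxX (t, x, u) ⟨ht, hx, hu⟩)).congr_of_eventuallyEq ?_).deriv.symm
    exact Filter.eventually_of_mem (hI.mem_nhds hx) fun s hs => (gξx t ht s hs u hu).symm
  have main := fun t ht x hx u hu =>
    determining_equations_partials hT hadm hQ hs (t := t) (x := x) (u := u) ht hx hu
  -- `η` is affine in `u`
  have huu : ∀ t ∈ T, ∀ x ∈ I, ∀ u ∈ J, pdu (pdu (eta Q)) (t, x, u) = 0 := by
    intro t ht x hx u hu
    have h2 := (main t ht x hx u hu).2.1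
    have h3 : HasDerivAt (fun v => D v * (ξ t x * deriv f x - f x * deriv τ t
        + 2 * f x * deriv (ξ t) x))
        (deriv D u * (ξ t x * deriv f x - f x * deriv τ t + 2 * f x * deriv (ξ t) x)) u :=
      (hadm.differentiableAt_D hu).hasDerivAt.mul_const _
    have h4 : HasDerivAt (fun v => f x * (eta Q (t, x, v) * deriv D v))
        (f x * (pdu (eta Q) (t, x, u) * deriv D u + eta Q (t, x, u) * deriv (deriv D) u)) u :=
      ((hasDerivAt_slice_u (dE (t, x, u) ⟨ht, hx, hu⟩)).mul
        (hadm.differentiableAt_deriv_D hu).hasDerivAt).const_mul _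
    have h5 := h4.congr_of_eventuallyEq (f₁ := fun v => D v * (ξ t x * deriv f x
        - f x * deriv τ t + 2 * f x * deriv (ξ t) x))
      (Filter.eventually_of_mem (hJ.mem_nhds hu) fun v hv => by
        have h1 := (main t ht x hx v hv).1
        rwa [eX t ht x hx v hv, gτ t ht x hx v hv, gξx t ht x hx v hv] at h1)
    have h6 := h3.unique h5
    rw [eX t ht x hx u hu, gτ t ht x hx u hu, gξx t ht x hx u hu] at h2
    have h7 : f x * D u * pdu (pdu (eta Q)) (t, x, u) = 0 := by linear_combination h6 - h2
    simpa [hadm.f_ne_zero x hx, hadm.D_ne_zero u hu] using h7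
  have hη : ∀ t ∈ T, ∀ x ∈ I, ∀ u ∈ J,
      pdu (eta Q) (t, x, u) = a t x ∧ eta Q (t, x, u) = a t x * u + b t x := by
    intro t ht x hx
    have h1 := fun (v : ℝ) (hv : v ∈ J) =>
      hJ.eq_of_deriv_deriv (g := fun v => eta Q (t, x, v))
        (g₁ := fun v => pdu (eta Q) (t, x, v)) (m := 0)
        (fun v hv => hasDerivAt_slice_u (dE (t, x, v) ⟨ht, hx, hv⟩))
        (fun v hv => by
          have h := hasDerivAt_slice_u (duE (t, x, v) ⟨ht, hx, hv⟩)
          rw [huu t ht x hx v hv] at h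
          simpa using h) hu₀ hv
    have h2 : pdu (eta Q) (t, x, u₀) = a t x := by
      have h3 := (h1 u₁ hu₁).2
      simp only [expInt, if_true] at h3
      simp only [ha]
      field_simp
      linarith
    intro u hu
    obtain ⟨h3, h4⟩ := h1 u hu
    simp only [expInt, if_true, zero_mul, Real.exp_zero, mul_one, h2] at h3 h4
    refine ⟨h3, ?_⟩
    rw [h4]
    simp only [hb]
    ring
  have sX : ∀ v ∈ J, SmoothOn₂ T I fun t x => xiX Q (t, x, v) := by
    intro v hv
    have h : ContDiffOn ℝ ∞ (fun z : ℝ × ℝ => Q (z.1, z.2, v)) (T ×ˢ I) :=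
      hQ.comp (f := fun z : ℝ × ℝ => (z.1, z.2, v)) (by fun_prop) fun z hz => ⟨hz.1, hz.2, hv⟩
    exact h.snd.fst
  have sE : ∀ v ∈ J, SmoothOn₂ T I fun t x => eta Q (t, x, v) := by
    intro v hv
    have h : ContDiffOn ℝ ∞ (fun z : ℝ × ℝ => Q (z.1, z.2, v)) (T ×ˢ I) :=
      hQ.comp (f := fun z : ℝ × ℝ => (z.1, z.2, v)) (by fun_prop) fun z hz => ⟨hz.1, hz.2, hv⟩
    exact h.snd.snd
  have sa : SmoothOn₂ T I a := ((sE u₁ hu₁).sub (sE u₀ hu₀)).div_const _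
  have sb : SmoothOn₂ T I b := (sE u₀ hu₀).sub (sa.mul contDiffOn_const)
  have sτ : ContDiffOn ℝ ∞ τ T := by
    have h : ContDiffOn ℝ ∞ (fun t : ℝ => Q (t, x₀, u₀)) T :=
      hQ.comp (f := fun t : ℝ => (t, x₀, u₀)) (by fun_prop) fun t ht => ⟨ht, hx₀, hu₀⟩
    exact h.fst
  have gηt : ∀ t ∈ T, ∀ x ∈ I, ∀ u ∈ J, pdt (eta Q) (t, x, u)
      = deriv (fun s => a s x) t * u + deriv (fun s => b s x) t := by
    intro t ht x hx u hu
    refine (hasDerivAt_slice_t (dE (t, x, u) ⟨ht, hx, hu⟩)).unique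
      ((((sa.hasDerivAt_t hT ht hx).mul_const u).add
        (sb.hasDerivAt_t hT ht hx)).congr_of_eventuallyEq ?_)
    exact Filter.eventually_of_mem (hT.mem_nhds ht) fun s hs => (hη s hs x hx u hu).2
  have gηx : ∀ t ∈ T, ∀ x ∈ I, ∀ u ∈ J, pdx (eta Q) (t, x, u)
      = deriv (a t) x * u + deriv (b t) x := by
    intro t ht x hx u hu
    refine (hasDerivAt_slice_x (dE (t, x, u) ⟨ht, hx, hu⟩)).unique
      ((((sa.hasDerivAt_x hI ht hx).mul_const u).add
        (sb.hasDerivAt_x hI ht hx)).congr_of_eventuallyEq ?_)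
    exact Filter.eventually_of_mem (hI.mem_nhds hx) fun s hs => (hη t ht s hs u hu).2
  have gηxx : ∀ t ∈ T, ∀ x ∈ I, ∀ u ∈ J, pdx (pdx (eta Q)) (t, x, u)
      = deriv (deriv (a t)) x * u + deriv (deriv (b t)) x := by
    intro t ht x hx u hu
    refine (hasDerivAt_slice_x (dxE (t, x, u) ⟨ht, hx, hu⟩)).unique
      ((((sa.hasDerivAt_deriv_x hI ht hx).mul_const u).add
        (sb.hasDerivAt_deriv_x hI ht hx)).congr_of_eventuallyEq ?_)
    exact Filter.eventually_of_mem (hI.mem_nhds hx) fun s hs => gηx t ht s hs u hu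
  have gηux : ∀ t ∈ T, ∀ x ∈ I, ∀ u ∈ J, pdx (pdu (eta Q)) (t, x, u) = deriv (a t) x := by
    intro t ht x hx u hu
    refine (hasDerivAt_slice_x (duE (t, x, u) ⟨ht, hx, hu⟩)).unique
      ((sa.hasDerivAt_x hI ht hx).congr_of_eventuallyEq ?_)
    exact Filter.eventually_of_mem (hI.mem_nhds hx) fun s hs => (hη t ht s hs u hu).1
  have gηxu : ∀ t ∈ T, ∀ x ∈ I, ∀ u ∈ J, pdu (pdx (eta Q)) (t, x, u) = deriv (a t) x := by
    intro t ht x hx u hu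
    have h1 : HasDerivAt (fun v => deriv (a t) x * v + deriv (b t) x) (deriv (a t) x) u := by
      simpa using ((hasDerivAt_id' u).const_mul (deriv (a t) x)).add_const (deriv (b t) x)
    refine (hasDerivAt_slice_u (dxE (t, x, u) ⟨ht, hx, hu⟩)).unique
      (h1.congr_of_eventuallyEq ?_)
    exact Filter.eventually_of_mem (hJ.mem_nhds hu) fun s hs => gηx t ht x hx s hs
  refine ⟨τ, ξ, a, b, ⟨?_, sτ, sX u₀ hu₀, sa, sb, ?_, ?_, ?_⟩⟩
  · intro t ht x hx u hu
    exact Prod.ext (eT t ht x hx u hu) (Prod.ext (eX t ht x hx u hu) (hη t ht x hx u hu).2)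
  · intro t ht x hx u hu
    have h := (main t ht x hx u hu).1
    rwa [eX t ht x hx u hu, gτ t ht x hx u hu, gξx t ht x hx u hu, (hη t ht x hx u hu).2] at h
  · intro t ht x hx u hu
    have h := (main t ht x hx u hu).2.2.1
    rw [eX t ht x hx u hu, gτ t ht x hx u hu, gξx t ht x hx u hu, (hη t ht x hx u hu).2,
      gξt t ht x hx u hu, gηx t ht x hx u hu, gηux t ht x hx u hu, gηxu t ht x hx u hu,
      gξxx t ht x hx u hu] at h
    rw [h]
    ring
  · intro t ht x hx u hu
    have h := (main t ht x hx u hu).2.2.2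
    rwa [gηt t ht x hx u hu, gηxx t ht x hx u hu, gηx t ht x hx u hu] at h

end

/-! ### Reduction to constant `f` -/

section

variable {T I J : Set ℝ} {f D K : ℝ → ℝ}

/-- A solution of `(μ u + ν) D' = D` extends to an interval invariant under the flow of
`(μ u + ν) ∂_u`, and is multiplied by `exp s` by the flow. -/
theorem exists_extension (hJ : IsOpenInterval J) {D : ℝ → ℝ} {μ ν : ℝ}
    (hDs : ContDiffOn ℝ ∞ D J) (hD0 : ∀ u ∈ J, D u ≠ 0)
    (hD : ∀ u ∈ J, (μ * u + ν) * deriv D u = D u) :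
    ∃ (J₁ : Set ℝ) (D₁ : ℝ → ℝ), IsAdmissible Set.univ J₁ (fun _ => 1) D₁ (fun _ => 0) ∧
      ∀ u ∈ J, ∀ s, u + expInt μ s * (μ * u + ν) ∈ J₁ ∧
        D₁ (u + expInt μ s * (μ * u + ν)) = Real.exp s * D u := by
  have hφ : ∀ u ∈ J, μ * u + ν ≠ 0 := by
    intro u hu h0
    have := hD u hu
    rw [h0, zero_mul] at this
    exact hD0 u hu this.symm
  obtain ⟨u₀, hu₀⟩ := hJ.2.2
  have hφ₀ := hφ u₀ hu₀
  set J₁ : Set ℝ := {u | 0 < (μ * u + ν) * (μ * u₀ + ν)} with hJ₁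
  have hJ₁i : IsOpenInterval J₁ := by
    refine ⟨isOpen_lt continuous_const (by fun_prop), ?_, u₀, mul_self_pos.2 hφ₀⟩
    refine ⟨fun x hx y hy z hz => ?_⟩
    simp only [hJ₁, Set.mem_ofPred_eq] at hx hy ⊢
    rcases le_total 0 (μ * (μ * u₀ + ν)) with h | h
    · nlinarith [mul_le_mul_of_nonneg_right hz.1 h]
    · nlinarith [mul_le_mul_of_nonpos_right hz.2 h]
  have hφ₁ : ∀ u ∈ J₁, μ * u + ν ≠ 0 := fun u hu h0 => by
    simp [hJ₁, h0] at hu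
  have hsub : J ⊆ J₁ := by
    have hcont : ContinuousOn (fun u : ℝ => (μ * u + ν) * (μ * u₀ + ν)) J := by fun_prop
    intro u hu
    by_contra hneg
    simp only [hJ₁, Set.mem_ofPred_eq, not_lt] at hneg
    obtain ⟨z, hz, hz0⟩ := hJ.isPreconnected.intermediate_value hu hu₀ hcont
      (⟨hneg, (mul_self_pos.2 hφ₀).le⟩ : (0 : ℝ) ∈ Set.Icc _ _)
    exact mul_ne_zero (hφ z hz) hφ₀ hz0
  obtain ⟨D₁, hD₁s, hD₁0, hD₁'⟩ : ∃ D₁ : ℝ → ℝ, ContDiffOn ℝ ∞ D₁ J₁ ∧ D₁ u₀ = D u₀ ∧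
      ∀ u ∈ J₁, D₁ u ≠ 0 ∧ HasDerivAt D₁ (D₁ u / (μ * u + ν)) u := by
    by_cases hμ : μ = 0
    · subst hμ
      simp only [zero_mul, zero_add] at *
      refine ⟨fun u => D u₀ * Real.exp ((u - u₀) / ν), by fun_prop, by simp, fun u hu =>
        ⟨mul_ne_zero (hD0 u₀ hu₀) (Real.exp_ne_zero _), ?_⟩⟩
      refine (((((hasDerivAt_id' u).sub_const u₀).div_const ν).exp).const_mul _).congr_deriv ?_
      ring
    · refine ⟨fun u => D u₀ * Real.exp (Real.log ((μ * u + ν) / (μ * u₀ + ν)) / μ), ?_, ?_,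
        fun u hu => ⟨mul_ne_zero (hD0 u₀ hu₀) (Real.exp_ne_zero _), ?_⟩⟩
      · have h1 : ContDiffOn ℝ ∞ (fun u : ℝ => (μ * u + ν) / (μ * u₀ + ν)) J₁ := by fun_prop
        exact contDiffOn_const.mul
          ((h1.log fun u hu => div_ne_zero (hφ₁ u hu) hφ₀).div_const _).exp
      · simp [div_self hφ₀]
      · have h1 : HasDerivAt (fun u : ℝ => (μ * u + ν) / (μ * u₀ + ν)) (μ / (μ * u₀ + ν)) u := by
          simpa using (((hasDerivAt_id' u).const_mul μ).add_const ν).div_const (μ * u₀ + ν)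
        have hu1 := hφ₁ u hu
        refine (((h1.log (div_ne_zero hu1 hφ₀)).div_const μ).exp.const_mul _).congr_deriv ?_
        field_simp
  have hflow : ∀ u ∈ J₁, ∀ s, μ * (u + expInt μ s * (μ * u + ν)) + ν
      = Real.exp (μ * s) * (μ * u + ν) := by
    intro u _ s
    rw [← one_add_mul_expInt]
    ring
  have hmem : ∀ u ∈ J₁, ∀ s, u + expInt μ s * (μ * u + ν) ∈ J₁ := by
    intro u hu s
    simp only [hJ₁, Set.mem_ofPred_eq] at hu ⊢
    rw [hflow u hu, mul_assoc]
    exact mul_pos (Real.exp_pos _) hu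
  have hscale : ∀ u ∈ J₁, ∀ s, D₁ (u + expInt μ s * (μ * u + ν)) = Real.exp s * D₁ u := by
    intro u hu s
    have huniv : IsOpenInterval Set.univ := ⟨isOpen_univ, Set.ordConnected_univ, Set.univ_nonempty⟩
    have h := huniv.eq_mul_exp (g := fun s => D₁ (u + expInt μ s * (μ * u + ν))) (m := 1)
      (fun r _ => by
        have h1 := (hD₁' _ (hmem u hu r)).2
        have h2 := ((hasDerivAt_expInt μ r).mul_const (μ * u + ν)).const_add u
        refine (h1.comp r h2).congr_deriv ?_
        rw [hflow u hu]
        rw [one_mul, div_mul_cancel₀ _ (mul_ne_zero (Real.exp_ne_zero _) (hφ₁ u hu))]) (Set.mem_univ 0) (Set.mem_univ s)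
    simp only [expInt_zero, zero_mul, add_zero, sub_zero, one_mul] at h
    rw [h, mul_comm]
  have hext : ∀ u ∈ J, D₁ u = D u := by
    intro u hu
    have h := hJ.eq_of_hasDerivAt_zero (g := fun u => D u / D₁ u) (fun z hz => by
      have h1 := (hDs.hasDerivAt_of_isOpen hJ.1 hz).div (hD₁' z (hsub hz)).2 (hD₁' z (hsub hz)).1
      refine h1.congr_deriv ?_
      have h2 := hD z hz
      have h3 := hφ z hz
      have h4 := (hD₁' z (hsub hz)).1
      rw [← h2]
      field_simp
      ring) hu hu₀
    simp only [hD₁0, div_self (hD0 u₀ hu₀)] at h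
    have h4 := (hD₁' u (hsub hu)).1
    field_simp at h
    exact h.symm
  refine ⟨J₁, D₁, ⟨⟨isOpen_univ, Set.ordConnected_univ, Set.univ_nonempty⟩, hJ₁i,
    contDiffOn_const, hD₁s, contDiffOn_const, fun _ _ => one_ne_zero, fun u hu => (hD₁' u hu).1,
    u₀, hsub hu₀, Or.inl ?_⟩, fun u hu s => ⟨hmem u (hsub hu) s, ?_⟩⟩
  · rw [(hD₁' u₀ (hsub hu₀)).2.deriv]
    exact div_ne_zero (hD₁' u₀ (hsub hu₀)).1 hφ₀
  · rw [hscale u (hsub hu), hext u hu]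

/-- Data of a point transformation
`(t, x, u) ↦ (θ(t), Y(t, x), u + expInt μ (s(t, x)) (μ u + ν))` that removes `f` and the
convection term `(k₁ D(u) + k₀) u_x` if `(μ u + ν) D' = D`. -/
structure ReductionData (T I : Set ℝ) (f : ℝ → ℝ) (μ k₀ k₁ : ℝ) (θ : ℝ → ℝ)
    (Y s E : ℝ → ℝ → ℝ) : Prop where
  smooth_θ : ContDiffOn ℝ ∞ θ T
  smooth_Y : SmoothOn₂ T I Y
  smooth_s : SmoothOn₂ T I s
  injOn_θ : Set.InjOn θ T
  injOn_Y : ∀ t ∈ T, Set.InjOn (Y t) I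
  deriv_θ_ne : ∀ t ∈ T, deriv θ t ≠ 0
  deriv_Y_ne : ∀ t ∈ T, ∀ x ∈ I, deriv (Y t) x ≠ 0
  E_mul : ∀ t ∈ T, ∀ x ∈ I, E t x * deriv (Y t) x = Real.exp ((μ + 1) * s t x)
  deriv_E : ∀ t ∈ T, ∀ x ∈ I,
    HasDerivAt (E t) (k₁ * E t x - (μ + 1) * deriv (s t) x * E t x) x
  E_mul_deriv_s : ∀ t ∈ T, ∃ c, ∀ x ∈ I, E t x * deriv (s t) x = c
  eq_f : ∀ t ∈ T, ∀ x ∈ I,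
    f x * E t x * deriv θ t = deriv (Y t) x * Real.exp (μ * s t x)
  eq_Y : ∀ t ∈ T, ∀ x ∈ I, f x * deriv (fun r => Y r x) t = k₀ * deriv (Y t) x
  eq_s : ∀ t ∈ T, ∀ x ∈ I, f x * deriv (fun r => s r x) t = k₀ * deriv (s t) x

theorem ReductionData.mapsEquation {μ ν k₀ k₁ : ℝ} {θ : ℝ → ℝ} {Y s E : ℝ → ℝ → ℝ}
    (hred : ReductionData T I f μ k₀ k₁ θ Y s E) (hT : IsOpenInterval T)
    (hadm : IsAdmissible I J f D K)
    (hD : ∀ u ∈ J, (μ * u + ν) * deriv D u = D u) (hK : ∀ u ∈ J, K u = k₁ * D u + k₀)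
    {J₁ : Set ℝ} {D₁ : ℝ → ℝ} (hJ₁ : IsOpen J₁) (hD₁ : ContDiffOn ℝ ∞ D₁ J₁)
    (hscale : ∀ u ∈ J, ∀ s, u + expInt μ s * (μ * u + ν) ∈ J₁ ∧
        D₁ (u + expInt μ s * (μ * u + ν)) = Real.exp s * D u) :
    MapsEquation (box T I J)
      (fun p => (θ p.1, Y p.1 p.2.1, p.2.2 + expInt μ (s p.1 p.2.1) * (μ * p.2.2 + ν)))
      f D K (fun _ => 1) D₁ (fun _ => 0) := by
  intro U W v w hU hW hv hw hΩ hmap t x htx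
  have hI := hadm.interval_x
  obtain ⟨ht, hx, hu⟩ := hΩ t x htx
  have hUx : IsOpen {y | (t, y) ∈ U} := hU.preimage (by fun_prop : Continuous fun y : ℝ => (t, y))
  have hUt : IsOpen {r | (r, x) ∈ U} := hU.preimage (by fun_prop : Continuous fun r : ℝ => (r, x))
  have hWx : IsOpen {z | (θ t, z) ∈ W} :=
    hW.preimage (by fun_prop : Continuous fun z : ℝ => (θ t, z))
  have hvx : ContDiffOn ℝ ∞ (v t) {y | (t, y) ∈ U} :=
    ContDiffOn.comp (g := fun z : ℝ × ℝ => v z.1 z.2) (f := fun y => (t, y)) hv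
      (contDiff_const.prodMk contDiff_id).contDiffOn fun _ h => h
  have hvt : ContDiffOn ℝ ∞ (fun r => v r x) {r | (r, x) ∈ U} :=
    ContDiffOn.comp (g := fun z : ℝ × ℝ => v z.1 z.2) (f := fun y => (y, x)) hv
      (contDiff_id.prodMk contDiff_const).contDiffOn fun _ h => h
  have hwx : ContDiffOn ℝ ∞ (w (θ t)) {z | (θ t, z) ∈ W} :=
    ContDiffOn.comp (g := fun z : ℝ × ℝ => w z.1 z.2) (f := fun y => (θ t, y)) hw
      (contDiff_const.prodMk contDiff_id).contDiffOn fun _ h => h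
  have hev : ∀ᶠ y in nhds x, (t, y) ∈ U := hUx.mem_nhds htx
  have hwv : ∀ r y, (r, y) ∈ U → w (θ r) (Y r y)
      = v r y + expInt μ (s r y) * (μ * v r y + ν) := fun r y h => (hmap r y h).2.symm
  have hsx : ∀ y ∈ I, HasDerivAt (s t) (deriv (s t) y) y := fun y hy =>
    hred.smooth_s.hasDerivAt_x hI ht hy
  -- first derivatives in `x`
  have hwx1 : ∀ y, (t, y) ∈ U → deriv (w (θ t)) (Y t y) * deriv (Y t) y
      = Real.exp (μ * s t y) * (deriv (v t) y + deriv (s t) y * (μ * v t y + ν)) := by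
    intro y hy
    obtain ⟨-, hyI, -⟩ := hΩ t y hy
    have h1 : HasDerivAt (fun y => w (θ t) (Y t y))
        (deriv (w (θ t)) (Y t y) * deriv (Y t) y) y :=
      HasDerivAt.comp (h₂ := w (θ t)) y (hwx.hasDerivAt_of_isOpen hWx (hmap t y hy).1)
        (hred.smooth_Y.hasDerivAt_x hI ht hyI)
    have hv1 := hvx.hasDerivAt_of_isOpen hUx hy
    have h2 := hv1.add (((hasDerivAt_expInt μ (s t y)).comp y (hsx y hyI)).mul
      ((hv1.const_mul μ).add_const ν))
    have h3 := h1.unique (h2.congr_of_eventuallyEq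
      (Filter.eventually_of_mem (hUx.mem_nhds hy) fun z hz => hwv t z hz))
    rw [h3, ← one_add_mul_expInt]
    simp only [Function.comp_apply]
    ring
  -- the flux
  obtain ⟨c, hc⟩ := hred.E_mul_deriv_s t ht
  have hflux : ∀ y, (t, y) ∈ U → D₁ (w (θ t) (Y t y)) * deriv (w (θ t)) (Y t y)
      = E t y * (D (v t y) * deriv (v t) y) + c * ((μ * v t y + ν) * D (v t y)) := by
    intro y hy
    obtain ⟨-, hyI, hyJ⟩ := hΩ t y hy
    have h1 := hwx1 y hy
    have h2 := hred.deriv_Y_ne t ht y hyI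
    refine mul_right_cancel₀ h2 ?_
    rw [mul_assoc, h1, hwv t y hy, (hscale _ hyJ _).2, ← hc y hyI]
    have h3 := hred.E_mul t ht y hyI
    have h4 : Real.exp ((μ + 1) * s t y) = Real.exp (s t y) * Real.exp (μ * s t y) := by
      rw [← Real.exp_add]
      ring_nf
    rw [h4] at h3
    linear_combination (-(D (v t y)) * deriv (v t) y
      - deriv (s t) y * (μ * v t y + ν) * D (v t y)) * h3
  have hvx' := hvx.hasDerivAt_of_isOpen hUx htx
  have hvxx := (hvx.contDiffOn_deriv hUx).hasDerivAt_of_isOpen hUx htx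
  have hDv : HasDerivAt (fun y => D (v t y)) (deriv D (v t x) * deriv (v t) x) x :=
    HasDerivAt.comp (h₂ := D) x (hadm.differentiableAt_D hu).hasDerivAt hvx'
  set P' := deriv (fun y => D (v t y) * deriv (v t) y) x with hP'
  have hP : HasDerivAt (fun y => D (v t y) * deriv (v t) y) P' x :=
    (hDv.mul hvxx).differentiableAt.hasDerivAt
  set q' := deriv (fun z => D₁ (w (θ t) z) * deriv (w (θ t)) z) (Y t x) with hq'
  have hWmem := (hmap t x htx).1
  have hq : HasDerivAt (fun z => D₁ (w (θ t) z) * deriv (w (θ t)) z) q' (Y t x) := by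
    have h1 : DifferentiableAt ℝ D₁ (w (θ t) (Y t x)) := by
      rw [hwv t x htx]
      exact (hD₁.hasDerivAt_of_isOpen hJ₁ (hscale _ hu _).1).differentiableAt
    have h2 := (hwx.hasDerivAt_of_isOpen hWx hWmem).differentiableAt
    have h3 := ((hwx.contDiffOn_deriv hWx).hasDerivAt_of_isOpen hWx hWmem).differentiableAt
    have h4 : DifferentiableAt ℝ (fun z => D₁ (w (θ t) z)) (Y t x) :=
      DifferentiableAt.comp (g := D₁) (Y t x) h1 h2
    exact (h4.mul h3).hasDerivAt
  have hdiv : q' * deriv (Y t) x = E t x * (P' + k₁ * (D (v t x) * deriv (v t) x)) := by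
    have h1 : HasDerivAt (fun y => D₁ (w (θ t) (Y t y)) * deriv (w (θ t)) (Y t y))
        (q' * deriv (Y t) x) x :=
      HasDerivAt.comp (h₂ := fun z => D₁ (w (θ t) z) * deriv (w (θ t)) z) x hq
        (hred.smooth_Y.hasDerivAt_x hI ht hx)
    have h2 := ((hred.deriv_E t ht x hx).mul hP).add
      ((((hvx'.const_mul μ).add_const ν).mul hDv).const_mul c)
    have h3 := h1.unique (h2.congr_of_eventuallyEq (hev.mono fun y hy => hflux y hy))
    have h4 := hD _ hu
    have h5 := hc x hx
    rw [h3]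
    linear_combination (c * deriv (v t) x) * h4
      - (μ + 1) * D (v t x) * deriv (v t) x * h5
  -- the derivative in `t`
  set wt := deriv (fun r => w r (Y t x)) (θ t) with hwt
  have htime : wt * deriv θ t + deriv (w (θ t)) (Y t x) * deriv (fun r => Y r x) t
      = Real.exp (μ * s t x) * (deriv (fun r => v r x) t
        + deriv (fun r => s r x) t * (μ * v t x + ν)) := by
    have hw2 : HasFDerivAt (fun z : ℝ × ℝ => w z.1 z.2)
        (fderiv ℝ (fun z : ℝ × ℝ => w z.1 z.2) (θ t, Y t x)) (θ t, Y t x) :=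
      ((hw.contDiffAt (hW.mem_nhds hWmem)).differentiableAt (by simp)).hasFDerivAt
    set L := fderiv ℝ (fun z : ℝ × ℝ => w z.1 z.2) (θ t, Y t x) with hL
    have e1 : L (1, 0) = wt := by
      have h : HasDerivAt (fun r => (r, Y t x)) ((1 : ℝ), (0 : ℝ)) (θ t) :=
        (hasDerivAt_id' _).prodMk (hasDerivAt_const _ _)
      exact (HasFDerivAt.comp_hasDerivAt (l := fun z : ℝ × ℝ => w z.1 z.2)
        (f := fun r => (r, Y t x)) (θ t) hw2 h).deriv.symm
    have e2 : L (0, 1) = deriv (w (θ t)) (Y t x) := by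
      have h : HasDerivAt (fun r => (θ t, r)) ((0 : ℝ), (1 : ℝ)) (Y t x) :=
        (hasDerivAt_const _ _).prodMk (hasDerivAt_id' _)
      exact (HasFDerivAt.comp_hasDerivAt (l := fun z : ℝ × ℝ => w z.1 z.2)
        (f := fun r => (θ t, r)) (Y t x) hw2 h).deriv.symm
    have h1 : HasDerivAt (fun r => w (θ r) (Y r x))
        (L (deriv θ t, deriv (fun r => Y r x) t)) t :=
      HasFDerivAt.comp_hasDerivAt (l := fun z : ℝ × ℝ => w z.1 z.2)
        (f := fun r => (θ r, Y r x)) t hw2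
        ((hred.smooth_θ.hasDerivAt_of_isOpen hT.1 ht).prodMk
          (hred.smooth_Y.hasDerivAt_t hT ht hx))
    have e3 : L (deriv θ t, deriv (fun r => Y r x) t)
        = wt * deriv θ t + deriv (w (θ t)) (Y t x) * deriv (fun r => Y r x) t := by
      have : ((deriv θ t, deriv (fun r => Y r x) t) : ℝ × ℝ)
          = deriv θ t • (1, 0) + deriv (fun r => Y r x) t • (0, 1) := by simp
      rw [this, map_add, map_smul, map_smul, e1, e2, smul_eq_mul, smul_eq_mul]
      ring
    have hv1 := hvt.hasDerivAt_of_isOpen hUt htx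
    have h2 := hv1.add (((hasDerivAt_expInt μ (s t x)).comp t
      (hred.smooth_s.hasDerivAt_t hT ht hx)).mul ((hv1.const_mul μ).add_const ν))
    have h3 := h1.unique (h2.congr_of_eventuallyEq
      (Filter.eventually_of_mem (hUt.mem_nhds htx) fun r hr => hwv r x hr))
    rw [← e3, h3, ← one_add_mul_expInt]
    simp only [Function.comp_apply]
    ring
  have hkey : f x * deriv θ t * (wt - q') = Real.exp (μ * s t x) *
      (f x * deriv (fun r => v r x) t - k₀ * deriv (v t) x
        - P' - k₁ * (D (v t x) * deriv (v t) x)) := by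
    have hYx := hred.deriv_Y_ne t ht x hx
    refine mul_right_cancel₀ hYx ?_
    have e1 := hwx1 x htx
    have e2 := hred.eq_Y t ht x hx
    have e3 := hred.eq_s t ht x hx
    have e4 := hred.eq_f t ht x hx
    linear_combination deriv (Y t) x * f x * htime - f x * deriv θ t * hdiv
      - (P' + k₁ * (D (v t x) * deriv (v t) x)) * e4
      - deriv (Y t) x * deriv (w (θ t)) (Y t x) * e2
      + deriv (Y t) x * Real.exp (μ * s t x) * (μ * v t x + ν) * e3
      - k₀ * deriv (Y t) x * e1
  have hne : f x * deriv θ t ≠ 0 := mul_ne_zero (hadm.f_ne_zero x hx) (hred.deriv_θ_ne t ht)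
  have hexp := Real.exp_ne_zero (μ * s t x)
  unfold SatisfiesAt
  change f x * deriv (fun r => v r x) t = P' + K (v t x) * deriv (v t) x ↔
    1 * wt = q' + 0 * deriv (w (θ t)) (Y t x)
  rw [hK _ hu]
  constructor
  · intro h
    have h0 : f x * deriv θ t * (wt - q') = 0 := by
      rw [hkey]
      linear_combination Real.exp (μ * s t x) * h
    have := (mul_eq_zero.1 h0).resolve_left hne
    linarith
  · intro h
    have h0 : Real.exp (μ * s t x) * (f x * deriv (fun r => v r x) t - k₀ * deriv (v t) x
        - P' - k₁ * (D (v t x) * deriv (v t) x)) = 0 := by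
      rw [← hkey]
      linear_combination f x * deriv θ t * h
    have := (mul_eq_zero.1 h0).resolve_left hexp
    linarith

end

section

variable {T I J : Set ℝ} {f D K : ℝ → ℝ}

/-- The equation `f(x) u_t = (D(u) u_x)_x + K(u) u_x` over `T × I × J` can be reduced by a point
transformation to an equation of the same class with `f = 1`. -/
def IsReducible (T I J : Set ℝ) (f D K : ℝ → ℝ) : Prop :=
  ∃ (I₁ J₁ : Set ℝ) (D₁ K₁ : ℝ → ℝ) (Φ : OpenPartialHomeomorph PointSpace PointSpace),
    IsAdmissible I₁ J₁ (fun _ => 1) D₁ K₁ ∧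
    IsPointTransformation (box T I J) Φ ∧
    (∀ p ∈ box T I J, (Φ p).2.1 ∈ I₁ ∧ (Φ p).2.2 ∈ J₁) ∧
    MapsEquation (box T I J) Φ f D K (fun _ => 1) D₁ K₁

/-- A triangular map with nonvanishing diagonal derivatives is a diffeomorphism. -/
theorem exists_triangular_pointTransformation (hT : IsOpenInterval T) (hI : IsOpenInterval I)
    (hJ : IsOpenInterval J) {θ : ℝ → ℝ} {Y : ℝ → ℝ → ℝ} {G : PointSpace → ℝ}
    (hθ : ContDiffOn ℝ ∞ θ T) (hY : SmoothOn₂ T I Y) (hG : ContDiffOn ℝ ∞ G (box T I J))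
    (hθi : Set.InjOn θ T) (hYi : ∀ t ∈ T, Set.InjOn (Y t) I)
    (hGi : ∀ t ∈ T, ∀ x ∈ I, Set.InjOn (fun u => G (t, x, u)) J)
    (hθ' : ∀ t ∈ T, deriv θ t ≠ 0) (hY' : ∀ t ∈ T, ∀ x ∈ I, deriv (Y t) x ≠ 0)
    (hG' : ∀ p ∈ box T I J, pdu G p ≠ 0) :
    ∃ e : OpenPartialHomeomorph PointSpace PointSpace, IsPointTransformation (box T I J) e ∧
      (e : PointSpace → PointSpace) = fun p => (θ p.1, Y p.1 p.2.1, G p) := by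
  have hΩ := isOpen_box hT.1 hI.1 hJ.1
  have c1 : ContDiffOn ℝ ∞ (fun p : PointSpace => θ p.1) (box T I J) :=
    hθ.comp (f := fun p : PointSpace => p.1) (by fun_prop) fun p hp => hp.1
  have c2 : ContDiffOn ℝ ∞ (fun p : PointSpace => Y p.1 p.2.1) (box T I J) :=
    ContDiffOn.comp (g := fun z : ℝ × ℝ => Y z.1 z.2) (f := fun p : PointSpace => (p.1, p.2.1)) hY
      (by fun_prop) fun p hp => ⟨hp.1, hp.2.1⟩
  refine exists_isPointTransformation hΩ (c1.prodMk (c2.prodMk hG)) ?_ ?_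
  · rintro ⟨t, x, u⟩ ⟨ht, hx, hu⟩ ⟨t', x', u'⟩ ⟨ht', hx', hu'⟩ h
    simp only [Prod.mk.injEq] at h
    obtain ⟨h1, h2, h3⟩ := h
    obtain rfl := hθi ht ht' h1
    obtain rfl := hYi t ht hx hx' h2
    obtain rfl := hGi t ht x hx hu hu' h3
    rfl
  · rintro ⟨t, x, u⟩ hp ⟨a, b, c⟩ h
    obtain ⟨ht, hx, hu⟩ := hp
    have hp : (t, x, u) ∈ box T I J := ⟨ht, hx, hu⟩
    have d1 := (c1.contDiffAt (hΩ.mem_nhds hp)).differentiableAt (by simp)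
    have d2 := (c2.contDiffAt (hΩ.mem_nhds hp)).differentiableAt (by simp)
    have d3 := (hG.contDiffAt (hΩ.mem_nhds hp)).differentiableAt (by simp)
    rw [(d1.hasFDerivAt.prodMk (d2.hasFDerivAt.prodMk d3.hasFDerivAt)).fderiv] at h
    simp only [ContinuousLinearMap.prod_apply, Prod.mk_eq_zero, fderiv_eq_partials] at h
    obtain ⟨h1, h2, h3⟩ := h
    have e1 : pdt (fun p : PointSpace => θ p.1) (t, x, u) = deriv θ t :=
      (hasDerivAt_slice_t d1).deriv.symm
    have e2 : pdx (fun p : PointSpace => θ p.1) (t, x, u) = 0 :=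
      (hasDerivAt_slice_x d1).unique (hasDerivAt_const x (θ t))
    have e3 : pdu (fun p : PointSpace => θ p.1) (t, x, u) = 0 :=
      (hasDerivAt_slice_u d1).unique (hasDerivAt_const u (θ t))
    have e4 : pdx (fun p : PointSpace => Y p.1 p.2.1) (t, x, u) = deriv (Y t) x :=
      (hasDerivAt_slice_x d2).deriv.symm
    have e5 : pdu (fun p : PointSpace => Y p.1 p.2.1) (t, x, u) = 0 :=
      (hasDerivAt_slice_u d2).unique (hasDerivAt_const u (Y t x))
    rw [e1, e2, e3] at h1
    rw [e4, e5] at h2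
    have ha : a = 0 := by simpa [hθ' t ht] using h1
    subst ha
    have hb : b = 0 := by simpa [hY' t ht x hx] using h2
    subst hb
    have hc : c = 0 := by simpa [hG' _ hp] using h3
    subst hc
    rfl

theorem ReductionData.isReducible {μ ν k₀ k₁ : ℝ} {θ : ℝ → ℝ} {Y s E : ℝ → ℝ → ℝ}
    (hred : ReductionData T I f μ k₀ k₁ θ Y s E) (hT : IsOpenInterval T)
    (hadm : IsAdmissible I J f D K)
    (hD : ∀ u ∈ J, (μ * u + ν) * deriv D u = D u) (hK : ∀ u ∈ J, K u = k₁ * D u + k₀) :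
    IsReducible T I J f D K := by
  obtain ⟨J₁, D₁, hadm₁, hscale⟩ :=
    exists_extension hadm.interval_u hadm.smooth_D hadm.D_ne_zero hD
  have hmaps := hred.mapsEquation hT hadm hD hK hadm₁.interval_u.1 hadm₁.smooth_D hscale
  have hI := hadm.interval_x
  have hJ := hadm.interval_u
  have hΩ := isOpen_box hT.1 hI.1 hJ.1
  have cs : ContDiffOn ℝ ∞ (fun p : PointSpace => s p.1 p.2.1) (box T I J) :=
    ContDiffOn.comp (g := fun z : ℝ × ℝ => s z.1 z.2) (f := fun p : PointSpace => (p.1, p.2.1))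
      hred.smooth_s (by fun_prop) fun p hp => ⟨hp.1, hp.2.1⟩
  have cG : ContDiffOn ℝ ∞
      (fun p : PointSpace => p.2.2 + expInt μ (s p.1 p.2.1) * (μ * p.2.2 + ν)) (box T I J) := by
    have h1 := (contDiff_expInt μ).comp_contDiffOn cs
    exact ContDiffOn.add (by fun_prop) (h1.mul (by fun_prop))
  have hu : ∀ t x u, u + expInt μ (s t x) * (μ * u + ν)
      = Real.exp (μ * s t x) * u + expInt μ (s t x) * ν := by
    intro t x u
    rw [← one_add_mul_expInt]
    ring
  obtain ⟨Φ, hΦ, hΦe⟩ := exists_triangular_pointTransformation hT hI hJ hred.smooth_θ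
    hred.smooth_Y cG hred.injOn_θ hred.injOn_Y (fun t _ x _ u _ u' _ h => by
      simp only [hu] at h
      exact mul_left_cancel₀ (Real.exp_ne_zero _) (add_right_cancel h))
    hred.deriv_θ_ne hred.deriv_Y_ne (by
      rintro ⟨t, x, u⟩ hp
      have h1 := hasDerivAt_slice_u ((cG.contDiffAt (hΩ.mem_nhds hp)).differentiableAt (by simp))
      simp only [hu] at h1
      have h2 : HasDerivAt (fun v => Real.exp (μ * s t x) * v + expInt μ (s t x) * ν)
          (Real.exp (μ * s t x)) u := by
        simpa using ((hasDerivAt_id' u).const_mul (Real.exp (μ * s t x))).add_const (expInt μ (s t x) * ν)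
      simp only [hu]
      rw [h1.unique h2]
      exact Real.exp_ne_zero _)
  refine ⟨Set.univ, J₁, D₁, fun _ => 0, Φ, hadm₁, hΦ, fun p hp => ?_, ?_⟩
  · rw [hΦe]
    exact ⟨Set.mem_univ _, (hscale _ hp.2.2 _).1⟩
  · rw [hΦe]
    exact hmaps

theorem isReducible_of_const (hT : IsOpenInterval T) (hadm : IsAdmissible I J f D K)
    (hf : ∀ x ∈ I, deriv f x = 0) : IsReducible T I J f D K := by
  have hI := hadm.interval_x
  have hJ := hadm.interval_u
  obtain ⟨x₀, hx₀⟩ := hI.2.2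
  set c := f x₀ with hc
  have hc0 : c ≠ 0 := hadm.f_ne_zero x₀ hx₀
  have hfc : ∀ x ∈ I, f x = c := fun x hx => hI.eq_of_hasDerivAt_zero (fun y hy => by
    have h := (hadm.differentiableAt_f hy).hasDerivAt
    rwa [hf y hy] at h) hx hx₀
  have hΩ := isOpen_box hT.1 hI.1 hJ.1
  have hθ : ∀ t, HasDerivAt (fun t : ℝ => t / c) (1 / c) t := fun t => (hasDerivAt_id' t).div_const c
  obtain ⟨Φ, hΦ, hΦe⟩ := exists_triangular_pointTransformation hT hI hJ (θ := fun t => t / c)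
    (Y := fun _ x => x) (G := fun p => p.2.2) (by fun_prop)
    (by unfold SmoothOn₂; fun_prop) (by fun_prop)
    (fun t _ t' _ h => by simpa [hc0, div_left_inj'] using h)
    (fun t _ x _ x' _ h => h) (fun t _ x _ u _ u' _ h => h)
    (fun t _ => by rw [(hθ t).deriv]; exact one_div_ne_zero hc0)
    (fun t _ x _ => by rw [(hasDerivAt_id' x).deriv]; exact one_ne_zero)
    (by
      rintro ⟨t, x, u⟩ hp
      have h1 := hasDerivAt_slice_u (F := fun p : PointSpace => p.2.2) (t := t) (x := x) (u := u)
        (by fun_prop)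
      rw [h1.unique (hasDerivAt_id' u)]
      exact one_ne_zero)
  refine ⟨I, J, D, K, Φ, ⟨hI, hJ, contDiffOn_const, hadm.smooth_D, hadm.smooth_K,
    fun _ _ => one_ne_zero, hadm.D_ne_zero, hadm.nonlinear⟩, hΦ, fun p hp => ?_, ?_⟩
  · rw [hΦe]
    exact ⟨hp.2.1, hp.2.2⟩
  · rw [hΦe]
    intro U W v w hU hW hv hw hin hmap t x htx
    obtain ⟨ht, hx, hu⟩ := hin t x htx
    have hwv : ∀ r y, (r, y) ∈ U → w (r / c) y = v r y := fun r y h => (hmap r y h).2.symm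
    have hev : w (t / c) =ᶠ[nhds x] v t := by
      have h : {y | (t, y) ∈ U} ∈ nhds x :=
        (hU.preimage (by fun_prop : Continuous fun y : ℝ => (t, y))).mem_nhds htx
      exact Filter.eventually_of_mem h fun y hy => hwv t y hy
    have e1 : deriv (fun y => w (t / c) y) x = deriv (fun y => v t y) x := hev.deriv_eq
    have e2 : deriv (fun y => D (w (t / c) y) * deriv (fun z => w (t / c) z) y) x
        = deriv (fun y => D (v t y) * deriv (fun z => v t z) y) x := by
      refine Filter.EventuallyEq.deriv_eq ?_
      filter_upwards [hev, hev.deriv] with y h1 h2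
      rw [h1]
      congr 1
    have e3 : deriv (fun r => v r x) t = deriv (fun r => w r x) (t / c) * (1 / c) := by
      have h : {r | (r, x) ∈ U} ∈ nhds t :=
        (hU.preimage (by fun_prop : Continuous fun r : ℝ => (r, x))).mem_nhds htx
      have h1 : (fun r => v r x) =ᶠ[nhds t] fun r => w (r / c) x :=
        Filter.eventually_of_mem h fun r hr => (hwv r x hr).symm
      have hWo : IsOpen {r | (r, x) ∈ W} :=
        hW.preimage (by fun_prop : Continuous fun r : ℝ => (r, x))
      have hwt : ContDiffOn ℝ ∞ (fun r => w r x) {r | (r, x) ∈ W} :=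
        ContDiffOn.comp (g := fun z : ℝ × ℝ => w z.1 z.2) (f := fun y => (y, x)) hw
          (contDiff_id.prodMk contDiff_const).contDiffOn fun _ h => h
      have h2 : HasDerivAt (fun r => w (r / c) x) (deriv (fun r => w r x) (t / c) * (1 / c)) t :=
        HasDerivAt.comp (h₂ := fun r => w r x) t
          (hwt.hasDerivAt_of_isOpen hWo (hmap t x htx).1) (hθ t)
      rw [h1.deriv_eq, h2.deriv]
    change f x * deriv (fun r => v r x) t = _ ↔ 1 * deriv (fun r => w r x) (t / c)
      = deriv (fun y => D (w (t / c) y) * deriv (fun z => w (t / c) z) y) x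
        + K (w (t / c) x) * deriv (fun y => w (t / c) y) x
    rw [e1, e2, e3, hwv t x htx, hfc x hx]
    have e4 : c * (deriv (fun r => w r x) (t / c) * (1 / c))
        = 1 * deriv (fun r => w r x) (t / c) := by
      field_simp
    rw [e4]

end

section

variable {T I J : Set ℝ} {f D K : ℝ → ℝ}

theorem smoothOn₂_of_x {g : ℝ → ℝ} (hg : ContDiffOn ℝ ∞ g I) : SmoothOn₂ T I fun _ x => g x :=
  hg.comp (f := fun z : ℝ × ℝ => z.2) (by fun_prop) fun _ hz => hz.2

/-- Reduction without the term `k₀ u_x`; here `X(x) = expInt (-k₁) (x - x₀)` is a variable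
in which `k₁ D(u) u_x` is absent, and `l` is a linear function of `X`. -/
theorem isReducible_of_linear {μ ν k₁ a x₀ : ℝ} (hT : IsOpenInterval T)
    (hadm : IsAdmissible I J f D K)
    (hD : ∀ u ∈ J, (μ * u + ν) * deriv D u = D u) (hK : ∀ u ∈ J, K u = k₁ * D u) (hx₀ : x₀ ∈ I)
    (hpos : ∀ x ∈ I, 0 < 1 + (μ + 1) * a * expInt (-k₁) (x - x₀))
    (hf : ∀ x ∈ I, (1 + (μ + 1) * a * expInt (-k₁) (x - x₀)) * (deriv f x + 2 * k₁ * f x)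
      = -(4 * μ + 3) * a * Real.exp (-k₁ * (x - x₀)) * f x) :
    IsReducible T I J f D K := by
  have hI := hadm.interval_x
  set X : ℝ → ℝ := fun x => expInt (-k₁) (x - x₀) with hX
  set Z : ℝ → ℝ := fun x => Real.exp (-k₁ * (x - x₀)) with hZ
  set l : ℝ → ℝ := fun x => 1 + (μ + 1) * a * X x with hl
  have hX0 : X x₀ = 0 := by simp [hX]
  have hX' : ∀ x, HasDerivAt X (Z x) x := fun x => hasDerivAt_expInt_sub _ _ _
  have hZ' : ∀ x, HasDerivAt Z (-k₁ * Z x) x := fun x => by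
    refine (((hasDerivAt_id' x).sub_const x₀).const_mul (-k₁)).exp.congr_deriv ?_
    simp only [hZ]
    ring
  have hl' : ∀ x, HasDerivAt l ((μ + 1) * a * Z x) x := fun x =>
    ((hX' x).const_mul _).const_add _
  have hZ0 : ∀ x, Z x ≠ 0 := fun x => Real.exp_ne_zero _
  have hl0 : ∀ x ∈ I, l x ≠ 0 := fun x hx => (hpos x hx).ne'
  have cX : ContDiff ℝ ∞ X := (contDiff_expInt _).comp (contDiff_id.sub contDiff_const)
  have cl : ContDiff ℝ ∞ l := contDiff_const.add (contDiff_const.mul cX)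
  obtain ⟨s, cs, hs0, hs⟩ : ∃ s : ℝ → ℝ, ContDiffOn ℝ ∞ s I ∧ s x₀ = 0 ∧ ∀ x ∈ I,
      HasDerivAt s (-a * Z x / l x) x ∧ Real.exp ((μ + 1) * s x) = 1 / l x := by
    by_cases hμ : μ + 1 = 0
    · have hl1 : ∀ x, l x = 1 := fun x => by simp [hl, hμ]
      refine ⟨fun x => -a * X x, (contDiff_const.mul cX).contDiffOn, by simp [hX0],
        fun x _ => ⟨?_, by simp [hμ, hl1]⟩⟩
      rw [hl1, div_one]
      exact (hX' x).const_mul _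
    · refine ⟨fun x => -(Real.log (l x) / (μ + 1)), ((cl.contDiffOn.log hl0).div_const _).neg,
        by simp [hl, hX0], fun x hx => ⟨?_, ?_⟩⟩
      · refine ((((hl' x).log (hl0 x hx)).div_const (μ + 1)).neg).congr_deriv ?_
        have := hl0 x hx
        field_simp
      · have e : (μ + 1) * -(Real.log (l x) / (μ + 1)) = -Real.log (l x) := by field_simp
        rw [e, Real.exp_neg, Real.exp_log (hpos x hx), one_div]
  have hfC : ∀ x ∈ I, f x * Real.exp (-((4 * μ + 3) * s x) + 2 * k₁ * (x - x₀)) = f x₀ := by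
    intro x hx
    have h := hI.eq_of_hasDerivAt_zero
      (g := fun x => f x * Real.exp (-((4 * μ + 3) * s x) + 2 * k₁ * (x - x₀))) (fun y hy => by
        refine ((hadm.differentiableAt_f hy).hasDerivAt.mul
          (((((hs y hy).1.const_mul (4 * μ + 3)).neg).add
            (((hasDerivAt_id' y).sub_const x₀).const_mul (2 * k₁))).exp)).congr_deriv ?_
        have e1 : l y * (deriv f y + 2 * k₁ * f y) = -(4 * μ + 3) * a * Z y * f y := hf y hy
        have e2 := hl0 y hy
        have e3 : deriv f y = -(4 * μ + 3) * a * Z y * f y / l y - 2 * k₁ * f y := by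
          field_simp
          linear_combination e1
        simp only [Pi.add_apply, Pi.neg_apply]
        rw [e3]
        ring) hx hx₀
    simpa [hs0] using h
  have hC := hadm.f_ne_zero x₀ hx₀
  have hY' : ∀ x ∈ I, HasDerivAt (fun x => X x / l x) (Z x / l x ^ 2) x := by
    intro x hx
    refine ((hX' x).div (hl' x) (hl0 x hx)).congr_deriv ?_
    congr 1
    simp only [hl]
    ring
  have hθ : ∀ t, HasDerivAt (fun t : ℝ => t / f x₀) (1 / f x₀) t := fun t =>
    (hasDerivAt_id' t).div_const _
  refine ReductionData.isReducible (μ := μ) (ν := ν) (k₀ := 0) (k₁ := k₁)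
    (θ := fun t => t / f x₀) (Y := fun _ x => X x / l x) (s := fun _ => s)
    (E := fun _ x => l x / Z x) ?_ hT hadm hD (fun u hu => by rw [hK u hu, add_zero])
  constructor
  · fun_prop
  · exact smoothOn₂_of_x (cX.contDiffOn.div cl.contDiffOn hl0)
  · exact smoothOn₂_of_x cs
  · intro t _ t' _ h
    simpa [hC, div_left_inj'] using h
  · intro t _ x hx x' hx' h
    have h1 := hl0 x hx
    have h2 := hl0 x' hx'
    have h3 : X x = X x' := by
      have h4 : X x * l x' = X x' * l x := by
        have : X x / l x = X x' / l x' := h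
        field_simp at this
        linarith
      simp only [hl] at h4
      linarith
    have h5 := (strictMono_expInt (-k₁)).injective h3
    linarith
  · intro t _
    rw [(hθ t).deriv]
    exact one_div_ne_zero hC
  · intro t _ x hx
    rw [(hY' x hx).deriv]
    exact div_ne_zero (hZ0 x) (pow_ne_zero 2 (hl0 x hx))
  · intro t _ x hx
    rw [(hY' x hx).deriv, (hs x hx).2]
    have := hZ0 x
    have := hl0 x hx
    field_simp
  · intro t _ x hx
    rw [(hs x hx).1.deriv]
    refine ((hl' x).div (hZ' x) (hZ0 x)).congr_deriv ?_
    have := hZ0 x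
    have := hl0 x hx
    field_simp
    ring
  · intro t _
    refine ⟨-a, fun x hx => ?_⟩
    rw [(hs x hx).1.deriv]
    have := hZ0 x
    have := hl0 x hx
    field_simp
  · intro t _ x hx
    rw [(hY' x hx).deriv, (hθ t).deriv]
    have e1 := hfC x hx
    have e2 : Real.exp (-((4 * μ + 3) * s x) + 2 * k₁ * (x - x₀))
        * (Real.exp (μ * s x) * Real.exp ((μ + 1) * s x) ^ 3 * Z x ^ 2) = 1 := by
      simp only [hZ]
      rw [← Real.exp_nat_mul, ← Real.exp_nat_mul, ← Real.exp_add, ← Real.exp_add, ← Real.exp_add]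
      refine Real.exp_eq_one_iff _ |>.2 ?_
      push_cast
      ring
    rw [(hs x hx).2] at e2
    have e3 : f x = f x₀ * (Real.exp (μ * s x) * (1 / l x) ^ 3 * Z x ^ 2) := by
      rw [← e1, mul_assoc, e2, mul_one]
    have := hZ0 x
    have := hl0 x hx
    change f x * (l x / Z x) * (1 / f x₀) = Z x / l x ^ 2 * Real.exp (μ * s x)
    rw [e3]
    field_simp
  · intro t _ x _
    simp
  · intro t _ x _
    simp

/-- Reduction in the presence of the term `k₀ u_x`, with a transformation depending on time. -/
theorem isReducible_of_inverse_linear {ν k₀ c d : ℝ} (hT : IsOpenInterval T)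
    (hadm : IsAdmissible I J f D K)
    (hD : ∀ u ∈ J, (-2 / 3 * u + ν) * deriv D u = D u) (hK : ∀ u ∈ J, K u = k₀) (hk₀ : k₀ ≠ 0)
    (hd : d ≠ 0) (hf : ∀ x ∈ I, f x * (c + d * x) = 1) :
    IsReducible T I J f D K := by
  have hI := hadm.interval_x
  set l : ℝ → ℝ := fun x => c + d * x with hl
  have hl0 : ∀ x ∈ I, l x ≠ 0 := fun x hx h0 => by
    have h := hf x hx
    have h0' : c + d * x = 0 := h0
    rw [h0', mul_zero] at h
    exact zero_ne_one h
  have hl' : ∀ x, HasDerivAt l d x := fun x => by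
    exact (((hasDerivAt_id' x).const_mul d).const_add c).congr_deriv (mul_one d)
  have hk : k₀ * d ≠ 0 := mul_ne_zero hk₀ hd
  obtain ⟨σ, hσ, hσl⟩ : ∃ σ : ℝ, σ ^ 2 = 1 ∧ ∀ x ∈ I, |l x| = σ * l x := by
    have hcont : ContinuousOn l I := by fun_prop
    obtain ⟨x₀, hx₀⟩ := hI.2.2
    rcases lt_or_gt_of_ne (hl0 x₀ hx₀) with h | h
    · refine ⟨-1, by norm_num, fun x hx => ?_⟩
      have : l x < 0 := by
        by_contra hneg
        obtain ⟨z, hz, hz0⟩ := hI.isPreconnected.intermediate_value hx₀ hx hcont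
          (⟨h.le, not_lt.1 hneg⟩ : (0 : ℝ) ∈ Set.Icc _ _)
        exact hl0 z hz hz0
      rw [abs_of_neg this]
      ring
    · refine ⟨1, by norm_num, fun x hx => ?_⟩
      have : 0 < l x := by
        by_contra hneg
        obtain ⟨z, hz, hz0⟩ := hI.isPreconnected.intermediate_value hx hx₀ hcont
          (⟨not_lt.1 hneg, h.le⟩ : (0 : ℝ) ∈ Set.Icc _ _)
        exact hl0 z hz hz0
      rw [abs_of_pos this]
      ring
  have hσ0 : σ ≠ 0 := fun h => by simp [h] at hσ
  set κ := k₀ * d with hκ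
  have hexp : ∀ t, HasDerivAt (fun t : ℝ => Real.exp (κ * t)) (κ * Real.exp (κ * t)) t := fun t => by
    refine ((hasDerivAt_id' t).const_mul κ).exp.congr_deriv ?_
    ring
  have hexpn : ∀ t, HasDerivAt (fun t : ℝ => Real.exp (-(κ * t))) (-κ * Real.exp (-(κ * t))) t :=
    fun t => by
      refine ((hasDerivAt_id' t).const_mul κ).neg.exp.congr_deriv ?_
      simp only [Pi.neg_apply]
      ring
  have hθ : ∀ t, HasDerivAt (fun t : ℝ => σ * d ^ 2 / κ * Real.exp (κ * t))
      (σ * d ^ 2 * Real.exp (κ * t)) t := fun t => by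
    refine ((hexp t).const_mul _).congr_deriv ?_
    field_simp
  have hYx : ∀ t, ∀ x ∈ I, HasDerivAt (fun x => -Real.exp (-(κ * t)) / l x)
      (Real.exp (-(κ * t)) * d / l x ^ 2) x := fun t x hx => by
    refine ((hasDerivAt_const x (-Real.exp (-(κ * t)))).div (hl' x) (hl0 x hx)).congr_deriv ?_
    ring
  have hYt : ∀ t x, HasDerivAt (fun t => -Real.exp (-(κ * t)) / l x)
      (κ * Real.exp (-(κ * t)) / l x) t := fun t x => by
    refine ((hexpn t).neg.div_const (l x)).congr_deriv ?_
    ring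
  have hsx : ∀ t, ∀ x ∈ I, HasDerivAt (fun x => -3 * (Real.log (l x) + κ * t))
      (-3 * (d / l x)) x := fun t x hx =>
    (((hl' x).log (hl0 x hx)).add_const _).const_mul _
  have hst : ∀ t x, HasDerivAt (fun t => -3 * (Real.log (l x) + κ * t)) (-3 * κ) t := fun t x => by
    simpa using ((((hasDerivAt_id' t).const_mul κ).const_add (Real.log (l x))).const_mul (-3))
  refine ReductionData.isReducible (μ := -2 / 3) (ν := ν) (k₀ := k₀) (k₁ := 0)
    (θ := fun t => σ * d ^ 2 / κ * Real.exp (κ * t)) (Y := fun t x => -Real.exp (-(κ * t)) / l x)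
    (s := fun t x => -3 * (Real.log (l x) + κ * t))
    (E := fun _ x => σ * l x / d) ?_ hT hadm hD (fun u hu => by rw [hK u hu, zero_mul, zero_add])
  have cl : ContDiffOn ℝ ∞ (fun z : ℝ × ℝ => l z.2) (T ×ˢ I) := by fun_prop
  have hexpl : ∀ t, ∀ x ∈ I, Real.exp (Real.log (l x) + κ * t) = σ * l x * Real.exp (κ * t) := by
    intro t x hx
    rw [Real.exp_add, ← Real.log_abs, Real.exp_log (abs_pos.2 (hl0 x hx)), hσl x hx]
  constructor
  · fun_prop
  · exact ContDiffOn.div (by fun_prop) cl fun z hz => hl0 _ hz.2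
  · exact contDiffOn_const.mul ((cl.log fun z hz => hl0 _ hz.2).add (by fun_prop))
  · intro t _ t' _ h
    have h1 : σ * d ^ 2 / κ ≠ 0 := div_ne_zero (mul_ne_zero hσ0 (pow_ne_zero 2 hd)) hk
    have h2 := Real.exp_injective (mul_left_cancel₀ h1 h)
    exact mul_left_cancel₀ hk h2
  · intro t _ x hx x' hx' h
    have h1 := hl0 x hx
    have h2 := hl0 x' hx'
    have h3 := Real.exp_ne_zero (-(κ * t))
    have h4 : -Real.exp (-(κ * t)) / l x = -Real.exp (-(κ * t)) / l x' := h
    rw [div_eq_div_iff h1 h2] at h4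
    have h5 := mul_left_cancel₀ (neg_ne_zero.2 h3) h4
    simp only [hl] at h5
    exact (mul_left_cancel₀ hd (add_left_cancel h5)).symm
  · intro t _
    rw [(hθ t).deriv]
    exact mul_ne_zero (mul_ne_zero hσ0 (pow_ne_zero 2 hd)) (Real.exp_ne_zero _)
  · intro t _ x hx
    rw [(hYx t x hx).deriv]
    exact div_ne_zero (mul_ne_zero (Real.exp_ne_zero _) hd) (pow_ne_zero 2 (hl0 x hx))
  · intro t _ x hx
    rw [(hYx t x hx).deriv]
    have e1 : (-2 / 3 + 1 : ℝ) * (-3 * (Real.log (l x) + κ * t))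
        = -(Real.log (l x) + κ * t) := by ring
    rw [e1, Real.exp_neg (Real.log (l x) + κ * t), hexpl t x hx, Real.exp_neg]
    have := hl0 x hx
    have := Real.exp_ne_zero (κ * t)
    field_simp
    exact hσ
  · intro t _ x hx
    rw [(hsx t x hx).deriv]
    refine (((hl' x).const_mul σ).div_const d).congr_deriv ?_
    have := hl0 x hx
    field_simp
    ring
  · intro t _
    refine ⟨-3 * σ, fun x hx => ?_⟩
    rw [(hsx t x hx).deriv]
    have := hl0 x hx
    field_simp
  · intro t _ x hx
    rw [(hYx t x hx).deriv, (hθ t).deriv]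
    have e1 : (-2 / 3 : ℝ) * (-3 * (Real.log (l x) + κ * t))
        = (2 : ℕ) * (Real.log (l x) + κ * t) := by
      push_cast
      ring
    rw [e1, Real.exp_nat_mul, hexpl t x hx, Real.exp_neg]
    have h1 := hl0 x hx
    have h2 := Real.exp_ne_zero (κ * t)
    have h3 : f x * l x = 1 := hf x hx
    have h4 : f x = 1 / l x := by
      field_simp
      exact h3
    rw [h4]
    field_simp
  · intro t _ x hx
    rw [(hYx t x hx).deriv, (hYt t x).deriv]
    have h1 := hl0 x hx
    have h3 : f x * l x = 1 := hf x hx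
    have h4 : f x = 1 / l x := by
      field_simp
      exact h3
    rw [h4]
    field_simp
    simp only [hκ]
  · intro t _ x hx
    rw [(hsx t x hx).deriv, (hst t x).deriv]
    have h1 := hl0 x hx
    have h3 : f x * l x = 1 := hf x hx
    have h4 : f x = 1 / l x := by
      field_simp
      exact h3
    rw [h4]
    field_simp
    simp only [hκ]

end

section

variable {T I J : Set ℝ} {f D K : ℝ → ℝ} {𝔤 : Submodule ℝ (PointSpace → PointSpace)}

/-- The coefficient of `∂_t` at a point. -/
def evalT (p : PointSpace) : (PointSpace → PointSpace) →ₗ[ℝ] ℝ :=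
  LinearMap.fst ℝ ℝ (ℝ × ℝ) ∘ₗ LinearMap.proj p

/-- The coefficient of `∂_x` at a point. -/
def evalX (p : PointSpace) : (PointSpace → PointSpace) →ₗ[ℝ] ℝ :=
  LinearMap.fst ℝ ℝ ℝ ∘ₗ LinearMap.snd ℝ ℝ (ℝ × ℝ) ∘ₗ LinearMap.proj p

/-- The coefficient of `∂_u` at a point. -/
def evalU (p : PointSpace) : (PointSpace → PointSpace) →ₗ[ℝ] ℝ :=
  LinearMap.snd ℝ ℝ ℝ ∘ₗ LinearMap.snd ℝ ℝ (ℝ × ℝ) ∘ₗ LinearMap.proj p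

theorem exists_ne_zero_vanishing (hdim : 4 ≤ Module.rank ℝ 𝔤)
    (l₁ l₂ l₃ : (PointSpace → PointSpace) →ₗ[ℝ] ℝ) :
    ∃ Q ∈ 𝔤, Q ≠ 0 ∧ l₁ Q = 0 ∧ l₂ Q = 0 ∧ l₃ Q = 0 := by
  obtain ⟨Q, hQ, hQ0, hl⟩ := exists_ne_zero_of_four_le_rank hdim (LinearMap.pi ![l₁, l₂, l₃])
  exact ⟨Q, hQ, hQ0, congrFun hl 0, congrFun hl 1, congrFun hl 2⟩

theorem SymmetryCoefficients.eq_zero {Q : PointSpace → PointSpace} {τ : ℝ → ℝ}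
    {ξ a b : ℝ → ℝ → ℝ} (h : SymmetryCoefficients T I J f D K Q τ ξ a b)
    (h𝔤 : IsInvarianceAlgebra f D K (box T I J) 𝔤) (hQ : Q ∈ 𝔤)
    (hτ : ∀ t ∈ T, τ t = 0) (hξ : ∀ t ∈ T, ∀ x ∈ I, ξ t x = 0)
    (hη : ∀ t ∈ T, ∀ x ∈ I, ∀ u ∈ J, a t x * u + b t x = 0) : Q = 0 := by
  funext p
  by_cases hp : p ∈ box T I J
  · obtain ⟨t, x, u⟩ := p
    obtain ⟨ht, hx, hu⟩ := hp
    rw [h.eq t ht x hx u hu, hτ t ht, hξ t ht x hx, hη t ht x hx u hu]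
    rfl
  · exact h𝔤.zero_outside Q hQ p hp

theorem IsInvarianceAlgebra.exists_coefficients
    (h𝔤 : IsInvarianceAlgebra f D K (box T I J) 𝔤) (hT : IsOpenInterval T)
    (hadm : IsAdmissible I J f D K) {Q : PointSpace → PointSpace} (hQ : Q ∈ 𝔤) :
    ∃ τ ξ a b, SymmetryCoefficients T I J f D K Q τ ξ a b :=
  exists_symmetryCoefficients hT hadm (h𝔤.smooth Q hQ) (h𝔤.symmetry Q hQ)

/-! ### Constant diffusivity -/

section

variable {d : ℝ} {Q : PointSpace → PointSpace} {τ : ℝ → ℝ} {ξ a b : ℝ → ℝ → ℝ}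

/-- The determining equations for constant `D`. -/
theorem SymmetryCoefficients.of_const (h : SymmetryCoefficients T I J f D K Q τ ξ a b)
    (hadm : IsAdmissible I J f D K) (hd : ∀ u ∈ J, D u = d) {t x : ℝ} (ht : t ∈ T) (hx : x ∈ I) :
    ξ t x * deriv f x - f x * deriv τ t + 2 * f x * deriv (ξ t) x = 0 ∧
      (∀ u ∈ J, K u * deriv (ξ t) x + f x * deriv (fun s => ξ s x) t
        + (a t x * u + b t x) * deriv K u + d * (2 * deriv (a t) x - deriv (deriv (ξ t)) x) = 0) ∧
      ∀ u ∈ J, f x * (deriv (fun s => a s x) t * u + deriv (fun s => b s x) t)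
        = d * (deriv (deriv (a t)) x * u + deriv (deriv (b t)) x)
          + K u * (deriv (a t) x * u + deriv (b t) x) := by
  have hD' : ∀ u ∈ J, deriv D u = 0 :=
    hadm.interval_u.eq_zero_of_hasDerivAt (fun u hu => (hadm.differentiableAt_D hu).hasDerivAt) hd
  have h0 : ξ t x * deriv f x - f x * deriv τ t + 2 * f x * deriv (ξ t) x = 0 := by
    obtain ⟨u, hu⟩ := hadm.interval_u.2.2
    have h1 := h.eq_uxx t ht x hx u hu
    rw [hD' u hu, mul_zero, mul_zero] at h1
    exact (mul_eq_zero.1 h1).resolve_left (hadm.D_ne_zero u hu)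
  refine ⟨h0, fun u hu => ?_, fun u hu => ?_⟩
  · have h1 := h.eq_ux t ht x hx u hu
    rw [hD' u hu, hd u hu] at h1
    refine mul_left_cancel₀ (hadm.f_ne_zero x hx) ?_
    linear_combination K u * h0 - h1
  · have h1 := h.eq_one t ht x hx u hu
    rwa [hd u hu] at h1

/-- A symmetry with `η_x` depending on `t, x` only makes `f` constant. -/
theorem deriv_f_eq_zero_of_affine (hT : IsOpenInterval T)
    (h : SymmetryCoefficients T I J f D K Q τ ξ a b)
    (hadm : IsAdmissible I J f D K) (hd : ∀ u ∈ J, D u = d) {α β : ℝ} (hα : α ≠ 0)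
    (hK : ∀ u ∈ J, K u = α * u + β) {t₁ x₁ : ℝ} (ht₁ : t₁ ∈ T) (hx₁ : x₁ ∈ I)
    (hb : deriv (b t₁) x₁ ≠ 0) : ∀ x ∈ I, deriv f x = 0 := by
  have hI := hadm.interval_x
  have hJ := hadm.interval_u
  have hK' : ∀ u ∈ J, deriv K u = α := fun u hu => by
    have h1 : HasDerivAt (fun u => α * u + β) α u := by
      simpa using ((hasDerivAt_id' u).const_mul α).add_const β
    exact (h1.congr_of_eventuallyEq (Filter.eventually_of_mem (hJ.mem_nhds hu) hK)).deriv
  have h3 : ∀ t ∈ T, ∀ x ∈ I, deriv (ξ t) x = -a t x ∧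
      β * deriv (ξ t) x + f x * deriv (fun s => ξ s x) t + α * b t x
        + d * (2 * deriv (a t) x - deriv (deriv (ξ t)) x) = 0 := by
    intro t ht x hx
    obtain ⟨e0, e1, -, -⟩ := cubic_eq_zero hJ.infinite (a := β * deriv (ξ t) x
      + f x * deriv (fun s => ξ s x) t + α * b t x
      + d * (2 * deriv (a t) x - deriv (deriv (ξ t)) x)) (b := α * (deriv (ξ t) x + a t x))
      (c := 0) (d := 0) (fun u hu => by
        have e := (h.of_const hadm hd ht hx).2.1 u hu
        rw [hK' u hu, hK u hu] at e
        linear_combination e)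
    have := (mul_eq_zero.1 e1).resolve_left hα
    exact ⟨by linarith, e0⟩
  have h4 : ∀ t ∈ T, ∀ x ∈ I, deriv (a t) x = 0 ∧ f x * deriv (fun s => a s x) t
      = d * deriv (deriv (a t)) x + α * deriv (b t) x := by
    intro t ht x hx
    obtain ⟨-, e1, e2, -⟩ := cubic_eq_zero hJ.infinite
      (a := d * deriv (deriv (b t)) x + β * deriv (b t) x - f x * deriv (fun s => b s x) t)
      (b := d * deriv (deriv (a t)) x + β * deriv (a t) x + α * deriv (b t) x
        - f x * deriv (fun s => a s x) t) (c := α * deriv (a t) x) (d := 0) (fun u hu => by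
        have e := (h.of_const hadm hd ht hx).2.2 u hu
        rw [hK u hu] at e
        linear_combination -e)
    have e3 := (mul_eq_zero.1 e2).resolve_left hα
    refine ⟨e3, ?_⟩
    rw [e3] at e1
    linarith
  have ha : ∀ t ∈ T, ∀ x ∈ I, a t x = a t x₁ := fun t ht x hx =>
    hI.eq_of_hasDerivAt_zero (fun y hy => by
      have e := h.smooth_a.hasDerivAt_x hI ht hy
      rwa [(h4 t ht y hy).1] at e) hx hx₁
  have hξ : ∀ t ∈ T, ∀ x ∈ I, ξ t x = ξ t x₁ - a t x₁ * (x - x₁) := by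
    intro t ht x hx
    have e := hI.eq_of_hasDerivAt_zero (g := fun x => ξ t x + a t x₁ * (x - x₁)) (fun y hy => by
      refine ((h.smooth_ξ.hasDerivAt_x hI ht hy).add
        (((hasDerivAt_id' y).sub_const x₁).const_mul (a t x₁))).congr_deriv ?_
      rw [(h3 t ht y hy).1, ha t ht y hy]
      ring) hx hx₁
    simp only [sub_self, mul_zero, add_zero] at e
    linarith
  set a' := deriv (fun s => a s x₁) t₁ with ha'
  set c' := deriv (fun s => ξ s x₁) t₁ with hc'
  have hat : ∀ x ∈ I, deriv (fun s => a s x) t₁ = a' := fun x hx =>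
    Filter.EventuallyEq.deriv_eq
      (Filter.eventually_of_mem (hT.mem_nhds ht₁) fun t ht => ha t ht x hx)
  have hξt : ∀ x ∈ I, deriv (fun s => ξ s x) t₁ = c' - a' * (x - x₁) := by
    intro x hx
    have e1 : HasDerivAt (fun s => ξ s x₁ - a s x₁ * (x - x₁)) (c' - a' * (x - x₁)) t₁ :=
      (h.smooth_ξ.hasDerivAt_t hT ht₁ hx₁).sub
        ((h.smooth_a.hasDerivAt_t hT ht₁ hx₁).mul_const _)
    exact (e1.congr_of_eventuallyEq
      (Filter.eventually_of_mem (hT.mem_nhds ht₁) fun t ht => hξ t ht x hx)).deriv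
  have haxx : ∀ x ∈ I, deriv (deriv (a t₁)) x = 0 :=
    hI.eq_zero_of_hasDerivAt (fun x hx => h.smooth_a.hasDerivAt_deriv_x hI ht₁ hx)
      fun x hx => (h4 t₁ ht₁ x hx).1
  have hξxx : ∀ x ∈ I, deriv (deriv (ξ t₁)) x = 0 :=
    hI.eq_zero_of_hasDerivAt (c := -a t₁ x₁)
      (fun x hx => h.smooth_ξ.hasDerivAt_deriv_x hI ht₁ hx)
      fun x hx => by rw [(h3 t₁ ht₁ x hx).1, ha t₁ ht₁ x hx]
  have hfa : ∀ x ∈ I, f x * a' = α * deriv (b t₁) x := by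
    intro x hx
    have e := (h4 t₁ ht₁ x hx).2
    rw [hat x hx, haxx x hx] at e
    linarith
  have ha0 : a' ≠ 0 := by
    intro h0
    have e := hfa x₁ hx₁
    rw [h0, mul_zero] at e
    exact mul_ne_zero hα hb e.symm
  have hbx : ∀ x ∈ I, α * deriv (b t₁) x
      + (deriv f x * (c' - a' * (x - x₁)) - f x * a') = 0 := by
    refine hI.eq_zero_of_hasDerivAt (g := fun x => α * b t₁ x + f x * (c' - a' * (x - x₁)))
      (c := β * a t₁ x₁) (fun x hx => ?_) (fun x hx => ?_)
    · refine (((h.smooth_b.hasDerivAt_x hI ht₁ hx).const_mul α).add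
        ((hadm.differentiableAt_f hx).hasDerivAt.mul
          ((((hasDerivAt_id' x).sub_const x₁).const_mul a').const_sub c'))).congr_deriv ?_
      ring
    · have e := (h3 t₁ ht₁ x hx).2
      rw [hξxx x hx, (h3 t₁ ht₁ x hx).1, (h4 t₁ ht₁ x hx).1, hξt x hx, ha t₁ ht₁ x hx] at e
      linarith
  refine eq_zero_of_affine_mul_eq_zero hI.1
    (hadm.smooth_f.contDiffOn_deriv hI.1).continuousOn (a := -a') (b := c' + a' * x₁)
    (Or.inl (neg_ne_zero.2 ha0)) fun x hx => ?_
  linear_combination hbx x hx + hfa x hx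

/-- There is no symmetry with `η_x` depending on `u`. -/
theorem deriv_a_eq_zero_of_const (h : SymmetryCoefficients T I J f D K Q τ ξ a b)
    (hT : IsOpenInterval T) (hadm : IsAdmissible I J f D K) (hd : ∀ u ∈ J, D u = d)
    (hK : ∃ u ∈ J, deriv K u ≠ 0) {t₁ x₁ : ℝ} (ht₁ : t₁ ∈ T) (hx₁ : x₁ ∈ I) :
    deriv (a t₁) x₁ = 0 := by
  have hI := hadm.interval_x
  have hJ := hadm.interval_u
  by_contra hγ
  set γ := deriv (a t₁) x₁ with hγd
  set δ := deriv (b t₁) x₁ with hδd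
  set α := f x₁ * deriv (fun s => a s x₁) t₁ - d * deriv (deriv (a t₁)) x₁ with hα
  set β := f x₁ * deriv (fun s => b s x₁) t₁ - d * deriv (deriv (b t₁)) x₁ with hβ
  set r := -δ / γ with hr
  set k₀ := α / γ with hk₀
  set k₁ := (β + α * r) / γ with hk₁
  have hKr : ∀ u ∈ J, (u - r) * (K u - k₀) = k₁ := by
    intro u hu
    have e := (h.of_const hadm hd ht₁ hx₁).2.2 u hu
    rw [← hγd, ← hδd] at e
    have e2 : (γ * u + δ) * K u = α * u + β := by
      simp only [hα, hβ]
      linear_combination -e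
    simp only [hk₁, hk₀, hr]
    field_simp
    linear_combination γ * e2
  have hk₁0 : k₁ ≠ 0 := by
    intro h0
    obtain ⟨u, hu, hu'⟩ := hK
    have e := eq_zero_of_affine_mul_eq_zero hJ.1 (g := fun u => K u - k₀)
      (hadm.smooth_K.continuousOn.sub continuousOn_const) (a := 1) (b := -r)
      (Or.inl one_ne_zero) fun u hu => by
        have := hKr u hu
        rw [h0] at this
        linarith
    exact hu' (hJ.eq_zero_of_hasDerivAt (c := k₀)
      (fun v hv => (hadm.differentiableAt_K hv).hasDerivAt) (fun v hv => by linarith [e v hv]) u hu)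
  have hK' : ∀ u ∈ J, (u - r) ^ 2 * deriv K u = -k₁ := by
    intro u hu
    have e := hJ.eq_zero_of_hasDerivAt (g := fun u => (u - r) * (K u - k₀)) (fun v hv =>
      ((hasDerivAt_id' v).sub_const r).mul
        ((hadm.differentiableAt_K hv).hasDerivAt.sub_const k₀)) hKr u hu
    linear_combination (u - r) * e - hKr u hu
  have hinf : ((fun u => u - r) '' J).Infinite :=
    hJ.infinite.image (fun u _ v _ h => sub_left_injective h)
  have hb : ∀ t ∈ T, ∀ x ∈ I, a t x * r + b t x = 0 := by
    intro t ht x hx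
    obtain ⟨e0, -, -, -⟩ := cubic_eq_zero hinf (a := -k₁ * (a t x * r + b t x))
      (b := k₁ * deriv (ξ t) x - k₁ * a t x)
      (c := k₀ * deriv (ξ t) x + f x * deriv (fun s => ξ s x) t
        + d * (2 * deriv (a t) x - deriv (deriv (ξ t)) x)) (d := 0) (by
        rintro _ ⟨u, hu, rfl⟩
        have e := (h.of_const hadm hd ht hx).2.1 u hu
        have e1 := hKr u hu
        have e2 := hK' u hu
        simp only
        linear_combination (u - r) ^ 2 * e - (a t x * u + b t x) * e2
          - (u - r) * deriv (ξ t) x * e1)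
    exact (mul_eq_zero.1 e0).resolve_left (neg_ne_zero.2 hk₁0)
  have hb' : ∀ t ∈ T, ∀ x ∈ I, b t x = -r * a t x := fun t ht x hx => by
    linarith [hb t ht x hx]
  have hbx : ∀ x ∈ I, deriv (b t₁) x = -r * deriv (a t₁) x := by
    intro x hx
    exact (((h.smooth_a.hasDerivAt_x hI ht₁ hx).const_mul (-r)).congr_of_eventuallyEq
      (Filter.eventually_of_mem (hI.mem_nhds hx) fun y hy => hb' t₁ ht₁ y hy)).deriv
  have hbxx : deriv (deriv (b t₁)) x₁ = -r * deriv (deriv (a t₁)) x₁ :=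
    (((h.smooth_a.hasDerivAt_deriv_x hI ht₁ hx₁).const_mul (-r)).congr_of_eventuallyEq
      (Filter.eventually_of_mem (hI.mem_nhds hx₁) fun y hy => hbx y hy)).deriv
  have hbt : deriv (fun s => b s x₁) t₁ = -r * deriv (fun s => a s x₁) t₁ :=
    (((h.smooth_a.hasDerivAt_t hT ht₁ hx₁).const_mul (-r)).congr_of_eventuallyEq
      (Filter.eventually_of_mem (hT.mem_nhds ht₁) fun s hs => hb' s hs x₁ hx₁)).deriv
  obtain ⟨e0, -, -, -⟩ := cubic_eq_zero hinf (a := k₁ * deriv (a t₁) x₁)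
    (b := d * deriv (deriv (a t₁)) x₁ + k₀ * deriv (a t₁) x₁
      - f x₁ * deriv (fun s => a s x₁) t₁) (c := 0) (d := 0) (by
      rintro _ ⟨u, hu, rfl⟩
      have e := (h.of_const hadm hd ht₁ hx₁).2.2 u hu
      rw [hbxx, hbt, hbx x₁ hx₁] at e
      simp only
      linear_combination -e - deriv (a t₁) x₁ * hKr u hu)
  exact hγ ((mul_eq_zero.1 e0).resolve_left hk₁0)

end

theorem deriv_f_eq_zero_of_const (hT : IsOpenInterval T) (hadm : IsAdmissible I J f D K)
    (h𝔤 : IsInvarianceAlgebra f D K (box T I J) 𝔤) (hdim : 4 ≤ Module.rank ℝ 𝔤)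
    (hD : ∀ u ∈ J, deriv D u = 0) : ∀ x ∈ I, deriv f x = 0 := by
  have hI := hadm.interval_x
  have hJ := hadm.interval_u
  obtain ⟨t₀, ht₀⟩ := hT.2.2
  obtain ⟨x₀, hx₀⟩ := hI.2.2
  obtain ⟨u₁, hu₁, hKu₁⟩ : ∃ u ∈ J, deriv K u ≠ 0 := by
    obtain ⟨u, hu, h | h⟩ := hadm.nonlinear
    · exact absurd (hD u hu) h
    · exact ⟨u, hu, h⟩
  set d := D u₁ with hd₁
  have hd : ∀ u ∈ J, D u = d := fun u hu => hJ.eq_of_hasDerivAt_zero (fun v hv => by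
    have e := (hadm.differentiableAt_D hv).hasDerivAt
    rwa [hD v hv] at e) hu hu₁
  have hKc : ∀ c, ¬ ∀ u ∈ J, K u = c := fun c hc =>
    hKu₁ (hJ.eq_zero_of_hasDerivAt (fun v hv => (hadm.differentiableAt_K hv).hasDerivAt) hc u₁ hu₁)
  by_contra hcon
  obtain ⟨Q, hQ, hQ0, hl1, hl2, hl3⟩ := exists_ne_zero_vanishing hdim (evalT (t₀, x₀, u₁))
    (evalX (t₀, x₀, u₁)) (evalU (t₀, x₀, u₁))
  obtain ⟨τ, ξ, a, b, h⟩ := h𝔤.exists_coefficients hT hadm hQ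
  simp only [evalT, evalX, evalU, LinearMap.comp_apply, LinearMap.proj_apply, LinearMap.fst_apply,
    LinearMap.snd_apply, h.eq t₀ ht₀ x₀ hx₀ u₁ hu₁] at hl1 hl2 hl3
  have hax : ∀ t ∈ T, ∀ x ∈ I, deriv (a t) x = 0 := fun t ht x hx =>
    deriv_a_eq_zero_of_const h hT hadm hd ⟨u₁, hu₁, hKu₁⟩ ht hx
  have haxx : ∀ t ∈ T, ∀ x ∈ I, deriv (deriv (a t)) x = 0 := fun t ht =>
    hI.eq_zero_of_hasDerivAt (fun x hx => h.smooth_a.hasDerivAt_deriv_x hI ht hx) (hax t ht)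
  have hbx : ∀ t ∈ T, ∀ x ∈ I, deriv (b t) x = 0 := by
    intro t ht x hx
    by_contra hb
    set α := f x * deriv (fun s => a s x) t / deriv (b t) x with hα
    set β := (f x * deriv (fun s => b s x) t - d * deriv (deriv (b t)) x) / deriv (b t) x with hβ
    have hK : ∀ u ∈ J, K u = α * u + β := by
      intro u hu
      have e := (h.of_const hadm hd ht hx).2.2 u hu
      rw [hax t ht x hx, haxx t ht x hx] at e
      simp only [hα, hβ]
      field_simp
      linear_combination -e
    have hα0 : α ≠ 0 := by
      intro h0
      refine hKc β fun u hu => ?_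
      rw [hK u hu, h0, zero_mul, zero_add]
    exact hcon (deriv_f_eq_zero_of_affine hT h hadm hd hα0 hK ht hx hb)
  have hbxx : ∀ t ∈ T, ∀ x ∈ I, deriv (deriv (b t)) x = 0 := fun t ht =>
    hI.eq_zero_of_hasDerivAt (fun x hx => h.smooth_b.hasDerivAt_deriv_x hI ht hx) (hbx t ht)
  have habt : ∀ t ∈ T, ∀ x ∈ I,
      deriv (fun s => a s x) t = 0 ∧ deriv (fun s => b s x) t = 0 := by
    intro t ht x hx
    obtain ⟨e0, e1, -, -⟩ := cubic_eq_zero hJ.infinite (a := f x * deriv (fun s => b s x) t)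
      (b := f x * deriv (fun s => a s x) t) (c := 0) (d := 0) (fun u hu => by
        have e := (h.of_const hadm hd ht hx).2.2 u hu
        rw [hax t ht x hx, haxx t ht x hx, hbx t ht x hx, hbxx t ht x hx] at e
        linear_combination e)
    have hf := hadm.f_ne_zero x hx
    exact ⟨(mul_eq_zero.1 e1).resolve_left hf, (mul_eq_zero.1 e0).resolve_left hf⟩
  have hac : ∀ t ∈ T, ∀ x ∈ I, a t x = a t₀ x₀ := by
    intro t ht x hx
    have e1 : a t x = a t x₀ := hI.eq_of_hasDerivAt_zero (fun y hy => by
      have e := h.smooth_a.hasDerivAt_x hI ht hy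
      rwa [hax t ht y hy] at e) hx hx₀
    have e2 : a t x₀ = a t₀ x₀ := hT.eq_of_hasDerivAt_zero (g := fun s => a s x₀) (fun s hs => by
      have e := h.smooth_a.hasDerivAt_t hT hs hx₀
      rwa [(habt s hs x₀ hx₀).1] at e) ht ht₀
    rw [e1, e2]
  have hbc : ∀ t ∈ T, ∀ x ∈ I, b t x = b t₀ x₀ := by
    intro t ht x hx
    have e1 : b t x = b t x₀ := hI.eq_of_hasDerivAt_zero (fun y hy => by
      have e := h.smooth_b.hasDerivAt_x hI ht hy
      rwa [hbx t ht y hy] at e) hx hx₀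
    have e2 : b t x₀ = b t₀ x₀ := hT.eq_of_hasDerivAt_zero (g := fun s => b s x₀) (fun s hs => by
      have e := h.smooth_b.hasDerivAt_t hT hs hx₀
      rwa [(habt s hs x₀ hx₀).2] at e) ht ht₀
    rw [e1, e2]
  set α := a t₀ x₀ with hα
  have hη : ∀ t ∈ T, ∀ x ∈ I, ∀ u, a t x * u + b t x = α * (u - u₁) := by
    intro t ht x hx u
    rw [hac t ht x hx, hbc t ht x hx]
    linarith
  have h3 : ∀ t ∈ T, ∀ x ∈ I, ∀ u ∈ J, K u * deriv (ξ t) x + f x * deriv (fun s => ξ s x) t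
      + α * (u - u₁) * deriv K u - d * deriv (deriv (ξ t)) x = 0 := by
    intro t ht x hx u hu
    have e := (h.of_const hadm hd ht hx).2.1 u hu
    rw [hη t ht x hx, hax t ht x hx] at e
    linarith
  have h3' : ∀ t ∈ T, ∀ x ∈ I, ∀ u ∈ J,
      deriv (ξ t) x * (K u - K u₁) + α * (u - u₁) * deriv K u = 0 := by
    intro t ht x hx u hu
    linear_combination h3 t ht x hx u hu - h3 t ht x hx u₁ hu₁
  obtain ⟨u₂, hu₂, hK₂⟩ : ∃ u ∈ J, K u ≠ K u₁ := by
    by_contra hneg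
    push Not at hneg
    exact hKc _ hneg
  set c := -(α * (u₂ - u₁) * deriv K u₂) / (K u₂ - K u₁) with hc
  have hξx : ∀ t ∈ T, ∀ x ∈ I, deriv (ξ t) x = c := by
    intro t ht x hx
    rw [hc, eq_div_iff (sub_ne_zero.2 hK₂)]
    linarith [h3' t ht x hx u₂ hu₂]
  have hξxx : ∀ t ∈ T, ∀ x ∈ I, deriv (deriv (ξ t)) x = 0 := fun t ht =>
    hI.eq_zero_of_hasDerivAt (fun x hx => h.smooth_ξ.hasDerivAt_deriv_x hI ht hx) (hξx t ht)
  have hξ : ∀ t ∈ T, ∀ x ∈ I, ξ t x = ξ t x₀ + c * (x - x₀) := by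
    intro t ht x hx
    have e := hI.eq_of_hasDerivAt_zero (g := fun x => ξ t x - c * (x - x₀)) (fun y hy => by
      refine ((h.smooth_ξ.hasDerivAt_x hI ht hy).sub
        (((hasDerivAt_id' y).sub_const x₀).const_mul c)).congr_deriv ?_
      rw [hξx t ht y hy]
      ring) hx hx₀
    simp only [sub_self, mul_zero, sub_zero] at e
    linarith
  have hξt : ∀ t ∈ T, ∀ x ∈ I, deriv (fun s => ξ s x) t = deriv (fun s => ξ s x₀) t := by
    intro t ht x hx
    have e1 := (h.smooth_ξ.hasDerivAt_t hT ht hx₀).add_const (c * (x - x₀))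
    exact (e1.congr_of_eventuallyEq
      (Filter.eventually_of_mem (hT.mem_nhds ht) fun s hs => hξ s hs x hx)).deriv
  have hfξ : ∀ t ∈ T, ∀ x ∈ I, f x * deriv (fun s => ξ s x₀) t = -(K u₁ * c) := by
    intro t ht x hx
    have e := h3 t ht x hx u₁ hu₁
    rw [hξxx t ht x hx, hξx t ht x hx, hξt t ht x hx] at e
    linarith
  by_cases hg : K u₁ * c = 0
  · have hξt0 : ∀ t ∈ T, deriv (fun s => ξ s x₀) t = 0 := fun t ht => by
      have e := hfξ t ht x₀ hx₀
      rw [hg, neg_zero] at e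
      exact (mul_eq_zero.1 e).resolve_left (hadm.f_ne_zero x₀ hx₀)
    have hξ0 : ∀ t ∈ T, ξ t x₀ = 0 := by
      intro t ht
      rw [← hl2]
      exact hT.eq_of_hasDerivAt_zero (g := fun s => ξ s x₀) (fun s hs => by
        have e := h.smooth_ξ.hasDerivAt_t hT hs hx₀
        rwa [hξt0 s hs] at e) ht ht₀
    have h0 : ∀ t ∈ T, ∀ x ∈ I,
        c * (x - x₀) * deriv f x - f x * deriv τ t + 2 * f x * c = 0 := by
      intro t ht x hx
      have e := (h.of_const hadm hd ht hx).1
      rwa [hξ t ht x hx, hξ0 t ht, hξx t ht x hx, zero_add] at e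
    have hτ' : ∀ t ∈ T, deriv τ t = 2 * c := by
      intro t ht
      refine mul_left_cancel₀ (hadm.f_ne_zero x₀ hx₀) ?_
      linear_combination -h0 t ht x₀ hx₀
    by_cases hc0 : c = 0
    · have hα0 : α = 0 := by
        by_contra hα0
        refine hKu₁ (eq_zero_of_affine_mul_eq_zero hJ.1
          (hadm.smooth_K.contDiffOn_deriv hJ.1).continuousOn (a := α) (b := -α * u₁)
          (Or.inl hα0) (fun u hu => ?_) u₁ hu₁)
        have e := h3' t₀ ht₀ x₀ hx₀ u hu
        rw [hξx t₀ ht₀ x₀ hx₀, hc0] at e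
        linarith
      refine hQ0 (h.eq_zero h𝔤 hQ (fun t ht => ?_) (fun t ht x hx => ?_) fun t ht x hx u _ => ?_)
      · rw [← hl1]
        exact hT.eq_of_hasDerivAt_zero (fun s hs => by
          have e := h.smooth_τ.hasDerivAt_of_isOpen hT.1 hs
          rwa [hτ' s hs, hc0, mul_zero] at e) ht ht₀
      · rw [hξ t ht x hx, hξ0 t ht, hc0]
        ring
      · rw [hη t ht x hx, hα0, zero_mul]
    · refine hcon (eq_zero_of_affine_mul_eq_zero hI.1
        (hadm.smooth_f.contDiffOn_deriv hI.1).continuousOn (a := c) (b := -c * x₀)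
        (Or.inl hc0) fun x hx => ?_)
      have e := h0 t₀ ht₀ x hx
      rw [hτ' t₀ ht₀] at e
      linarith
  · refine hcon (hI.eq_zero_of_hasDerivAt (c := -(K u₁ * c) / deriv (fun s => ξ s x₀) t₀)
      (fun x hx => (hadm.differentiableAt_f hx).hasDerivAt) fun x hx => ?_)
    have e := hfξ t₀ ht₀ x hx
    have hne : deriv (fun s => ξ s x₀) t₀ ≠ 0 := by
      intro h0
      rw [h0, mul_zero] at e
      exact hg (neg_eq_zero.1 e.symm)
    rw [eq_div_iff hne, e]

end

section

variable {T I J : Set ℝ} {f D K : ℝ → ℝ} {𝔤 : Submodule ℝ (PointSpace → PointSpace)}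

theorem SmoothOn₂.eq_of_deriv_zero {g : ℝ → ℝ → ℝ} (h : SmoothOn₂ T I g)
    (hT : IsOpenInterval T) (hI : IsOpenInterval I)
    (hx : ∀ t ∈ T, ∀ x ∈ I, deriv (g t) x = 0)
    (ht : ∀ t ∈ T, ∀ x ∈ I, deriv (fun s => g s x) t = 0) {t x t' x' : ℝ}
    (h1 : t ∈ T) (h2 : x ∈ I) (h3 : t' ∈ T) (h4 : x' ∈ I) : g t x = g t' x' := by
  have e1 : g t x = g t x' := hI.eq_of_hasDerivAt_zero (fun y hy => by
    have e := h.hasDerivAt_x hI h1 hy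
    rwa [hx t h1 y hy] at e) h2 h4
  have e2 : g t x' = g t' x' := hT.eq_of_hasDerivAt_zero (g := fun s => g s x') (fun s hs => by
    have e := h.hasDerivAt_t hT hs h4
    rwa [ht s hs x' h4] at e) h1 h3
  rw [e1, e2]

/-! ### Nonconstant diffusivity -/

/-- The vector field `τ(t) ∂_t + ξ(t, x) ∂_x + A(t, x) φ(u) ∂_u` is given by smooth coefficients
satisfying the determining equations, in the case `φ' = μ` and `A (φ D' - D) = 0`. -/
structure ScaledCoefficients (T I J : Set ℝ) (f D K φ : ℝ → ℝ) (μ : ℝ)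
    (Q : PointSpace → PointSpace) (τ : ℝ → ℝ) (ξ A : ℝ → ℝ → ℝ) : Prop where
  eq : ∀ t ∈ T, ∀ x ∈ I, ∀ u ∈ J, Q (t, x, u) = (τ t, ξ t x, A t x * φ u)
  smooth_τ : ContDiffOn ℝ ∞ τ T
  smooth_ξ : SmoothOn₂ T I ξ
  smooth_A : SmoothOn₂ T I A
  A_mul : ∀ t ∈ T, ∀ x ∈ I, ∀ u ∈ J, A t x * (φ u * deriv D u) = A t x * D u
  eq_uxx : ∀ t ∈ T, ∀ x ∈ I,
    ξ t x * deriv f x - f x * deriv τ t + 2 * f x * deriv (ξ t) x = A t x * f x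
  eq_ux : ∀ t ∈ T, ∀ x ∈ I, ∀ u ∈ J,
    (A t x - deriv (ξ t) x) * K u - A t x * φ u * deriv K u - f x * deriv (fun s => ξ s x) t
      = D u * (2 * (μ + 1) * deriv (A t) x - deriv (deriv (ξ t)) x)
  eq_one : ∀ t ∈ T, ∀ x ∈ I, ∀ u ∈ J,
    f x * deriv (fun s => A s x) t = D u * deriv (deriv (A t)) x + K u * deriv (A t) x

theorem SymmetryCoefficients.scaled_of_eta_eq_zero {Q : PointSpace → PointSpace} {τ : ℝ → ℝ}
    {ξ a b : ℝ → ℝ → ℝ} (h : SymmetryCoefficients T I J f D K Q τ ξ a b)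
    (hadm : IsAdmissible I J f D K)
    (hη : ∀ p ∈ box T I J, (Q p).2.2 = 0) (μ : ℝ) :
    ScaledCoefficients T I J f D K (fun _ => 1) μ Q τ ξ (fun _ _ => 0) := by
  have hI := hadm.interval_x
  have h0 : ∀ t ∈ T, ∀ x ∈ I, b t x = 0 ∧ a t x = 0 := by
    intro t ht x hx
    obtain ⟨e0, e1, -, -⟩ := cubic_eq_zero hadm.interval_u.infinite (a := b t x) (b := a t x)
      (c := 0) (d := 0) (fun u hu => by
        have e := hη (t, x, u) ⟨ht, hx, hu⟩
        rw [h.eq t ht x hx u hu] at e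
        simp only at e
        linear_combination e)
    exact ⟨e0, e1⟩
  have hax : ∀ t ∈ T, ∀ x ∈ I, deriv (a t) x = 0 := fun t ht =>
    hI.eq_zero_of_hasDerivAt (fun x hx => h.smooth_a.hasDerivAt_x hI ht hx)
      fun x hx => (h0 t ht x hx).2
  have hbx : ∀ t ∈ T, ∀ x ∈ I, deriv (b t) x = 0 := fun t ht =>
    hI.eq_zero_of_hasDerivAt (fun x hx => h.smooth_b.hasDerivAt_x hI ht hx)
      fun x hx => (h0 t ht x hx).1
  have huxx : ∀ t ∈ T, ∀ x ∈ I,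
      ξ t x * deriv f x - f x * deriv τ t + 2 * f x * deriv (ξ t) x = 0 := by
    intro t ht x hx
    obtain ⟨u, hu⟩ := hadm.interval_u.2.2
    have e := h.eq_uxx t ht x hx u hu
    rw [(h0 t ht x hx).1, (h0 t ht x hx).2] at e
    refine mul_left_cancel₀ (hadm.D_ne_zero u hu) ?_
    linear_combination e
  refine ⟨fun t ht x hx u hu => ?_, h.smooth_τ, h.smooth_ξ, contDiffOn_const, by simp,
    fun t ht x hx => ?_, fun t ht x hx u hu => ?_, by simp⟩
  · rw [h.eq t ht x hx u hu, (h0 t ht x hx).1, (h0 t ht x hx).2]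
    simp
  · rw [huxx t ht x hx, zero_mul]
  · have e := h.eq_ux t ht x hx u hu
    rw [(h0 t ht x hx).1, (h0 t ht x hx).2, hax t ht x hx, hbx t ht x hx] at e
    refine mul_left_cancel₀ (hadm.f_ne_zero x hx) ?_
    simp only [deriv_const]
    linear_combination e - K u * huxx t ht x hx

theorem SymmetryCoefficients.scaled_of_affine {Q : PointSpace → PointSpace} {τ : ℝ → ℝ}
    {ξ a b : ℝ → ℝ → ℝ} (h : SymmetryCoefficients T I J f D K Q τ ξ a b)
    (hT : IsOpenInterval T) (hadm : IsAdmissible I J f D K) {μ ν : ℝ}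
    (hD : ∀ u ∈ J, (μ * u + ν) * deriv D u = D u) :
    ∃ A, ScaledCoefficients T I J f D K (fun u => μ * u + ν) μ Q τ ξ A := by
  have hI := hadm.interval_x
  have hJ := hadm.interval_u
  obtain ⟨u₀, hu₀⟩ := hJ.2.2
  have hφ : ∀ u ∈ J, μ * u + ν ≠ 0 ∧ deriv D u ≠ 0 := by
    intro u hu
    have e := hD u hu
    constructor <;> intro h0
    · rw [h0, zero_mul] at e
      exact hadm.D_ne_zero u hu e.symm
    · rw [h0, mul_zero] at e
      exact hadm.D_ne_zero u hu e.symm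
  set A : ℝ → ℝ → ℝ := fun t x => (a t x * u₀ + b t x) / (μ * u₀ + ν) with hA
  have sA : SmoothOn₂ T I A := ((h.smooth_a.mul contDiffOn_const).add h.smooth_b).div_const _
  have hη : ∀ t ∈ T, ∀ x ∈ I, ∀ u ∈ J, f x * (a t x * u + b t x)
      = (ξ t x * deriv f x - f x * deriv τ t + 2 * f x * deriv (ξ t) x) * (μ * u + ν) := by
    intro t ht x hx u hu
    have e := h.eq_uxx t ht x hx u hu
    refine mul_right_cancel₀ (hφ u hu).2 ?_
    linear_combination -e - (ξ t x * deriv f x - f x * deriv τ t + 2 * f x * deriv (ξ t) x)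
      * hD u hu
  have huxx : ∀ t ∈ T, ∀ x ∈ I,
      ξ t x * deriv f x - f x * deriv τ t + 2 * f x * deriv (ξ t) x = A t x * f x := by
    intro t ht x hx
    have h1 := (hφ u₀ hu₀).1
    have e := hη t ht x hx u₀ hu₀
    simp only [hA]
    rw [div_mul_eq_mul_div, eq_div_iff h1]
    linear_combination -e
  have hη' : ∀ t ∈ T, ∀ x ∈ I, ∀ u ∈ J, a t x * u + b t x = A t x * (μ * u + ν) := by
    intro t ht x hx u hu
    have e := hη t ht x hx u hu
    rw [huxx t ht x hx] at e
    refine mul_left_cancel₀ (hadm.f_ne_zero x hx) ?_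
    linear_combination e
  have hab : ∀ t ∈ T, ∀ x ∈ I, b t x = ν * A t x ∧ a t x = μ * A t x := by
    intro t ht x hx
    obtain ⟨e0, e1, -, -⟩ := cubic_eq_zero hJ.infinite (a := b t x - ν * A t x)
      (b := a t x - μ * A t x) (c := 0) (d := 0) (fun u hu => by
        linear_combination hη' t ht x hx u hu)
    exact ⟨by linarith, by linarith⟩
  have hax : ∀ t ∈ T, ∀ x ∈ I, deriv (a t) x = μ * deriv (A t) x := fun t ht x hx =>
    (((sA.hasDerivAt_x hI ht hx).const_mul μ).congr_of_eventuallyEq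
      (Filter.eventually_of_mem (hI.mem_nhds hx) fun y hy => (hab t ht y hy).2)).deriv
  have hbx : ∀ t ∈ T, ∀ x ∈ I, deriv (b t) x = ν * deriv (A t) x := fun t ht x hx =>
    (((sA.hasDerivAt_x hI ht hx).const_mul ν).congr_of_eventuallyEq
      (Filter.eventually_of_mem (hI.mem_nhds hx) fun y hy => (hab t ht y hy).1)).deriv
  have haxx : ∀ t ∈ T, ∀ x ∈ I, deriv (deriv (a t)) x = μ * deriv (deriv (A t)) x :=
    fun t ht x hx => (((sA.hasDerivAt_deriv_x hI ht hx).const_mul μ).congr_of_eventuallyEq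
      (Filter.eventually_of_mem (hI.mem_nhds hx) fun y hy => hax t ht y hy)).deriv
  have hbxx : ∀ t ∈ T, ∀ x ∈ I, deriv (deriv (b t)) x = ν * deriv (deriv (A t)) x :=
    fun t ht x hx => (((sA.hasDerivAt_deriv_x hI ht hx).const_mul ν).congr_of_eventuallyEq
      (Filter.eventually_of_mem (hI.mem_nhds hx) fun y hy => hbx t ht y hy)).deriv
  have hat : ∀ t ∈ T, ∀ x ∈ I, deriv (fun s => a s x) t = μ * deriv (fun s => A s x) t :=
    fun t ht x hx => (((sA.hasDerivAt_t hT ht hx).const_mul μ).congr_of_eventuallyEq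
      (Filter.eventually_of_mem (hT.mem_nhds ht) fun s hs => (hab s hs x hx).2)).deriv
  have hbt : ∀ t ∈ T, ∀ x ∈ I, deriv (fun s => b s x) t = ν * deriv (fun s => A s x) t :=
    fun t ht x hx => (((sA.hasDerivAt_t hT ht hx).const_mul ν).congr_of_eventuallyEq
      (Filter.eventually_of_mem (hT.mem_nhds ht) fun s hs => (hab s hs x hx).1)).deriv
  refine ⟨A, fun t ht x hx u hu => ?_, h.smooth_τ, h.smooth_ξ, sA, fun t ht x hx u hu => ?_,
    huxx, fun t ht x hx u hu => ?_, fun t ht x hx u hu => ?_⟩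
  · rw [h.eq t ht x hx u hu, hη' t ht x hx u hu]
  · rw [hD u hu]
  · have e := h.eq_ux t ht x hx u hu
    rw [hη' t ht x hx u hu, hax t ht x hx, hbx t ht x hx] at e
    refine mul_left_cancel₀ (hadm.f_ne_zero x hx) ?_
    linear_combination e - K u * huxx t ht x hx + 2 * f x * deriv (A t) x * hD u hu
  · have e := h.eq_one t ht x hx u hu
    rw [hax t ht x hx, hbx t ht x hx, haxx t ht x hx, hbxx t ht x hx, hat t ht x hx,
      hbt t ht x hx] at e
    refine mul_left_cancel₀ (hφ u hu).1 ?_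
    linear_combination e

/-- A symmetry with `η ≠ 0` determines a nonconstant `D`. -/
theorem SymmetryCoefficients.exists_affine {Q : PointSpace → PointSpace} {τ : ℝ → ℝ}
    {ξ a b : ℝ → ℝ → ℝ} (h : SymmetryCoefficients T I J f D K Q τ ξ a b)
    (hadm : IsAdmissible I J f D K) (hD' : ∃ u ∈ J, deriv D u ≠ 0) {p : PointSpace}
    (hp : p ∈ box T I J) (hη : (Q p).2.2 ≠ 0) :
    ∃ μ ν : ℝ, ∀ u ∈ J, (μ * u + ν) * deriv D u = D u := by
  obtain ⟨t, x, v⟩ := p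
  obtain ⟨ht, hx, hv⟩ := hp
  rw [h.eq t ht x hx v hv] at hη
  set B := ξ t x * deriv f x - f x * deriv τ t + 2 * f x * deriv (ξ t) x with hB
  have e : ∀ u ∈ J, D u * B = f x * ((a t x * u + b t x) * deriv D u) := h.eq_uxx t ht x hx
  have hf := hadm.f_ne_zero x hx
  have hB0 : B ≠ 0 := by
    intro h0
    obtain ⟨u, hu, hu'⟩ := hD'
    refine hu' (eq_zero_of_affine_mul_eq_zero hadm.interval_u.1
      (hadm.smooth_D.contDiffOn_deriv hadm.interval_u.1).continuousOn (a := a t x) (b := b t x)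
      ?_ (fun u hu => ?_) u hu)
    · by_contra hab
      push Not at hab
      simp only [hab.1, hab.2] at hη
      simp at hη
    · have e1 := e u hu
      rw [h0, mul_zero] at e1
      exact (mul_eq_zero.1 e1.symm).resolve_left hf
  refine ⟨f x * a t x / B, f x * b t x / B, fun u hu => ?_⟩
  field_simp
  linear_combination -e u hu

theorem ScaledCoefficients.eq_zero {φ : ℝ → ℝ} {μ : ℝ} {Q : PointSpace → PointSpace} {τ : ℝ → ℝ}
    {ξ A : ℝ → ℝ → ℝ} (h : ScaledCoefficients T I J f D K φ μ Q τ ξ A)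
    (h𝔤 : IsInvarianceAlgebra f D K (box T I J) 𝔤) (hT : IsOpenInterval T)
    (hadm : IsAdmissible I J f D K) (hQ : Q ∈ 𝔤) {t₀ : ℝ} (ht₀ : t₀ ∈ T) (hτ : τ t₀ = 0)
    (hξ : ∀ t ∈ T, ∀ x ∈ I, ξ t x = 0) (hA : ∀ t ∈ T, ∀ x ∈ I, A t x = 0) : Q = 0 := by
  obtain ⟨x₀, hx₀⟩ := hadm.interval_x.2.2
  have hτ' : ∀ t ∈ T, τ t = 0 := by
    intro t ht
    rw [← hτ]
    refine hT.eq_of_hasDerivAt_zero (fun s hs => ?_) ht ht₀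
    have e := h.eq_uxx s hs x₀ hx₀
    have e1 := hadm.interval_x.eq_zero_of_hasDerivAt
      (fun x hx => h.smooth_ξ.hasDerivAt_x hadm.interval_x hs hx) (hξ s hs) x₀ hx₀
    rw [hξ s hs x₀ hx₀, hA s hs x₀ hx₀, e1] at e
    have e2 : f x₀ * deriv τ s = 0 := by linarith
    have e3 := h.smooth_τ.hasDerivAt_of_isOpen hT.1 hs
    rwa [(mul_eq_zero.1 e2).resolve_left (hadm.f_ne_zero x₀ hx₀)] at e3
  funext p
  by_cases hp : p ∈ box T I J
  · obtain ⟨t, x, u⟩ := p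
    obtain ⟨ht, hx, hu⟩ := hp
    rw [h.eq t ht x hx u hu, hτ' t ht, hξ t ht x hx, hA t ht x hx, zero_mul]
    rfl
  · exact h𝔤.zero_outside Q hQ p hp

/-- The coefficients of the symmetries are of the form `ScaledCoefficients`. -/
def HasScaledCoefficients (T I J : Set ℝ) (f D K φ : ℝ → ℝ) (μ : ℝ)
    (𝔤 : Submodule ℝ (PointSpace → PointSpace)) : Prop :=
  (∀ u ∈ J, φ u ≠ 0) ∧ ∀ Q ∈ 𝔤, ∃ τ ξ A, ScaledCoefficients T I J f D K φ μ Q τ ξ A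

theorem HasScaledCoefficients.exists_vanishing {φ : ℝ → ℝ} {μ : ℝ}
    (h : HasScaledCoefficients T I J f D K φ μ 𝔤) (hJ : IsOpenInterval J)
    (hdim : 4 ≤ Module.rank ℝ 𝔤) {t₀ x₀ : ℝ} (ht₀ : t₀ ∈ T) (hx₀ : x₀ ∈ I) :
    ∃ Q ∈ 𝔤, Q ≠ 0 ∧ ∃ τ ξ A, ScaledCoefficients T I J f D K φ μ Q τ ξ A ∧
      τ t₀ = 0 ∧ ξ t₀ x₀ = 0 ∧ A t₀ x₀ = 0 := by
  obtain ⟨u₀, hu₀⟩ := hJ.2.2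
  obtain ⟨Q, hQ, hQ0, hl1, hl2, hl3⟩ := exists_ne_zero_vanishing hdim (evalT (t₀, x₀, u₀))
    (evalX (t₀, x₀, u₀)) (evalU (t₀, x₀, u₀))
  obtain ⟨τ, ξ, A, hs⟩ := h.2 Q hQ
  simp only [evalT, evalX, evalU, LinearMap.comp_apply, LinearMap.proj_apply, LinearMap.fst_apply,
    LinearMap.snd_apply, hs.eq t₀ ht₀ x₀ hx₀ u₀ hu₀] at hl1 hl2 hl3
  exact ⟨Q, hQ, hQ0, τ, ξ, A, hs, hl1, hl2, (mul_eq_zero.1 hl3).resolve_right (h.1 u₀ hu₀)⟩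

theorem exists_scaledCoefficients (h𝔤 : IsInvarianceAlgebra f D K (box T I J) 𝔤)
    (hT : IsOpenInterval T) (hadm : IsAdmissible I J f D K) (hD' : ∃ u ∈ J, deriv D u ≠ 0) :
    (∃ μ ν, (∀ u ∈ J, (μ * u + ν) * deriv D u = D u) ∧
      HasScaledCoefficients T I J f D K (fun u => μ * u + ν) μ 𝔤) ∨
    ((∀ Q ∈ 𝔤, ∀ p ∈ box T I J, (Q p).2.2 = 0) ∧
      HasScaledCoefficients T I J f D K (fun _ => 1) 0 𝔤) := by
  by_cases hη : ∀ Q ∈ 𝔤, ∀ p ∈ box T I J, (Q p).2.2 = 0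
  · refine Or.inr ⟨hη, fun _ _ => one_ne_zero, fun Q hQ => ?_⟩
    obtain ⟨τ, ξ, a, b, h⟩ := h𝔤.exists_coefficients hT hadm hQ
    exact ⟨τ, ξ, _, h.scaled_of_eta_eq_zero hadm (hη Q hQ) 0⟩
  · push Not at hη
    obtain ⟨Q, hQ, p, hp, hne⟩ := hη
    obtain ⟨τ, ξ, a, b, h⟩ := h𝔤.exists_coefficients hT hadm hQ
    obtain ⟨μ, ν, hD⟩ := h.exists_affine hadm hD' hp hne
    refine Or.inl ⟨μ, ν, hD, fun u hu (h0 : μ * u + ν = 0) => ?_, fun R hR => ?_⟩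
    · have e := hD u hu
      rw [h0, zero_mul] at e
      exact hadm.D_ne_zero u hu e.symm
    · obtain ⟨τ, ξ, a, b, h⟩ := h𝔤.exists_coefficients hT hadm hR
      obtain ⟨A, hA⟩ := h.scaled_of_affine hT hadm hD
      exact ⟨τ, ξ, A, hA⟩

theorem IsAdmissible.D_not_const (hadm : IsAdmissible I J f D K) (hD' : ∃ u ∈ J, deriv D u ≠ 0) :
    ∃ u ∈ J, ∃ v ∈ J, D u ≠ D v := by
  by_contra hcon
  push Not at hcon
  obtain ⟨u, hu, hu'⟩ := hD'
  exact hu' (hadm.interval_u.eq_zero_of_hasDerivAt (c := D u)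
    (fun v hv => (hadm.differentiableAt_D hv).hasDerivAt) (fun v hv => hcon v hv u hu) u hu)

/-- If `K` is not a linear combination of `1` and `D`, the dimension is at most three. -/
theorem exists_linear_relation (h𝔤 : IsInvarianceAlgebra f D K (box T I J) 𝔤)
    (hT : IsOpenInterval T) (hadm : IsAdmissible I J f D K) (hdim : 4 ≤ Module.rank ℝ 𝔤)
    (hD' : ∃ u ∈ J, deriv D u ≠ 0) {φ : ℝ → ℝ} {μ : ℝ}
    (h : HasScaledCoefficients T I J f D K φ μ 𝔤) :
    ∃ k₁ k₀ : ℝ, ∀ u ∈ J, K u = k₁ * D u + k₀ := by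
  have hI := hadm.interval_x
  by_contra hcon
  push Not at hcon
  have hindep : ∀ a b c : ℝ, (∀ u ∈ J, a + b * D u + c * K u = 0) → a = 0 ∧ b = 0 ∧ c = 0 := by
    intro a b c habc
    have hc : c = 0 := by
      by_contra hc
      obtain ⟨u, hu, hne⟩ := hcon (-b / c) (-a / c)
      refine hne ?_
      field_simp
      linarith [habc u hu]
    obtain ⟨u, hu, v, hv, huv⟩ := hadm.D_not_const hD'
    have hb : b * (D u - D v) = 0 := by
      have e1 := habc u hu
      have e2 := habc v hv
      rw [hc] at e1 e2
      linarith
    have hb0 := (mul_eq_zero.1 hb).resolve_right (sub_ne_zero.2 huv)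
    have e1 := habc u hu
    rw [hc, hb0] at e1
    exact ⟨by linarith, hb0, hc⟩
  obtain ⟨t₀, ht₀⟩ := hT.2.2
  obtain ⟨x₀, hx₀⟩ := hI.2.2
  obtain ⟨Q, hQ, hQ0, τ, ξ, A, hs, hτ, hξ, hA⟩ :=
    h.exists_vanishing hadm.interval_u hdim ht₀ hx₀
  have hAd : ∀ t ∈ T, ∀ x ∈ I, deriv (fun s => A s x) t = 0 ∧ deriv (A t) x = 0 := by
    intro t ht x hx
    obtain ⟨e0, -, e2⟩ := hindep (-(f x * deriv (fun s => A s x) t)) (deriv (deriv (A t)) x)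
      (deriv (A t) x) (fun u hu => by linear_combination -hs.eq_one t ht x hx u hu)
    exact ⟨(mul_eq_zero.1 (neg_eq_zero.1 e0)).resolve_left (hadm.f_ne_zero x hx), e2⟩
  have hA0 : ∀ t ∈ T, ∀ x ∈ I, A t x = 0 := fun t ht x hx => by
    rw [← hA]
    exact hs.smooth_A.eq_of_deriv_zero hT hI (fun t ht x hx => (hAd t ht x hx).2)
      (fun t ht x hx => (hAd t ht x hx).1) ht hx ht₀ hx₀
  have hξd : ∀ t ∈ T, ∀ x ∈ I, deriv (fun s => ξ s x) t = 0 ∧ deriv (ξ t) x = 0 := by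
    intro t ht x hx
    obtain ⟨e0, -, e2⟩ := hindep (-(f x * deriv (fun s => ξ s x) t)) (deriv (deriv (ξ t)) x)
      (-deriv (ξ t) x) (fun u hu => by
        have e := hs.eq_ux t ht x hx u hu
        rw [hA0 t ht x hx, (hAd t ht x hx).2] at e
        linear_combination e)
    exact ⟨(mul_eq_zero.1 (neg_eq_zero.1 e0)).resolve_left (hadm.f_ne_zero x hx),
      neg_eq_zero.1 e2⟩
  refine hQ0 (hs.eq_zero h𝔤 hT hadm hQ ht₀ hτ (fun t ht x hx => ?_) hA0)
  rw [← hξ]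
  exact hs.smooth_ξ.eq_of_deriv_zero hT hI (fun t ht x hx => (hξd t ht x hx).2)
    (fun t ht x hx => (hξd t ht x hx).1) ht hx ht₀ hx₀

/-- The determining equations in the case `K = k₁ D + k₀`. -/
theorem ScaledCoefficients.of_linear_relation {φ : ℝ → ℝ} {μ k₁ k₀ : ℝ}
    {Q : PointSpace → PointSpace} {τ : ℝ → ℝ}
    {ξ A : ℝ → ℝ → ℝ} (h : ScaledCoefficients T I J f D K φ μ Q τ ξ A)
    (hadm : IsAdmissible I J f D K) (hD' : ∃ u ∈ J, deriv D u ≠ 0)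
    (hK : ∀ u ∈ J, K u = k₁ * D u + k₀) {t x : ℝ} (ht : t ∈ T) (hx : x ∈ I) :
    deriv (deriv (A t)) x = -k₁ * deriv (A t) x ∧
      f x * deriv (fun s => A s x) t = k₀ * deriv (A t) x ∧
      deriv (deriv (ξ t)) x = k₁ * deriv (ξ t) x + 2 * (μ + 1) * deriv (A t) x ∧
      f x * deriv (fun s => ξ s x) t = k₀ * (A t x - deriv (ξ t) x) := by
  have hJ := hadm.interval_u
  have hindep : ∀ a b : ℝ, (∀ u ∈ J, a + b * D u = 0) → a = 0 ∧ b = 0 := by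
    intro a b hab
    obtain ⟨u, hu, v, hv, huv⟩ := hadm.D_not_const hD'
    have hb : b * (D u - D v) = 0 := by linarith [hab u hu, hab v hv]
    have hb0 := (mul_eq_zero.1 hb).resolve_right (sub_ne_zero.2 huv)
    have e1 := hab u hu
    rw [hb0] at e1
    exact ⟨by linarith, hb0⟩
  have hK' : ∀ u ∈ J, deriv K u = k₁ * deriv D u := fun u hu =>
    ((((hadm.differentiableAt_D hu).hasDerivAt.const_mul k₁).add_const k₀).congr_of_eventuallyEq
      (Filter.eventually_of_mem (hJ.mem_nhds hu) hK)).deriv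
  obtain ⟨e1, e2⟩ := hindep (k₀ * deriv (A t) x - f x * deriv (fun s => A s x) t)
    (deriv (deriv (A t)) x + k₁ * deriv (A t) x) (fun u hu => by
      have e := h.eq_one t ht x hx u hu
      rw [hK u hu] at e
      linear_combination -e)
  obtain ⟨e3, e4⟩ := hindep (k₀ * (A t x - deriv (ξ t) x) - f x * deriv (fun s => ξ s x) t)
    (deriv (deriv (ξ t)) x - k₁ * deriv (ξ t) x - 2 * (μ + 1) * deriv (A t) x) (fun u hu => by
      have e := h.eq_ux t ht x hx u hu
      rw [hK u hu, hK' u hu] at e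
      linear_combination e + k₁ * h.A_mul t ht x hx u hu)
  exact ⟨by linarith, by linarith, by linarith, by linarith⟩

/-! ### The case `K = k₁ D` -/

theorem false_of_eta_eq_zero (h𝔤 : IsInvarianceAlgebra f D K (box T I J) 𝔤)
    (hT : IsOpenInterval T) (hadm : IsAdmissible I J f D K) (hdim : 4 ≤ Module.rank ℝ 𝔤)
    (hD' : ∃ u ∈ J, deriv D u ≠ 0) {k₁ : ℝ} (hK : ∀ u ∈ J, K u = k₁ * D u)
    (hη : ∀ Q ∈ 𝔤, ∀ p ∈ box T I J, (Q p).2.2 = 0) : False := by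
  have hI := hadm.interval_x
  obtain ⟨t₀, ht₀⟩ := hT.2.2
  obtain ⟨x₀, hx₀⟩ := hI.2.2
  obtain ⟨u₀, hu₀⟩ := hadm.interval_u.2.2
  obtain ⟨x₁, hx₁, hne⟩ := hI.exists_ne x₀
  obtain ⟨Q, hQ, hQ0, hl1, hl2, hl3⟩ := exists_ne_zero_vanishing hdim (evalT (t₀, x₀, u₀))
    (evalX (t₀, x₀, u₀)) (evalX (t₀, x₁, u₀))
  obtain ⟨τ, ξ, a, b, hc⟩ := h𝔤.exists_coefficients hT hadm hQ
  have hs := hc.scaled_of_eta_eq_zero hadm (hη Q hQ) 0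
  simp only [evalT, evalX, LinearMap.comp_apply, LinearMap.proj_apply, LinearMap.fst_apply,
    LinearMap.snd_apply, hs.eq t₀ ht₀ x₀ hx₀ u₀ hu₀, hs.eq t₀ ht₀ x₁ hx₁ u₀ hu₀] at hl1 hl2 hl3
  have hlin := fun (t : ℝ) (ht : t ∈ T) (x : ℝ) (hx : x ∈ I) =>
    hs.of_linear_relation hadm hD' (k₀ := 0) (fun u hu => by rw [hK u hu, add_zero]) ht hx
  have hx : ∀ x ∈ I, ξ t₀ x = 0 := by
    have e := fun (x : ℝ) (hx : x ∈ I) => (hI.eq_of_deriv_deriv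
      (fun y hy => hs.smooth_ξ.hasDerivAt_x hI ht₀ hy) (fun y hy => by
        have e1 := hs.smooth_ξ.hasDerivAt_deriv_x hI ht₀ hy
        have e2 := (hlin t₀ ht₀ y hy).2.2.1
        simp only [deriv_const, mul_zero, add_zero] at e2
        rwa [e2] at e1) hx₀ hx).2
    have e1 := e x₁ hx₁
    rw [hl2, hl3, zero_add] at e1
    have e2 : deriv (ξ t₀) x₀ = 0 := (mul_eq_zero.1 e1.symm).resolve_right
      (fun h => sub_ne_zero.2 hne (expInt_eq_zero_iff.1 h))
    intro x hx
    rw [e x hx, hl2, e2]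
    ring
  refine hQ0 (hs.eq_zero h𝔤 hT hadm hQ ht₀ hl1 (fun t ht x hx' => ?_) fun _ _ _ _ => rfl)
  rw [← hx x hx']
  refine hT.eq_of_hasDerivAt_zero (g := fun s => ξ s x) (fun s hs' => ?_) ht ht₀
  have e := hs.smooth_ξ.hasDerivAt_t hT hs' hx'
  have e1 := (hlin s hs' x hx').2.2.2
  rw [zero_mul] at e1
  rwa [(mul_eq_zero.1 e1).resolve_left (hadm.f_ne_zero x hx')] at e

theorem isReducible_of_homogeneous (h𝔤 : IsInvarianceAlgebra f D K (box T I J) 𝔤)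
    (hT : IsOpenInterval T) (hadm : IsAdmissible I J f D K) (hdim : 4 ≤ Module.rank ℝ 𝔤)
    (hD' : ∃ u ∈ J, deriv D u ≠ 0) {k₁ μ ν : ℝ} (hK : ∀ u ∈ J, K u = k₁ * D u)
    (hD : ∀ u ∈ J, (μ * u + ν) * deriv D u = D u)
    (h : HasScaledCoefficients T I J f D K (fun u => μ * u + ν) μ 𝔤) :
    IsReducible T I J f D K := by
  have hI := hadm.interval_x
  obtain ⟨t₀, ht₀⟩ := hT.2.2
  obtain ⟨x₀, hx₀⟩ := hI.2.2
  obtain ⟨Q, hQ, hQ0, τ, ξ, A, hs, hτ, hξ, hA⟩ :=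
    h.exists_vanishing hadm.interval_u hdim ht₀ hx₀
  have hlin := fun (t : ℝ) (ht : t ∈ T) (x : ℝ) (hx : x ∈ I) =>
    hs.of_linear_relation hadm hD' (k₀ := 0) (fun u hu => by rw [hK u hu, add_zero]) ht hx
  have hAt : ∀ t ∈ T, ∀ x ∈ I, A t x = A t₀ x := by
    intro t ht x hx
    refine hT.eq_of_hasDerivAt_zero (g := fun s => A s x) (fun s hs' => ?_) ht ht₀
    have e := hs.smooth_A.hasDerivAt_t hT hs' hx
    have e1 := (hlin s hs' x hx).2.1
    rw [zero_mul] at e1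
    rwa [(mul_eq_zero.1 e1).resolve_left (hadm.f_ne_zero x hx)] at e
  have hξt : ∀ t ∈ T, ∀ x ∈ I, ξ t x = ξ t₀ x := by
    intro t ht x hx
    refine hT.eq_of_hasDerivAt_zero (g := fun s => ξ s x) (fun s hs' => ?_) ht ht₀
    have e := hs.smooth_ξ.hasDerivAt_t hT hs' hx
    have e1 := (hlin s hs' x hx).2.2.2
    rw [zero_mul] at e1
    rwa [(mul_eq_zero.1 e1).resolve_left (hadm.f_ne_zero x hx)] at e
  set X : ℝ → ℝ := fun x => expInt (-k₁) (x - x₀) with hX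
  set Z : ℝ → ℝ := fun x => Real.exp (-k₁ * (x - x₀)) with hZ
  have hX' : ∀ x, HasDerivAt X (Z x) x := fun x => hasDerivAt_expInt_sub _ _ _
  have hZ' : ∀ x, HasDerivAt Z (-k₁ * Z x) x := fun x => by
    refine (((hasDerivAt_id' x).sub_const x₀).const_mul (-k₁)).exp.congr_deriv ?_
    simp only [hZ]
    ring
  have hZ0 : ∀ x, Z x ≠ 0 := fun x => Real.exp_ne_zero _
  have hX0 : X x₀ = 0 := by simp [hX]
  have hZ1 : Z x₀ = 1 := by simp [hZ]
  have hXinj : ∀ x y, X x = X y → x = y := fun x y e => by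
    have := (strictMono_expInt (-k₁)).injective e
    linarith
  set a₁ := deriv (A t₀) x₀ with ha₁
  set b := deriv (ξ t₀) x₀ with hb
  have hAX : ∀ x ∈ I, A t₀ x = a₁ * X x := by
    intro x hx
    have e := (hI.eq_of_deriv_deriv (fun y hy => hs.smooth_A.hasDerivAt_x hI ht₀ hy)
      (fun y hy => by
        have e1 := hs.smooth_A.hasDerivAt_deriv_x hI ht₀ hy
        rwa [(hlin t₀ ht₀ y hy).1] at e1) hx₀ hx).2
    rw [e, hA, zero_add]
  have hξ1 : ∀ x ∈ I, deriv (ξ t₀) x = k₁ * ξ t₀ x + 2 * (μ + 1) * a₁ * X x + b := by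
    intro x hx
    have e := hI.eq_of_hasDerivAt_zero
      (g := fun x => deriv (ξ t₀) x - k₁ * ξ t₀ x - 2 * (μ + 1) * A t₀ x) (fun y hy => by
        refine (((hs.smooth_ξ.hasDerivAt_deriv_x hI ht₀ hy).sub
          ((hs.smooth_ξ.hasDerivAt_x hI ht₀ hy).const_mul k₁)).sub
          ((hs.smooth_A.hasDerivAt_x hI ht₀ hy).const_mul (2 * (μ + 1)))).congr_deriv ?_
        rw [(hlin t₀ ht₀ y hy).2.2.1]
        ring) hx hx₀
    simp only [hξ, hA, hAX x hx] at e
    linarith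
  have hξX : ∀ x ∈ I, ξ t₀ x * Z x = X x * ((μ + 1) * a₁ * X x + b) := by
    intro x hx
    have e := hI.eq_of_hasDerivAt_zero
      (g := fun x => ξ t₀ x * Z x - X x * ((μ + 1) * a₁ * X x + b)) (fun y hy => by
        refine (((hs.smooth_ξ.hasDerivAt_x hI ht₀ hy).mul (hZ' y)).sub
          ((hX' y).mul (((hX' y).const_mul ((μ + 1) * a₁)).add_const b))).congr_deriv ?_
        rw [hξ1 y hy]
        ring) hx hx₀
    simp only [hξ, hX0] at e
    linarith
  have hτ' : deriv τ t₀ = 2 * b := by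
    have e := hs.eq_uxx t₀ ht₀ x₀ hx₀
    rw [hξ, hA] at e
    refine mul_left_cancel₀ (hadm.f_ne_zero x₀ hx₀) ?_
    linear_combination -e
  have hne : a₁ ≠ 0 ∨ b ≠ 0 := by
    by_contra hcon
    push Not at hcon
    refine hQ0 (hs.eq_zero h𝔤 hT hadm hQ ht₀ hτ (fun t ht x hx => ?_) fun t ht x hx => ?_)
    · have e := hξX x hx
      rw [hcon.1, hcon.2] at e
      rw [hξt t ht x hx]
      refine (mul_eq_zero.1 (?_ : ξ t₀ x * Z x = 0)).resolve_right (hZ0 x)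
      linarith
    · rw [hAt t ht x hx, hAX x hx, hcon.1, zero_mul]
  have cf := hadm.smooth_f.continuousOn
  have cf' := (hadm.smooth_f.contDiffOn_deriv hI.1).continuousOn
  have cX : Continuous X := continuous_iff_continuousAt.2 fun x => (hX' x).continuousAt
  have cZ : Continuous Z := continuous_iff_continuousAt.2 fun x => (hZ' x).continuousAt
  have hg : ∀ x ∈ I, ((μ + 1) * a₁ * X x + b) * (deriv f x + 2 * k₁ * f x)
      + (4 * μ + 3) * a₁ * Z x * f x = 0 := by
    refine eq_zero_of_eq_zero_off_point hI.1 ?_ x₀ fun x hx hxx => ?_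
    · exact ((by fun_prop : ContinuousOn (fun x => (μ + 1) * a₁ * X x + b) I).mul
        (cf'.add (continuousOn_const.mul cf))).add
        ((by fun_prop : ContinuousOn (fun x => (4 * μ + 3) * a₁ * Z x) I).mul cf)
    · have hXx : X x ≠ 0 := fun h0 => hxx (hXinj x x₀ (by rw [h0, hX0]))
      refine mul_left_cancel₀ hXx ?_
      have e := hs.eq_uxx t₀ ht₀ x hx
      rw [hτ', hξ1 x hx, hAX x hx] at e
      linear_combination Z x * e - (deriv f x + 2 * k₁ * f x) * hξX x hx
  -- `f' = -2 k₁ f` suffices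
  have hzero : (∀ x ∈ I, deriv f x + 2 * k₁ * f x = 0) → IsReducible T I J f D K := fun h0 =>
    isReducible_of_linear (a := 0) hT hadm hD hK hx₀ (fun x _ => by simp) fun x hx => by
      rw [h0 x hx]
      ring
  have hzero' : ∀ c, (∀ x ∈ I, x ≠ c → deriv f x + 2 * k₁ * f x = 0) → IsReducible T I J f D K :=
    fun c hc => hzero (eq_zero_of_eq_zero_off_point hI.1 (cf'.add (continuousOn_const.mul cf)) c hc)
  by_cases hb0 : b = 0
  · have ha0 : a₁ ≠ 0 := by tauto
    have hμ : 4 * μ + 3 = 0 := by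
      have e := hg x₀ hx₀
      rw [hX0, hZ1, hb0] at e
      have e1 : (4 * μ + 3) * (a₁ * f x₀) = 0 := by linarith
      exact (mul_eq_zero.1 e1).resolve_right (mul_ne_zero ha0 (hadm.f_ne_zero x₀ hx₀))
    refine hzero' x₀ fun x hx hxx => ?_
    have hXx : X x ≠ 0 := fun h0 => hxx (hXinj x x₀ (by rw [h0, hX0]))
    have e := hg x hx
    rw [hμ, hb0] at e
    have hμ1 : μ + 1 ≠ 0 := by intro h0; linarith
    have e1 : ((μ + 1) * a₁ * X x) * (deriv f x + 2 * k₁ * f x) = 0 := by linarith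
    exact (mul_eq_zero.1 e1).resolve_left (mul_ne_zero (mul_ne_zero hμ1 ha0) hXx)
  · by_cases hl : ∀ x ∈ I, 1 + (μ + 1) * (a₁ / b) * X x ≠ 0
    · refine isReducible_of_linear (a := a₁ / b) hT hadm hD hK hx₀ (fun x hx => ?_)
        fun x hx => ?_
      · by_contra hneg
        obtain ⟨z, hz, hz0⟩ := hI.isPreconnected.intermediate_value hx hx₀
          (f := fun x => 1 + (μ + 1) * (a₁ / b) * X x) (by fun_prop)
          (⟨not_lt.1 hneg, by simp [hX0]⟩ : (0 : ℝ) ∈ Set.Icc _ _)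
        exact hl z hz hz0
      · have e := hg x hx
        change (1 + (μ + 1) * (a₁ / b) * X x) * (deriv f x + 2 * k₁ * f x)
          = -(4 * μ + 3) * (a₁ / b) * Z x * f x
        field_simp
        linear_combination e
    · push Not at hl
      obtain ⟨c, hc, hc0⟩ := hl
      have hlc : (μ + 1) * a₁ * X c + b = 0 := by
        field_simp at hc0
        linarith
      have hμa : (μ + 1) * a₁ ≠ 0 := by
        intro h0
        rw [h0] at hlc
        exact hb0 (by linarith)
      have hμ : 4 * μ + 3 = 0 := by
        have e := hg c hc
        rw [hlc] at e
        have e1 : (4 * μ + 3) * (a₁ * Z c * f c) = 0 := by linarith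
        exact (mul_eq_zero.1 e1).resolve_right
          (mul_ne_zero (mul_ne_zero (right_ne_zero_of_mul hμa) (hZ0 c)) (hadm.f_ne_zero c hc))
      refine hzero' c fun x hx hxc => ?_
      have e := hg x hx
      rw [hμ] at e
      have e1 : ((μ + 1) * a₁ * X x + b) * (deriv f x + 2 * k₁ * f x) = 0 := by linarith
      refine (mul_eq_zero.1 e1).resolve_left fun h0 => hxc (hXinj x c ?_)
      refine mul_left_cancel₀ hμa ?_
      linarith

end

section

variable {T I J : Set ℝ} {f D K : ℝ → ℝ} {𝔤 : Submodule ℝ (PointSpace → PointSpace)}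

/-! ### The case `K = k₁ D + k₀` with nonzero `k₀` and `k₁` -/

/-- A solution of `g_xx = m g_x` is a combination of two functions of `x` with coefficients
depending on `t`. -/
theorem exists_coefficients_of_deriv_deriv {m x₀ : ℝ}
    (hI : IsOpenInterval I) (hx₀ : x₀ ∈ I) {g gx : ℝ → ℝ → ℝ}
    (hgx : ∀ t ∈ T, ∀ x ∈ I, HasDerivAt (g t) (gx t x) x)
    (hgxx : ∀ t ∈ T, ∀ x ∈ I, HasDerivAt (gx t) (m * gx t x) x)
    (hgt : ∀ t ∈ T, ∀ x ∈ I, DifferentiableAt ℝ (fun s => g s x) t) :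
    ∃ c : ℝ → ℝ, (∀ t ∈ T, DifferentiableAt ℝ c t) ∧
      ∀ t ∈ T, ∀ x ∈ I, g t x = c t * expInt m (x - x₀) + g t x₀ := by
  obtain ⟨x₁, hx₁, hne⟩ := hI.exists_ne x₀
  have hW : expInt m (x₁ - x₀) ≠ 0 := fun h => sub_ne_zero.2 hne (expInt_eq_zero_iff.1 h)
  refine ⟨fun t => (g t x₁ - g t x₀) / expInt m (x₁ - x₀),
    fun t ht => ((hgt t ht x₁ hx₁).sub (hgt t ht x₀ hx₀)).div_const _, fun t ht x hx => ?_⟩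
  have e := fun (x : ℝ) (hx : x ∈ I) => (hI.eq_of_deriv_deriv (hgx t ht) (hgxx t ht) hx₀ hx).2
  have hq : (g t x₁ - g t x₀) / expInt m (x₁ - x₀) = gx t x₀ := by
    rw [div_eq_iff hW, e x₁ hx₁]
    ring
  simp only [hq]
  rw [e x hx]
  ring

theorem expInt_eq_of_ne_zero {m : ℝ} (hm : m ≠ 0) (s : ℝ) :
    expInt m s = (Real.exp (m * s) - 1) / m := by
  simp [expInt, hm]

/-- Coefficients of a vector field in the case `k₀ k₁ ≠ 0`, in terms of
`z = exp (-k₁ (x - x₀))`. -/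
structure ExpCoefficients (T I : Set ℝ) (f : ℝ → ℝ) (μ k₀ k₁ x₀ : ℝ) (τ : ℝ → ℝ)
    (ξ A : ℝ → ℝ → ℝ) (a₁ a₀ b₁ b₀ : ℝ → ℝ) : Prop where
  diff_a₁ : ∀ t ∈ T, DifferentiableAt ℝ a₁ t
  diff_a₀ : ∀ t ∈ T, DifferentiableAt ℝ a₀ t
  diff_b₁ : ∀ t ∈ T, DifferentiableAt ℝ b₁ t
  diff_b₀ : ∀ t ∈ T, DifferentiableAt ℝ b₀ t
  A_eq : ∀ t ∈ T, ∀ x ∈ I, A t x = a₁ t * Real.exp (-k₁ * (x - x₀)) + a₀ t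
  ξ_mul : ∀ t ∈ T, ∀ x ∈ I, k₁ * ξ t x * Real.exp (-k₁ * (x - x₀))
    = -(μ + 1) * a₁ t * Real.exp (-k₁ * (x - x₀)) ^ 2 + k₁ * b₁ t
      + k₁ * b₀ t * Real.exp (-k₁ * (x - x₀))
  eq_A : ∀ t ∈ T, ∀ x ∈ I, f x * (deriv a₁ t * Real.exp (-k₁ * (x - x₀)) + deriv a₀ t)
    = -k₀ * k₁ * a₁ t * Real.exp (-k₁ * (x - x₀))
  eq_ξ : ∀ t ∈ T, ∀ x ∈ I, f x * (-(μ + 1) * deriv a₁ t * Real.exp (-k₁ * (x - x₀)) ^ 2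
      + k₁ * deriv b₁ t + k₁ * deriv b₀ t * Real.exp (-k₁ * (x - x₀)))
    = k₀ * k₁ * (-μ * a₁ t * Real.exp (-k₁ * (x - x₀)) ^ 2
      + a₀ t * Real.exp (-k₁ * (x - x₀)) - k₁ * b₁ t)
  eq_f : ∀ t ∈ T, ∀ x ∈ I, (-(μ + 1) * a₁ t * Real.exp (-k₁ * (x - x₀)) ^ 2 + k₁ * b₁ t
      + k₁ * b₀ t * Real.exp (-k₁ * (x - x₀))) * deriv f x
    = k₁ * f x * ((-2 * μ - 1) * a₁ t * Real.exp (-k₁ * (x - x₀)) ^ 2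
      + (a₀ t + deriv τ t) * Real.exp (-k₁ * (x - x₀)) - 2 * k₁ * b₁ t)

theorem hasDerivAt_exp_mul_sub (m c x : ℝ) :
    HasDerivAt (fun x => Real.exp (m * (x - c))) (m * Real.exp (m * (x - c))) x := by
  refine (((hasDerivAt_id' x).sub_const c).const_mul m).exp.congr_deriv ?_
  ring

theorem ScaledCoefficients.exists_expCoefficients {φ : ℝ → ℝ} {μ k₁ k₀ x₀ : ℝ}
    {Q : PointSpace → PointSpace} {τ : ℝ → ℝ}
    {ξ A : ℝ → ℝ → ℝ} (h : ScaledCoefficients T I J f D K φ μ Q τ ξ A) (hT : IsOpenInterval T)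
    (hadm : IsAdmissible I J f D K) (hD' : ∃ u ∈ J, deriv D u ≠ 0)
    (hK : ∀ u ∈ J, K u = k₁ * D u + k₀) (hk₁ : k₁ ≠ 0) (hx₀ : x₀ ∈ I) :
    ∃ a₁ a₀ b₁ b₀, ExpCoefficients T I f μ k₀ k₁ x₀ τ ξ A a₁ a₀ b₁ b₀ := by
  have hI := hadm.interval_x
  have hlin := fun (t : ℝ) (ht : t ∈ T) (x : ℝ) (hx : x ∈ I) =>
    h.of_linear_relation hadm hD' hK ht hx
  have hk₁' : -k₁ ≠ 0 := neg_ne_zero.2 hk₁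
  set z : ℝ → ℝ := fun x => Real.exp (-k₁ * (x - x₀)) with hz
  have hz' : ∀ x, HasDerivAt z (-k₁ * z x) x := hasDerivAt_exp_mul_sub (-k₁) x₀
  have hz0 : ∀ x, z x ≠ 0 := fun x => Real.exp_ne_zero _
  have hAt := fun (t : ℝ) (ht : t ∈ T) (x : ℝ) (hx : x ∈ I) =>
    (h.smooth_A.hasDerivAt_t hT ht hx).differentiableAt
  have hξt := fun (t : ℝ) (ht : t ∈ T) (x : ℝ) (hx : x ∈ I) =>
    (h.smooth_ξ.hasDerivAt_t hT ht hx).differentiableAt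
  obtain ⟨c, hc, hcA⟩ := exists_coefficients_of_deriv_deriv (m := -k₁) hI hx₀
    (fun t ht x hx => h.smooth_A.hasDerivAt_x hI ht hx)
    (fun t ht x hx => by
      have e := h.smooth_A.hasDerivAt_deriv_x hI ht hx
      rwa [(hlin t ht x hx).1] at e) hAt
  set a₁ : ℝ → ℝ := fun t => -(c t) / k₁ with ha₁
  set a₀ : ℝ → ℝ := fun t => A t x₀ + c t / k₁ with ha₀
  have da₁ : ∀ t ∈ T, DifferentiableAt ℝ a₁ t := fun t ht => (hc t ht).neg.div_const _
  have da₀ : ∀ t ∈ T, DifferentiableAt ℝ a₀ t := fun t ht =>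
    (hAt t ht x₀ hx₀).add ((hc t ht).div_const _)
  have hA : ∀ t ∈ T, ∀ x ∈ I, A t x = a₁ t * z x + a₀ t := by
    intro t ht x hx
    rw [hcA t ht x hx, expInt_eq_of_ne_zero hk₁']
    simp only [ha₁, ha₀, hz]
    field_simp
    ring
  have hAx : ∀ t ∈ T, ∀ x ∈ I, deriv (A t) x = -k₁ * a₁ t * z x := by
    intro t ht x hx
    have e := (((hz' x).const_mul (a₁ t)).add_const (a₀ t)).congr_of_eventuallyEq
      (Filter.eventually_of_mem (hI.mem_nhds hx) (hA t ht))
    rw [e.deriv]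
    ring
  obtain ⟨c', hc', hcξ⟩ := exists_coefficients_of_deriv_deriv (m := k₁) hI hx₀
    (g := fun t x => ξ t x + (μ + 1) / k₁ * a₁ t * z x)
    (gx := fun t x => deriv (ξ t) x - (μ + 1) * a₁ t * z x)
    (fun t ht x hx => by
      refine ((h.smooth_ξ.hasDerivAt_x hI ht hx).add
        ((hz' x).const_mul ((μ + 1) / k₁ * a₁ t))).congr_deriv ?_
      field_simp
      ring)
    (fun t ht x hx => by
      refine ((h.smooth_ξ.hasDerivAt_deriv_x hI ht hx).sub
        ((hz' x).const_mul ((μ + 1) * a₁ t))).congr_deriv ?_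
      rw [(hlin t ht x hx).2.2.1, hAx t ht x hx]
      ring)
    (fun t ht x hx => (hξt t ht x hx).add (((da₁ t ht).const_mul _).mul_const _))
  set b₁ : ℝ → ℝ := fun t => c' t / k₁ with hb₁
  set b₀ : ℝ → ℝ := fun t => ξ t x₀ + (μ + 1) / k₁ * a₁ t - c' t / k₁ with hb₀
  have db₁ : ∀ t ∈ T, DifferentiableAt ℝ b₁ t := fun t ht => (hc' t ht).div_const _
  have db₀ : ∀ t ∈ T, DifferentiableAt ℝ b₀ t := fun t ht =>
    ((hξt t ht x₀ hx₀).add ((da₁ t ht).const_mul _)).sub ((hc' t ht).div_const _)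
  have hzinv : ∀ x, Real.exp (k₁ * (x - x₀)) * z x = 1 := fun x => by
    simp only [hz]
    rw [← Real.exp_add, neg_mul, add_neg_cancel, Real.exp_zero]
  have hz1 : z x₀ = 1 := by simp [hz]
  have hξ : ∀ t ∈ T, ∀ x ∈ I, k₁ * ξ t x * z x
      = -(μ + 1) * a₁ t * z x ^ 2 + k₁ * b₁ t + k₁ * b₀ t * z x := by
    intro t ht x hx
    have e := hcξ t ht x hx
    simp only [hz1, mul_one] at e
    rw [expInt_eq_of_ne_zero hk₁] at e
    have e1 : ξ t x = c' t * ((Real.exp (k₁ * (x - x₀)) - 1) / k₁)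
      + (ξ t x₀ + (μ + 1) / k₁ * a₁ t) - (μ + 1) / k₁ * a₁ t * z x := by linarith
    rw [e1]
    simp only [hb₁, hb₀]
    field_simp
    linear_combination c' t * hzinv x
  have hξx : ∀ t ∈ T, ∀ x ∈ I, deriv (ξ t) x * z x = (μ + 1) * a₁ t * z x ^ 2 + k₁ * b₁ t := by
    intro t ht x hx
    have e := ((h.smooth_ξ.hasDerivAt_x hI ht hx).const_mul k₁).mul (hz' x)
    have e1 := ((((hz' x).pow 2).const_mul (-(μ + 1) * a₁ t)).add_const (k₁ * b₁ t)).add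
      ((hz' x).const_mul (k₁ * b₀ t))
    have e2 := e.unique (e1.congr_of_eventuallyEq
      (Filter.eventually_of_mem (hI.mem_nhds hx) (hξ t ht)))
    refine mul_left_cancel₀ hk₁ ?_
    simp only [Nat.cast_ofNat] at e2
    linear_combination e2 + k₁ * hξ t ht x hx
  have hξt' : ∀ t ∈ T, ∀ x ∈ I, k₁ * deriv (fun s => ξ s x) t * z x
      = -(μ + 1) * deriv a₁ t * z x ^ 2 + k₁ * deriv b₁ t + k₁ * deriv b₀ t * z x := by
    intro t ht x hx
    have e := ((h.smooth_ξ.hasDerivAt_t hT ht hx).const_mul k₁).mul_const (z x)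
    have e1 := ((((da₁ t ht).hasDerivAt.const_mul (-(μ + 1))).mul_const (z x ^ 2)).add
      ((db₁ t ht).hasDerivAt.const_mul k₁)).add
      (((db₀ t ht).hasDerivAt.const_mul k₁).mul_const (z x))
    exact e.unique (e1.congr_of_eventuallyEq
      (Filter.eventually_of_mem (hT.mem_nhds ht) fun s hs => hξ s hs x hx))
  have hAt' : ∀ t ∈ T, ∀ x ∈ I, deriv (fun s => A s x) t = deriv a₁ t * z x + deriv a₀ t := by
    intro t ht x hx
    exact (((da₁ t ht).hasDerivAt.mul_const (z x)).add
      (da₀ t ht).hasDerivAt |>.congr_of_eventuallyEq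
      (Filter.eventually_of_mem (hT.mem_nhds ht) fun s hs => hA s hs x hx)).deriv
  refine ⟨a₁, a₀, b₁, b₀, da₁, da₀, db₁, db₀, hA, hξ, fun t ht x hx => ?_,
    fun t ht x hx => ?_, fun t ht x hx => ?_⟩
  · have e := (hlin t ht x hx).2.1
    rw [hAt' t ht x hx, hAx t ht x hx] at e
    linear_combination e
  · have e := (hlin t ht x hx).2.2.2
    linear_combination k₁ * z x * e - f x * hξt' t ht x hx - k₀ * k₁ * hξx t ht x hx
      + k₀ * k₁ * z x * hA t ht x hx
  · have e := h.eq_uxx t ht x hx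
    linear_combination k₁ * z x * e - deriv f x * hξ t ht x hx - 2 * k₁ * f x * hξx t ht x hx
      + k₁ * z x * f x * hA t ht x hx

theorem infinite_image_exp {I : Set ℝ} (hI : IsOpenInterval I) {m : ℝ} (hm : m ≠ 0) (c : ℝ) :
    ((fun x => Real.exp (m * (x - c))) '' I).Infinite :=
  hI.infinite.image fun x _ y _ h => by
    have := mul_left_cancel₀ hm (Real.exp_injective h)
    linarith

section

variable {μ k₀ k₁ x₀ : ℝ} {τ : ℝ → ℝ} {ξ A : ℝ → ℝ → ℝ} {a₁ a₀ b₁ b₀ : ℝ → ℝ}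

theorem ExpCoefficients.a₁_eq_zero (h : ExpCoefficients T I f μ k₀ k₁ x₀ τ ξ A a₁ a₀ b₁ b₀)
    (hT : IsOpenInterval T) (hadm : IsAdmissible I J f D K) (hk₀ : k₀ ≠ 0) (hk₁ : k₁ ≠ 0)
    (hf : ¬ ∀ x ∈ I, deriv f x = 0) {t₁ : ℝ} (ht₁ : t₁ ∈ T) : a₁ t₁ = 0 := by
  have hI := hadm.interval_x
  by_contra ha
  have hinf := infinite_image_exp hI (neg_ne_zero.2 hk₁) x₀
  set z : ℝ → ℝ := fun x => Real.exp (-k₁ * (x - x₀)) with hz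
  have hz' : ∀ x, HasDerivAt z (-k₁ * z x) x := hasDerivAt_exp_mul_sub (-k₁) x₀
  have hz0 : ∀ x, z x ≠ 0 := fun x => Real.exp_ne_zero _
  have hκ : k₀ * k₁ * a₁ t₁ ≠ 0 := mul_ne_zero (mul_ne_zero hk₀ hk₁) ha
  set γ := -(deriv a₀ t₁) / (k₀ * k₁ * a₁ t₁) with hγ
  set δ := -(deriv a₁ t₁) / (k₀ * k₁ * a₁ t₁) with hδ
  have hfz : ∀ x ∈ I, f x * (γ + δ * z x) = z x := by
    intro x hx
    have e := h.eq_A t₁ ht₁ x hx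
    simp only [hγ, hδ]
    field_simp
    linear_combination -e
  have hγ0 : γ ≠ 0 := by
    intro h0
    refine hf (hI.eq_zero_of_hasDerivAt (c := 1 / δ)
      (fun x hx => (hadm.differentiableAt_f hx).hasDerivAt) fun x hx => ?_)
    have e := hfz x hx
    have e1 : f x * δ = 1 := by
      refine mul_right_cancel₀ (hz0 x) ?_
      rw [h0] at e
      linarith
    have hδ0 : δ ≠ 0 := fun h0 => by simp [h0] at e1
    rw [eq_div_iff hδ0, e1]
  have hfd : ∀ x ∈ I, deriv f x * (γ + δ * z x) = -k₁ * γ * f x := by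
    intro x hx
    have e := (((hadm.differentiableAt_f hx).hasDerivAt.mul
      (((hz' x).const_mul δ).const_add γ)).sub (hz' x))
    have e1 := e.unique ((hasDerivAt_const x (0 : ℝ)).congr_of_eventuallyEq
      (Filter.eventually_of_mem (hI.mem_nhds hx) fun y hy => by
        have := hfz y hy
        simp only [Pi.sub_apply, Pi.mul_apply]
        linarith))
    linear_combination e1 + k₁ * hfz x hx
  have hb₁ : ∀ t ∈ T, b₁ t = 0 := by
    intro t ht
    obtain ⟨e0, -, -, -⟩ := cubic_eq_zero hinf
      (a := k₁ * (γ * b₁ t))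
      (b := -(γ * k₁ * b₀ t) - γ * (a₀ t + deriv τ t) + 2 * δ * k₁ * b₁ t)
      (c := γ * (μ + 1) * a₁ t - γ * (-2 * μ - 1) * a₁ t - δ * (a₀ t + deriv τ t))
      (d := -δ * (-2 * μ - 1) * a₁ t) (by
        rintro _ ⟨x, hx, rfl⟩
        have e := h.eq_f t ht x hx
        refine mul_left_cancel₀ (mul_ne_zero hk₁ (hadm.f_ne_zero x hx)) ?_
        linear_combination (γ + δ * z x) * e - (-(μ + 1) * a₁ t * z x ^ 2 + k₁ * b₁ t
          + k₁ * b₀ t * z x) * hfd x hx)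
    exact (mul_eq_zero.1 ((mul_eq_zero.1 e0).resolve_left hk₁)).resolve_left hγ0
  have hb₁' : ∀ t ∈ T, deriv b₁ t = 0 :=
    hT.eq_zero_of_hasDerivAt (fun t ht => (h.diff_b₁ t ht).hasDerivAt) hb₁
  have ha₀ : ∀ t ∈ T, a₀ t = 0 := by
    intro t ht
    obtain ⟨e0, -, -, -⟩ := cubic_eq_zero hinf
      (a := k₀ * k₁ * (γ * a₀ t))
      (b := k₀ * k₁ * (δ * a₀ t - γ * μ * a₁ t) - k₁ * deriv b₀ t)
      (c := -(k₀ * k₁ * δ * μ * a₁ t) + (μ + 1) * deriv a₁ t)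
      (d := 0) (by
        rintro _ ⟨x, hx, rfl⟩
        have e := h.eq_ξ t ht x hx
        rw [hb₁ t ht, hb₁' t ht] at e
        refine mul_left_cancel₀ (hz0 x) ?_
        linear_combination -(γ + δ * z x) * e + (-(μ + 1) * deriv a₁ t * z x ^ 2
          + k₁ * deriv b₀ t * z x) * hfz x hx)
    exact (mul_eq_zero.1 ((mul_eq_zero.1 e0).resolve_left
      (mul_ne_zero hk₀ hk₁))).resolve_left hγ0
  refine hγ0 ?_
  rw [hγ, hT.eq_zero_of_hasDerivAt (fun t ht => (h.diff_a₀ t ht).hasDerivAt) ha₀ t₁ ht₁]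
  simp

theorem ExpCoefficients.b₁_eq_zero (h : ExpCoefficients T I f μ k₀ k₁ x₀ τ ξ A a₁ a₀ b₁ b₀)
    (hT : IsOpenInterval T) (hadm : IsAdmissible I J f D K) (hk₀ : k₀ ≠ 0) (hk₁ : k₁ ≠ 0)
    (ha₁ : ∀ t ∈ T, a₁ t = 0) {t : ℝ} (ht : t ∈ T) : b₁ t = 0 := by
  have hI := hadm.interval_x
  by_contra hb
  have hinf := infinite_image_exp hI (neg_ne_zero.2 hk₁) x₀
  set z : ℝ → ℝ := fun x => Real.exp (-k₁ * (x - x₀)) with hz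
  have hz' : ∀ x, HasDerivAt z (-k₁ * z x) x := hasDerivAt_exp_mul_sub (-k₁) x₀
  have hz0 : ∀ x, z x ≠ 0 := fun x => Real.exp_ne_zero _
  have ha₁' : deriv a₁ t = 0 :=
    hT.eq_zero_of_hasDerivAt (fun t ht => (h.diff_a₁ t ht).hasDerivAt) ha₁ t ht
  set β₁ := deriv b₁ t with hβ₁
  set β₀ := deriv b₀ t with hβ₀
  have hfM : ∀ x ∈ I, f x * (β₁ + β₀ * z x) = k₀ * (a₀ t * z x - k₁ * b₁ t) := by
    intro x hx
    have e := h.eq_ξ t ht x hx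
    rw [ha₁ t ht, ha₁'] at e
    refine mul_left_cancel₀ hk₁ ?_
    linear_combination e
  have hfd : ∀ x ∈ I, deriv f x * (β₁ + β₀ * z x) = k₁ * β₀ * z x * f x
      - k₁ * k₀ * a₀ t * z x := by
    intro x hx
    have e := (((hadm.differentiableAt_f hx).hasDerivAt.mul
      (((hz' x).const_mul β₀).const_add β₁)).sub
      ((((hz' x).const_mul (a₀ t)).sub_const (k₁ * b₁ t)).const_mul k₀))
    have e1 := e.unique ((hasDerivAt_const x (0 : ℝ)).congr_of_eventuallyEq
      (Filter.eventually_of_mem (hI.mem_nhds hx) fun y hy => by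
        have := hfM y hy
        simp only [Pi.sub_apply, Pi.mul_apply]
        linarith))
    linear_combination e1
  have hf : ∀ x ∈ I, (b₁ t + b₀ t * z x) * deriv f x
      = f x * ((a₀ t + deriv τ t) * z x - 2 * k₁ * b₁ t) := by
    intro x hx
    have e := h.eq_f t ht x hx
    rw [ha₁ t ht] at e
    refine mul_left_cancel₀ hk₁ ?_
    linear_combination e
  set c := -(k₁ * β₀ * b₁ t) - a₀ t * β₁ with hc
  have hpoly : ∀ x ∈ I, (b₁ t + b₀ t * z x) * (k₁ * z x * c)
      = (a₀ t * z x - k₁ * b₁ t) * (β₁ + β₀ * z x)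
        * ((a₀ t + deriv τ t) * z x - 2 * k₁ * b₁ t) := by
    intro x hx
    refine mul_left_cancel₀ hk₀ ?_
    simp only [hc]
    linear_combination (β₁ + β₀ * z x) ^ 2 * hf x hx
      - (b₁ t + b₀ t * z x) * (β₁ + β₀ * z x) * hfd x hx
      - (b₁ t + b₀ t * z x) * k₁ * z x * β₀ * hfM x hx
      + (β₁ + β₀ * z x) * ((a₀ t + deriv τ t) * z x - 2 * k₁ * b₁ t) * hfM x hx
  set s := a₀ t + deriv τ t with hs
  obtain ⟨e0, e1, -, -⟩ := cubic_eq_zero hinf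
    (a := -(2 * k₁ ^ 2 * b₁ t ^ 2 * β₁))
    (b := b₁ t * k₁ * c + k₁ * b₁ t * β₁ * s + 2 * k₁ * b₁ t * (a₀ t * β₁ - k₁ * b₁ t * β₀))
    (c := b₀ t * k₁ * c - s * (a₀ t * β₁ - k₁ * b₁ t * β₀) + 2 * k₁ * b₁ t * (a₀ t * β₀))
    (d := -(a₀ t * β₀ * s)) (by
      rintro _ ⟨x, hx, rfl⟩
      linear_combination hpoly x hx)
  have hβ₁0 : β₁ = 0 := by
    have : 2 * k₁ ^ 2 * b₁ t ^ 2 ≠ 0 := by positivity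
    exact (mul_eq_zero.1 (neg_eq_zero.1 e0)).resolve_left this
  have hβ₀0 : β₀ = 0 := by
    have h1 : 3 * k₁ ^ 2 * b₁ t ^ 2 ≠ 0 := by positivity
    refine (mul_eq_zero.1 (?_ : 3 * k₁ ^ 2 * b₁ t ^ 2 * β₀ = 0)).resolve_left h1
    rw [hc, hβ₁0] at e1
    linear_combination -e1
  obtain ⟨e2, -, -, -⟩ := cubic_eq_zero hinf (a := -(k₀ * k₁ * b₁ t)) (b := k₀ * a₀ t) (c := 0)
    (d := 0) (by
      rintro _ ⟨x, hx, rfl⟩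
      have e := hfM x hx
      rw [hβ₁0, hβ₀0] at e
      linear_combination -e)
  exact mul_ne_zero (mul_ne_zero hk₀ hk₁) hb (neg_eq_zero.1 e2)

end

theorem deriv_f_eq_zero_of_mul_ne_zero (h𝔤 : IsInvarianceAlgebra f D K (box T I J) 𝔤)
    (hT : IsOpenInterval T) (hadm : IsAdmissible I J f D K) (hdim : 4 ≤ Module.rank ℝ 𝔤)
    (hD' : ∃ u ∈ J, deriv D u ≠ 0) {k₁ k₀ : ℝ} (hK : ∀ u ∈ J, K u = k₁ * D u + k₀)
    (hk₀ : k₀ ≠ 0) (hk₁ : k₁ ≠ 0) {φ : ℝ → ℝ} {μ : ℝ}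
    (h : HasScaledCoefficients T I J f D K φ μ 𝔤) : ∀ x ∈ I, deriv f x = 0 := by
  have hI := hadm.interval_x
  by_contra hf
  obtain ⟨t₀, ht₀⟩ := hT.2.2
  obtain ⟨x₀, hx₀⟩ := hI.2.2
  obtain ⟨Q, hQ, hQ0, τ, ξ, A, hs, hτ, hξ, hA⟩ :=
    h.exists_vanishing hadm.interval_u hdim ht₀ hx₀
  obtain ⟨a₁, a₀, b₁, b₀, hc⟩ := hs.exists_expCoefficients hT hadm hD' hK hk₁ hx₀
  have ha₁ : ∀ t ∈ T, a₁ t = 0 := fun t ht => hc.a₁_eq_zero hT hadm hk₀ hk₁ hf ht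
  have hb₁ : ∀ t ∈ T, b₁ t = 0 := fun t ht => hc.b₁_eq_zero hT hadm hk₀ hk₁ ha₁ ht
  have ha₁' := hT.eq_zero_of_hasDerivAt (fun t ht => (hc.diff_a₁ t ht).hasDerivAt) ha₁
  have hb₁' := hT.eq_zero_of_hasDerivAt (fun t ht => (hc.diff_b₁ t ht).hasDerivAt) hb₁
  have hf₀ := hadm.f_ne_zero x₀ hx₀
  have hA' : ∀ t ∈ T, ∀ x ∈ I, A t x = a₀ t := fun t ht x hx => by
    rw [hc.A_eq t ht x hx, ha₁ t ht, zero_mul, zero_add]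
  have ha₀ : ∀ t ∈ T, a₀ t = 0 := by
    intro t ht
    rw [← hA, hA' t₀ ht₀ x₀ hx₀]
    refine hT.eq_of_hasDerivAt_zero (fun s hs => ?_) ht ht₀
    have e := hc.eq_A s hs x₀ hx₀
    rw [ha₁ s hs, ha₁' s hs] at e
    have e1 : f x₀ * deriv a₀ s = 0 := by linarith
    have e2 := (hc.diff_a₀ s hs).hasDerivAt
    rwa [(mul_eq_zero.1 e1).resolve_left hf₀] at e2
  have hξ' : ∀ t ∈ T, ∀ x ∈ I, ξ t x = b₀ t := by
    intro t ht x hx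
    have e := hc.ξ_mul t ht x hx
    rw [ha₁ t ht, hb₁ t ht] at e
    refine mul_left_cancel₀ hk₁ (mul_right_cancel₀ (Real.exp_ne_zero (-k₁ * (x - x₀))) ?_)
    linear_combination e
  have hb₀ : ∀ t ∈ T, b₀ t = 0 := by
    intro t ht
    rw [← hξ, hξ' t₀ ht₀ x₀ hx₀]
    refine hT.eq_of_hasDerivAt_zero (fun s hs => ?_) ht ht₀
    have e := hc.eq_ξ s hs x₀ hx₀
    rw [ha₁ s hs, ha₁' s hs, hb₁ s hs, hb₁' s hs, ha₀ s hs] at e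
    simp only [sub_self, mul_zero, Real.exp_zero] at e
    have e1 : (f x₀ * k₁) * deriv b₀ s = 0 := by linarith
    have e2 := (hc.diff_b₀ s hs).hasDerivAt
    rwa [(mul_eq_zero.1 e1).resolve_left (mul_ne_zero hf₀ hk₁)] at e2
  exact hQ0 (hs.eq_zero h𝔤 hT hadm hQ ht₀ hτ (fun t ht x hx => by rw [hξ' t ht x hx, hb₀ t ht])
    fun t ht x hx => by rw [hA' t ht x hx, ha₀ t ht])

end

section

variable {T I J : Set ℝ} {f D K : ℝ → ℝ} {𝔤 : Submodule ℝ (PointSpace → PointSpace)}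

/-! ### The case of a nonzero constant `K` -/

/-- Coefficients of a vector field in the case `K = k₀`, in terms of `x - x₀`. -/
structure PolynomialCoefficients (T I : Set ℝ) (f : ℝ → ℝ) (μ k₀ x₀ : ℝ) (τ : ℝ → ℝ)
    (ξ A : ℝ → ℝ → ℝ) (a₁ a₀ b₁ b₀ : ℝ → ℝ) : Prop where
  diff_a₁ : ∀ t ∈ T, DifferentiableAt ℝ a₁ t
  diff_a₀ : ∀ t ∈ T, DifferentiableAt ℝ a₀ t
  diff_b₁ : ∀ t ∈ T, DifferentiableAt ℝ b₁ t
  diff_b₀ : ∀ t ∈ T, DifferentiableAt ℝ b₀ t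
  A_eq : ∀ t ∈ T, ∀ x ∈ I, A t x = a₁ t * (x - x₀) + a₀ t
  ξ_eq : ∀ t ∈ T, ∀ x ∈ I, ξ t x = (μ + 1) * a₁ t * (x - x₀) ^ 2 + b₁ t * (x - x₀) + b₀ t
  eq_A : ∀ t ∈ T, ∀ x ∈ I, f x * (deriv a₁ t * (x - x₀) + deriv a₀ t) = k₀ * a₁ t
  eq_ξ : ∀ t ∈ T, ∀ x ∈ I, f x * ((μ + 1) * deriv a₁ t * (x - x₀) ^ 2
      + deriv b₁ t * (x - x₀) + deriv b₀ t)
    = k₀ * ((-2 * μ - 1) * a₁ t * (x - x₀) + a₀ t - b₁ t)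
  eq_f : ∀ t ∈ T, ∀ x ∈ I,
    ((μ + 1) * a₁ t * (x - x₀) ^ 2 + b₁ t * (x - x₀) + b₀ t) * deriv f x
    = f x * ((-4 * μ - 3) * a₁ t * (x - x₀) + a₀ t + deriv τ t - 2 * b₁ t)

theorem ScaledCoefficients.exists_polynomialCoefficients {φ : ℝ → ℝ} {μ k₀ x₀ : ℝ}
    {Q : PointSpace → PointSpace} {τ : ℝ → ℝ}
    {ξ A : ℝ → ℝ → ℝ} (h : ScaledCoefficients T I J f D K φ μ Q τ ξ A) (hT : IsOpenInterval T)
    (hadm : IsAdmissible I J f D K) (hD' : ∃ u ∈ J, deriv D u ≠ 0)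
    (hK : ∀ u ∈ J, K u = k₀) (hx₀ : x₀ ∈ I) :
    ∃ a₁ a₀ b₁ b₀, PolynomialCoefficients T I f μ k₀ x₀ τ ξ A a₁ a₀ b₁ b₀ := by
  have hI := hadm.interval_x
  have hlin := fun (t : ℝ) (ht : t ∈ T) (x : ℝ) (hx : x ∈ I) =>
    h.of_linear_relation hadm hD' (k₁ := 0) (k₀ := k₀) (fun u hu => by rw [hK u hu]; ring) ht hx
  have hy' : ∀ x, HasDerivAt (fun x => x - x₀) 1 x := fun x => (hasDerivAt_id' x).sub_const x₀
  have hexp : ∀ s, expInt 0 s = s := fun s => by simp [expInt]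
  have hAt := fun (t : ℝ) (ht : t ∈ T) (x : ℝ) (hx : x ∈ I) =>
    (h.smooth_A.hasDerivAt_t hT ht hx).differentiableAt
  have hξt := fun (t : ℝ) (ht : t ∈ T) (x : ℝ) (hx : x ∈ I) =>
    (h.smooth_ξ.hasDerivAt_t hT ht hx).differentiableAt
  obtain ⟨a₁, da₁, hA⟩ := exists_coefficients_of_deriv_deriv (m := 0) hI hx₀
    (fun t ht x hx => h.smooth_A.hasDerivAt_x hI ht hx)
    (fun t ht x hx => by
      have e := h.smooth_A.hasDerivAt_deriv_x hI ht hx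
      rwa [(hlin t ht x hx).1, neg_zero] at e) hAt
  set a₀ : ℝ → ℝ := fun t => A t x₀ with ha₀
  have da₀ : ∀ t ∈ T, DifferentiableAt ℝ a₀ t := fun t ht => hAt t ht x₀ hx₀
  simp only [hexp] at hA
  have hAx : ∀ t ∈ T, ∀ x ∈ I, deriv (A t) x = a₁ t := by
    intro t ht x hx
    have e := (((hy' x).const_mul (a₁ t)).add_const (a₀ t)).congr_of_eventuallyEq
      (Filter.eventually_of_mem (hI.mem_nhds hx) (hA t ht))
    rw [e.deriv, mul_one]
  obtain ⟨b₁, db₁, hξ⟩ := exists_coefficients_of_deriv_deriv (m := 0) hI hx₀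
    (g := fun t x => ξ t x - (μ + 1) * a₁ t * (x - x₀) ^ 2)
    (gx := fun t x => deriv (ξ t) x - 2 * (μ + 1) * a₁ t * (x - x₀))
    (fun t ht x hx => by
      refine ((h.smooth_ξ.hasDerivAt_x hI ht hx).sub
        (((hy' x).pow 2).const_mul ((μ + 1) * a₁ t))).congr_deriv ?_
      simp only [Nat.cast_ofNat]
      ring)
    (fun t ht x hx => by
      refine ((h.smooth_ξ.hasDerivAt_deriv_x hI ht hx).sub
        ((hy' x).const_mul (2 * (μ + 1) * a₁ t))).congr_deriv ?_
      rw [(hlin t ht x hx).2.2.1, hAx t ht x hx]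
      ring)
    (fun t ht x hx => (hξt t ht x hx).sub (((da₁ t ht).const_mul _).mul_const _))
  set b₀ : ℝ → ℝ := fun t => ξ t x₀ with hb₀
  have db₀ : ∀ t ∈ T, DifferentiableAt ℝ b₀ t := fun t ht => hξt t ht x₀ hx₀
  replace hξ : ∀ t ∈ T, ∀ x ∈ I,
      ξ t x = (μ + 1) * a₁ t * (x - x₀) ^ 2 + b₁ t * (x - x₀) + b₀ t := by
    intro t ht x hx
    have e := hξ t ht x hx
    simp only [hexp, sub_self] at e
    linear_combination e
  have hξx : ∀ t ∈ T, ∀ x ∈ I, deriv (ξ t) x = 2 * (μ + 1) * a₁ t * (x - x₀) + b₁ t := by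
    intro t ht x hx
    have e := (((((hy' x).pow 2).const_mul ((μ + 1) * a₁ t)).add
      ((hy' x).const_mul (b₁ t))).add_const (b₀ t)).congr_of_eventuallyEq
      (Filter.eventually_of_mem (hI.mem_nhds hx) (hξ t ht))
    rw [e.deriv]
    simp only [Nat.cast_ofNat]
    ring
  have hξt' : ∀ t ∈ T, ∀ x ∈ I, deriv (fun s => ξ s x) t
      = (μ + 1) * deriv a₁ t * (x - x₀) ^ 2 + deriv b₁ t * (x - x₀) + deriv b₀ t := by
    intro t ht x hx
    exact (((((da₁ t ht).hasDerivAt.const_mul (μ + 1)).mul_const ((x - x₀) ^ 2)).add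
      ((db₁ t ht).hasDerivAt.mul_const (x - x₀))).add
      (db₀ t ht).hasDerivAt |>.congr_of_eventuallyEq
      (Filter.eventually_of_mem (hT.mem_nhds ht) fun s hs => hξ s hs x hx)).deriv
  have hAt' : ∀ t ∈ T, ∀ x ∈ I,
      deriv (fun s => A s x) t = deriv a₁ t * (x - x₀) + deriv a₀ t := by
    intro t ht x hx
    exact (((da₁ t ht).hasDerivAt.mul_const (x - x₀)).add
      (da₀ t ht).hasDerivAt |>.congr_of_eventuallyEq
      (Filter.eventually_of_mem (hT.mem_nhds ht) fun s hs => hA s hs x hx)).deriv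
  refine ⟨a₁, a₀, b₁, b₀, da₁, da₀, db₁, db₀, hA, hξ, fun t ht x hx => ?_,
    fun t ht x hx => ?_, fun t ht x hx => ?_⟩
  · have e := (hlin t ht x hx).2.1
    rwa [hAt' t ht x hx, hAx t ht x hx] at e
  · have e := (hlin t ht x hx).2.2.2
    rw [hξt' t ht x hx, hA t ht x hx, hξx t ht x hx] at e
    linear_combination e
  · have e := h.eq_uxx t ht x hx
    rw [hξ t ht x hx, hA t ht x hx, hξx t ht x hx] at e
    linear_combination e

/-- The reciprocal of a function with nonzero derivative, if affine, is not constant. -/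
theorem IsAdmissible.of_mul_affine_eq_one (hadm : IsAdmissible I J f D K) {γ δ x₀ : ℝ}
    (h : ∀ x ∈ I, f x * (γ + δ * (x - x₀)) = 1) (hf : ¬ ∀ x ∈ I, deriv f x = 0) :
    δ ≠ 0 ∧ ∀ x ∈ I, deriv f x * (γ + δ * (x - x₀)) = -δ * f x := by
  have hI := hadm.interval_x
  have hfd : ∀ x ∈ I, deriv f x * (γ + δ * (x - x₀)) = -δ * f x := by
    intro x hx
    have e := (hadm.differentiableAt_f hx).hasDerivAt.mul
      ((((hasDerivAt_id' x).sub_const x₀).const_mul δ).const_add γ)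
    have e1 := e.unique ((hasDerivAt_const x (1 : ℝ)).congr_of_eventuallyEq
      (Filter.eventually_of_mem (hI.mem_nhds hx) h))
    linear_combination e1
  refine ⟨fun h0 => hf fun x hx => ?_, hfd⟩
  have e := hfd x hx
  have e1 := h x hx
  rw [h0] at e e1
  have e2 : deriv f x * γ = 0 := by linarith
  refine (mul_eq_zero.1 e2).resolve_right fun hγ => ?_
  rw [hγ] at e1
  simp at e1

theorem PolynomialCoefficients.of_a₁_ne_zero {μ k₀ x₀ : ℝ} {τ : ℝ → ℝ} {ξ A : ℝ → ℝ → ℝ}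
    {a₁ a₀ b₁ b₀ : ℝ → ℝ} (h : PolynomialCoefficients T I f μ k₀ x₀ τ ξ A a₁ a₀ b₁ b₀)
    (hadm : IsAdmissible I J f D K) (hk₀ : k₀ ≠ 0)
    (hf : ¬ ∀ x ∈ I, deriv f x = 0) {t : ℝ} (ht : t ∈ T) (ha : a₁ t ≠ 0) :
    μ = -2 / 3 ∧ ∃ c d : ℝ, d ≠ 0 ∧ ∀ x ∈ I, f x * (c + d * x) = 1 := by
  have hI := hadm.interval_x
  set γ := deriv a₀ t / (k₀ * a₁ t) with hγ
  set δ := deriv a₁ t / (k₀ * a₁ t) with hδ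
  have hfy : ∀ x ∈ I, f x * (γ + δ * (x - x₀)) = 1 := by
    intro x hx
    have e := h.eq_A t ht x hx
    simp only [hγ, hδ]
    field_simp
    linear_combination e
  obtain ⟨hδ0, hfd⟩ := hadm.of_mul_affine_eq_one hfy hf
  refine ⟨?_, γ - δ * x₀, δ, hδ0, fun x hx => by linear_combination hfy x hx⟩
  set s := a₀ t + deriv τ t - 2 * b₁ t with hs
  obtain ⟨-, -, e, -⟩ := cubic_eq_zero
    (hI.infinite.image (sub_left_injective (b := x₀)).injOn)
    (a := -δ * b₀ t - γ * s)
    (b := -δ * b₁ t - δ * s - γ * ((-4 * μ - 3) * a₁ t))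
    (c := -δ * ((μ + 1) * a₁ t) - δ * ((-4 * μ - 3) * a₁ t)) (d := 0) (by
      rintro _ ⟨x, hx, rfl⟩
      refine mul_left_cancel₀ (hadm.f_ne_zero x hx) ?_
      linear_combination (γ + δ * (x - x₀)) * h.eq_f t ht x hx
        - ((μ + 1) * a₁ t * (x - x₀) ^ 2 + b₁ t * (x - x₀) + b₀ t) * hfd x hx)
  have e1 : 3 * μ + 2 = 0 :=
    (mul_eq_zero.1 (by linear_combination e : δ * a₁ t * (3 * μ + 2) = 0)).resolve_left
      (mul_ne_zero hδ0 ha)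
  linarith

theorem inverse_linear_of_const (h𝔤 : IsInvarianceAlgebra f D K (box T I J) 𝔤)
    (hT : IsOpenInterval T) (hadm : IsAdmissible I J f D K) (hdim : 4 ≤ Module.rank ℝ 𝔤)
    (hD' : ∃ u ∈ J, deriv D u ≠ 0) {k₀ : ℝ} (hK : ∀ u ∈ J, K u = k₀)
    (hk₀ : k₀ ≠ 0) {φ : ℝ → ℝ} {μ : ℝ}
    (h : HasScaledCoefficients T I J f D K φ μ 𝔤) (hf : ¬ ∀ x ∈ I, deriv f x = 0) :
    μ = -2 / 3 ∧ ∃ c d : ℝ, d ≠ 0 ∧ ∀ x ∈ I, f x * (c + d * x) = 1 := by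
  have hI := hadm.interval_x
  by_contra hcon
  obtain ⟨t₀, ht₀⟩ := hT.2.2
  obtain ⟨x₀, hx₀⟩ := hI.2.2
  have hf₀ := hadm.f_ne_zero x₀ hx₀
  have hzero : ∀ {τ ξ A a₁ a₀ b₁ b₀},
      PolynomialCoefficients T I f μ k₀ x₀ τ ξ A a₁ a₀ b₁ b₀ →
      ∀ t ∈ T, a₁ t = 0 ∧ deriv a₁ t = 0 ∧ deriv a₀ t = 0 := by
    intro τ ξ A a₁ a₀ b₁ b₀ hc
    have ha₁ : ∀ t ∈ T, a₁ t = 0 := fun t ht => by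
      by_contra ha
      exact hcon (hc.of_a₁_ne_zero hadm hk₀ hf ht ha)
    have ha₁' := hT.eq_zero_of_hasDerivAt (fun t ht => (hc.diff_a₁ t ht).hasDerivAt) ha₁
    refine fun t ht => ⟨ha₁ t ht, ha₁' t ht, ?_⟩
    have e := hc.eq_A t ht x₀ hx₀
    rw [ha₁ t ht, ha₁' t ht, zero_mul, zero_add, mul_zero] at e
    exact (mul_eq_zero.1 e).resolve_left hf₀
  obtain ⟨Q, hQ, hQ0, τ, ξ, A, hs, hτ, hξ, hA⟩ :=
    h.exists_vanishing hadm.interval_u hdim ht₀ hx₀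
  obtain ⟨a₁, a₀, b₁, b₀, hc⟩ := hs.exists_polynomialCoefficients hT hadm hD' hK hx₀
  have ha₁ := hzero hc
  have hA' : ∀ t ∈ T, ∀ x ∈ I, A t x = a₀ t := fun t ht x hx => by
    rw [hc.A_eq t ht x hx, (ha₁ t ht).1, zero_mul, zero_add]
  have ha₀ : ∀ t ∈ T, a₀ t = 0 := by
    intro t ht
    rw [← hA, hA' t₀ ht₀ x₀ hx₀]
    refine hT.eq_of_hasDerivAt_zero (fun s hs => ?_) ht ht₀
    have e := (hc.diff_a₀ s hs).hasDerivAt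
    rwa [(ha₁ s hs).2.2] at e
  have hξ' : ∀ t ∈ T, ∀ x ∈ I, ξ t x = b₁ t * (x - x₀) + b₀ t := by
    intro t ht x hx
    have e := hc.ξ_eq t ht x hx
    rw [(ha₁ t ht).1] at e
    linear_combination e
  have hb₀ : b₀ t₀ = 0 := by
    have e := hξ' t₀ ht₀ x₀ hx₀
    rw [hξ, sub_self, mul_zero, zero_add] at e
    exact e.symm
  have heq : ∀ t ∈ T, ∀ x ∈ I, f x * (deriv b₁ t * (x - x₀) + deriv b₀ t) = -k₀ * b₁ t := by
    intro t ht x hx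
    have e := hc.eq_ξ t ht x hx
    rw [(ha₁ t ht).1, (ha₁ t ht).2.1, ha₀ t ht] at e
    linear_combination e
  suffices hb : (∀ t ∈ T, b₁ t = 0) ∧ ∀ t ∈ T, b₀ t = 0 from
    hQ0 (hs.eq_zero h𝔤 hT hadm hQ ht₀ hτ
      (fun t ht x hx => by rw [hξ' t ht x hx, hb.1 t ht, hb.2 t ht]; ring)
      fun t ht x hx => by rw [hA' t ht x hx, ha₀ t ht])
  by_cases hall : ∀ t ∈ T, b₁ t = 0
  · refine ⟨hall, fun t ht => ?_⟩
    rw [← hb₀]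
    refine hT.eq_of_hasDerivAt_zero (fun s hs => ?_) ht ht₀
    have e := heq s hs x₀ hx₀
    rw [hall s hs, sub_self, mul_zero, mul_zero, zero_add] at e
    have e2 := (hc.diff_b₀ s hs).hasDerivAt
    rwa [(mul_eq_zero.1 e).resolve_left hf₀] at e2
  push Not at hall
  obtain ⟨t₁, ht₁, hne⟩ := hall
  set γ := -(deriv b₀ t₁) / (k₀ * b₁ t₁) with hγ
  set δ := -(deriv b₁ t₁) / (k₀ * b₁ t₁) with hδ
  have hfy : ∀ x ∈ I, f x * (γ + δ * (x - x₀)) = 1 := by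
    intro x hx
    have e := heq t₁ ht₁ x hx
    simp only [hγ, hδ]
    field_simp
    linear_combination -e
  obtain ⟨hδ0, hfd⟩ := hadm.of_mul_affine_eq_one hfy hf
  have hinf := hI.infinite.image (sub_left_injective (b := x₀)).injOn
  have hb₁' : ∀ t ∈ T, deriv b₁ t = -k₀ * δ * b₁ t := by
    intro t ht
    obtain ⟨-, e, -, -⟩ := cubic_eq_zero hinf (a := deriv b₀ t + k₀ * γ * b₁ t)
      (b := deriv b₁ t + k₀ * δ * b₁ t) (c := 0) (d := 0) (by
        rintro _ ⟨x, hx, rfl⟩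
        linear_combination (γ + δ * (x - x₀)) * heq t ht x hx
          - (deriv b₁ t * (x - x₀) + deriv b₀ t) * hfy x hx)
    linarith
  have hγb : ∀ t ∈ T, δ * b₀ t = γ * b₁ t := by
    intro t ht
    obtain ⟨e0, e1, -, -⟩ := cubic_eq_zero hinf
      (a := -δ * b₀ t - γ * (deriv τ t - 2 * b₁ t))
      (b := -δ * b₁ t - δ * (deriv τ t - 2 * b₁ t)) (c := 0) (d := 0) (by
        rintro _ ⟨x, hx, rfl⟩
        have e := hc.eq_f t ht x hx
        rw [(ha₁ t ht).1, ha₀ t ht] at e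
        refine mul_left_cancel₀ (hadm.f_ne_zero x hx) ?_
        linear_combination (γ + δ * (x - x₀)) * e - (b₁ t * (x - x₀) + b₀ t) * hfd x hx)
    have e2 : deriv τ t - b₁ t = 0 :=
      (mul_eq_zero.1 (by linear_combination -e1 : δ * (deriv τ t - b₁ t) = 0)).resolve_left hδ0
    linear_combination -e0 - γ * e2
  have hγ0 : γ ≠ 0 := by
    intro h0
    have e := hfy x₀ hx₀
    rw [h0] at e
    simp at e
  have hb₁₀ : b₁ t₀ = 0 := by
    have e := hγb t₀ ht₀
    rw [hb₀, mul_zero] at e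
    exact (mul_eq_zero.1 e.symm).resolve_left hγ0
  refine (hne ?_).elim
  have e := hT.eq_mul_exp (g := b₁) (m := -k₀ * δ)
    (fun t ht => by rw [← hb₁' t ht]; exact (hc.diff_b₁ t ht).hasDerivAt) ht₀ ht₁
  rw [e, hb₁₀, zero_mul]

end

theorem theorem4 (T I J : Set ℝ) (f D K : ℝ → ℝ)
    (hT : IsOpenInterval T) (hadm : IsAdmissible I J f D K)
    (𝔤 : Submodule ℝ (PointSpace → PointSpace))
    (h𝔤 : IsInvarianceAlgebra f D K (box T I J) 𝔤)
    (hdim : 4 ≤ Module.rank ℝ 𝔤) :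
    ∃ (I₁ J₁ : Set ℝ) (D₁ K₁ : ℝ → ℝ)
      (Φ : OpenPartialHomeomorph PointSpace PointSpace),
      IsAdmissible I₁ J₁ (fun _ => 1) D₁ K₁ ∧
      IsPointTransformation (box T I J) Φ ∧
      (∀ p ∈ box T I J, (Φ p).2.1 ∈ I₁ ∧ (Φ p).2.2 ∈ J₁) ∧
      MapsEquation (box T I J) Φ f D K (fun _ => 1) D₁ K₁ := by
  change IsReducible T I J f D K
  by_cases hf : ∀ x ∈ I, deriv f x = 0
  · exact isReducible_of_const hT hadm hf
  by_cases hD' : ∀ u ∈ J, deriv D u = 0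
  · exact isReducible_of_const hT hadm (deriv_f_eq_zero_of_const hT hadm h𝔤 hdim hD')
  push Not at hD'
  obtain ⟨μ, ν, hD, h⟩ | ⟨hη, h⟩ := exists_scaledCoefficients h𝔤 hT hadm hD' <;>
    obtain ⟨k₁, k₀, hK⟩ := exists_linear_relation h𝔤 hT hadm hdim hD' h <;>
    by_cases hk₀ : k₀ = 0
  · exact isReducible_of_homogeneous h𝔤 hT hadm hdim hD'
      (fun u hu => by rw [hK u hu, hk₀, add_zero]) hD h
  · by_cases hk₁ : k₁ = 0
    · have hK' : ∀ u ∈ J, K u = k₀ := fun u hu => by rw [hK u hu, hk₁, zero_mul, zero_add]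
      obtain ⟨rfl, c, d, hd, hcd⟩ := inverse_linear_of_const h𝔤 hT hadm hdim hD' hK' hk₀ h hf
      exact isReducible_of_inverse_linear hT hadm hD hK' hk₀ hd hcd
    · exact (hf (deriv_f_eq_zero_of_mul_ne_zero h𝔤 hT hadm hdim hD' hK hk₀ hk₁ h)).elim
  · exact (false_of_eta_eq_zero h𝔤 hT hadm hdim hD'
      (fun u hu => by rw [hK u hu, hk₀, add_zero]) hη).elim
  · by_cases hk₁ : k₁ = 0
    · have hK' : ∀ u ∈ J, K u = k₀ := fun u hu => by rw [hK u hu, hk₁, zero_mul, zero_add]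
      have e := (inverse_linear_of_const h𝔤 hT hadm hdim hD' hK' hk₀ h hf).1
      norm_num at e
    · exact (hf (deriv_f_eq_zero_of_mul_ne_zero h𝔤 hT hadm hdim hD' hK hk₀ hk₁ h)).elim
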